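/- **Setting.** Let $\mathbb F_q$ be a finite field with $q$ elements, $k=\mathbb F_q(T)$, $k_\infty=\mathbb F_q(\!(1/T)\!)$ with $|T|_\infty=q$, $\mathbb C_\infty$ the completion of an algebraic closure of $k_\infty$, $\bar k$ the algebraic closure of $k$ in $\mathbb C_\infty$, and let $\mathbb C_\infty\{t\}$ be the ring of power series $\sum a_nt^n$ with $a_n\in\mathbb C_\infty$, $|a_n|_\infty\to 0$. For $f=\sum a_nt^n$ put $f^{(-1)}=\sum a_n^{1/q}t^n$. Let $\bar k[t,\sigma]$ be the ring of polynomials $\sum a_i\sigma^i$ with $a_i\in\bar k[t]$ and $\sigma a=a^{(-1)}\sigma$, and $\bar k[\sigma]$ its subring of those with $a_i\in\bar k$. A *dual $t$-motive* is a left $\bar k[t,\sigma]$-module $H$ that is free of finite rank over $\bar k[t]$ and over $\bar k[\sigma]$ and satisfies $(t-T)^nH\subset\sigma H$ for $n\gg0$. A submodule $N\subset H$ is *saturated* if it contains every $\bar k[\sigma]$-submodule and every $\bar k[t]$-submodule $N'\subset H$ with $\dim_{\bar k}(N'+N)/N<\infty$; $H$ is *simple* if $H\ne0$ and its only saturated $\bar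 k[t,\sigma]$-submodules are $0$ and $H$. Put $\tilde H=\mathbb C_\infty\{t\}\otimes_{\bar k[t]}H$ with $\sigma(f\otimes h)=f^{(-1)}\otimes\sigma h$, and let $H^{\mathrm{Betti}}$ be the $\mathbb F_q[t]$-module of $\sigma$-invariants of $\tilde H$; $H$ is *rigid analytically trivial* if the natural map $\mathbb C_\infty\{t\}\otimes_{\mathbb F_q[t]}H^{\mathrm{Betti}}\to\tilde H$ is bijective. A *GCM $\mathbb F_q[t]$-algebra* is an $\mathbb F_q[t]$-algebra $\mathbf L$, free of finite rank as an $\mathbb F_q[t]$-module, such that $\mathbf L$ and $\overline{\mathbf L}:=\bar k\otimes_{\mathbb F_q}\mathbf L$ are Dedekind domains. Let $a\mapsto a^{(-1)}$ be the $\mathbf L$-linear extension of $x\mapsto x^{1/q}$ to $\overline{\mathbf L}$ and $\overline{\mathbf L}[\sigma]$ the ring of polynomials $\sum a_i\sigma^i$ with $a_i\in\overline{\mathbf L}$ and $\sigma a=a^{(-1)}\sigma$. A *dual $t$-motive with GCM by $\mathbf L$* is a left $\overline{\mathbf L}[\sigma]$-module $H$ that is projective of rank one over $\overline{\mathbf L}$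 and whose underlying $\bar k[t,\sigma]$-module (the *bare* dual $t$-motive) is a dual $t$-motive. The GCM is *tight* if the natural map $\mathbf L\to\mathrm{End}_{\bar k[t,\sigma]}(H)$ is bijective. The *GCM type* of $H$ with respect to $\mathbf L$ is the annihilator in $\overline{\mathbf L}$ of $H/\sigma H$. **Theorem.** Let $\mathbf L$ be a GCM $\mathbb F_q[t]$-algebra and let $H$ be a dual $t$-motive with GCM by $\mathbf L$ whose underlying bare dual $t$-motive is rigid analytically trivial. Put $$\mathbf R:=\mathrm{End}_{\bar k[t,\sigma]}(H),\qquad \mathbf K:=\{x\in\mathbf L\mid (h\mapsto xh)\in\mathrm{End}_{\mathbf R}(H)\}.$$ Then $\mathbf K$ is a GCM $\mathbb F_q[t]$-subalgebra of $\mathbf L$, and there exists a $\overline{\mathbf K}[\sigma]$-submodule $H_0\subset H$ such that - $H_0$ is a dual $t$-motive with tight GCM by $\mathbf K$; - the bare dual $t$-motive underlying $H_0$ is simple and rigid analytically trivial; - the GCM type of $H$ with respect to $\mathbf L$ is generated, as an ideal of $\overline{\mathbf L}$, by the GCM type of $H_0$ with respect to $\mathbf K$. -/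

import Mathlib

open Polynomial TensorProduct

noncomputable section

namespace DualTMotive

/-! ### The fields `k_∞`, `ℂ_∞` and `k̄` -/

section Fields

variable (Fq : Type*) [Field Fq]

open scoped Classical in
/-- `k_∞ = 𝔽_q((1/T))`, the completion of `k = 𝔽_q(T)` at the infinite place. -/
def KInfty := RatFunc.CompletionAtInfty Fq

open scoped Classical in
instance : Field (KInfty Fq) := inferInstanceAs (Field (RatFunc.CompletionAtInfty Fq))

open scoped Classical in
instance : Algebra (RatFunc Fq) (KInfty Fq) :=
  inferInstanceAs (Algebra (RatFunc Fq) (RatFunc.CompletionAtInfty Fq))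

open scoped Classical in
instance : Valued (KInfty Fq) (WithZero (Multiplicative ℤ)) :=
  inferInstanceAs (Valued (RatFunc.CompletionAtInfty Fq) (WithZero (Multiplicative ℤ)))

open scoped Classical in
theorem valuation_algebraMap (x : RatFunc Fq) :
    Valued.v (algebraMap (RatFunc Fq) (KInfty Fq) x) = RatFunc.inftyValuation Fq x := by
  change Valued.v (algebraMap (RatFunc Fq) (RatFunc.CompletionAtInfty Fq) x) = _
  rw [RatFunc.valuedCompletionAtInfty.def]
  let := RatFunc.inftyValued Fq
  exact Valued.extensionValuation_apply_coe x

variable [Fintype Fq]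

theorem one_lt_card : (1 : NNReal) < (Fintype.card Fq : NNReal) := by
  exact_mod_cast Fintype.one_lt_card

/-- The valuation of `k_∞` as a real-valued absolute value, normalized by `|T|_∞ = q`. -/
instance : Valuation.RankOne (Valued.v (R := KInfty Fq)) where
  hom' := (WithZeroMulInt.toNNReal (one_lt_card Fq).ne_zero).comp
    MonoidWithZeroHom.ValueGroup₀.embedding
  strictMono' := (WithZeroMulInt.toNNReal_strictMono (one_lt_card Fq)).comp
    MonoidWithZeroHom.ValueGroup₀.embedding_strictMono
  exists_val_nontrivial := by
    refine ⟨algebraMap (RatFunc Fq) (KInfty Fq) RatFunc.X, ?_⟩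
    rw [valuation_algebraMap, RatFunc.inftyValuation.X]
    simp

instance : NontriviallyNormedField (KInfty Fq) :=
  Valued.toNontriviallyNormedField (KInfty Fq) (WithZero (Multiplicative ℤ))

instance : IsUltrametricDist (KInfty Fq) :=
  Valued.instIsUltrametricDist (KInfty Fq) (WithZero (Multiplicative ℤ))

open scoped Classical in
instance : CompleteSpace (KInfty Fq) :=
  inferInstanceAs (CompleteSpace (@UniformSpace.Completion (RatFunc Fq)
    (RatFunc.inftyValued Fq).toUniformSpace))

theorem norm_T : ‖algebraMap (RatFunc Fq) (KInfty Fq) RatFunc.X‖ = Fintype.card Fq := by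
  change ((WithZeroMulInt.toNNReal (one_lt_card Fq).ne_zero
    (MonoidWithZeroHom.ValueGroup₀.embedding
      (Valued.v.restrict (algebraMap (RatFunc Fq) (KInfty Fq) RatFunc.X))) : NNReal) : ℝ) = _
  rw [Valuation.embedding_restrict, valuation_algebraMap, RatFunc.inftyValuation.X,
    WithZeroMulInt.toNNReal_neg_apply _ WithZero.exp_ne_zero]
  simp [WithZero.exp]

/-- `\overline{k_∞}`, an algebraic closure of `k_∞`. -/
abbrev KInftyBar := AlgebraicClosure (KInfty Fq)

/-- `\overline{k_∞}` carries the unique extension of the absolute value of `k_∞`. -/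
instance : NontriviallyNormedField (KInftyBar Fq) :=
  spectralNorm.nontriviallyNormedField (KInfty Fq) (KInftyBar Fq)

instance : NormedAlgebra (KInfty Fq) (KInftyBar Fq) := spectralNorm.normedAlgebra _ _

instance : IsUltrametricDist (KInftyBar Fq) :=
  IsUltrametricDist.isUltrametricDist_of_forall_norm_add_le_max_norm
    (isNonarchimedean_spectralNorm (K := KInfty Fq) (L := KInftyBar Fq))

/-- `ℂ_∞`, the completion of `\overline{k_∞}`. -/
def CInfty := UniformSpace.Completion (KInftyBar Fq)

instance : NormedField (CInfty Fq) :=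
  inferInstanceAs (NormedField (UniformSpace.Completion (KInftyBar Fq)))

instance : CompleteSpace (CInfty Fq) :=
  inferInstanceAs (CompleteSpace (UniformSpace.Completion (KInftyBar Fq)))

/-- The inclusion of `\overline{k_∞}` into `ℂ_∞`. -/
instance : NormedAlgebra (KInftyBar Fq) (CInfty Fq) :=
  inferInstanceAs (NormedAlgebra (KInftyBar Fq) (UniformSpace.Completion (KInftyBar Fq)))

theorem denseRange_algebraMap : DenseRange (algebraMap (KInftyBar Fq) (CInfty Fq)) :=
  UniformSpace.Completion.denseRange_coe (α := KInftyBar Fq)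

instance : IsUltrametricDist (CInfty Fq) := IsUltrametricDist.of_normedAlgebra (KInftyBar Fq)

instance : Algebra (RatFunc Fq) (CInfty Fq) :=
  ((algebraMap (KInftyBar Fq) (CInfty Fq)).comp
    ((algebraMap (KInfty Fq) (KInftyBar Fq)).comp (algebraMap (RatFunc Fq) (KInfty Fq)))).toAlgebra

instance : Algebra Fq (CInfty Fq) :=
  ((algebraMap (RatFunc Fq) (CInfty Fq)).comp (algebraMap Fq (RatFunc Fq))).toAlgebra

instance : IsScalarTower Fq (RatFunc Fq) (CInfty Fq) := IsScalarTower.of_algebraMap_eq' rfl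

/-- `k̄`, the algebraic closure of `k = 𝔽_q(T)` in `ℂ_∞`. -/
def KBar : Type _ := algebraicClosure (RatFunc Fq) (CInfty Fq)

instance : Field (KBar Fq) := inferInstanceAs (Field (algebraicClosure (RatFunc Fq) (CInfty Fq)))
instance : Algebra (RatFunc Fq) (KBar Fq) :=
  inferInstanceAs (Algebra (RatFunc Fq) (algebraicClosure (RatFunc Fq) (CInfty Fq)))
instance : Algebra Fq (KBar Fq) :=
  inferInstanceAs (Algebra Fq (algebraicClosure (RatFunc Fq) (CInfty Fq)))
instance : IsScalarTower Fq (RatFunc Fq) (KBar Fq) :=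
  inferInstanceAs (IsScalarTower Fq (RatFunc Fq) (algebraicClosure (RatFunc Fq) (CInfty Fq)))
instance : Algebra (KBar Fq) (CInfty Fq) :=
  inferInstanceAs (Algebra (algebraicClosure (RatFunc Fq) (CInfty Fq)) (CInfty Fq))
instance : IsScalarTower (RatFunc Fq) (KBar Fq) (CInfty Fq) :=
  inferInstanceAs
    (IsScalarTower (RatFunc Fq) (algebraicClosure (RatFunc Fq) (CInfty Fq)) (CInfty Fq))

/-- The element `T` of `k̄`. -/
def T : KBar Fq := algebraMap (RatFunc Fq) (KBar Fq) RatFunc.X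

/-! ### The `q`-power Frobenius is bijective on `ℂ_∞` and on `k̄` -/

theorem frobenius_bijective_CInfty :
    Function.Bijective (FiniteField.frobeniusAlgHom Fq (CInfty Fq)) := by
  refine ⟨RingHom.injective _, fun x => ?_⟩
  set f := FiniteField.frobeniusAlgHom Fq (CInfty Fq)
  have hf : ∀ x, f x = x ^ Fintype.card Fq := fun x => rfl
  have hq : Fintype.card Fq ≠ 0 := Fintype.card_ne_zero
  obtain ⟨u, hu, hux⟩ := mem_closure_iff_seq_limit.mp ((denseRange_algebraMap Fq) x)
  have hv : ∀ n, ∃ v : CInfty Fq, f v = u n := by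
    intro n
    obtain ⟨w, hw⟩ := hu n
    obtain ⟨z, hz⟩ := IsAlgClosed.exists_pow_nat_eq w (Nat.pos_of_ne_zero hq)
    exact ⟨algebraMap _ _ z, by rw [hf, ← map_pow, hz, hw]⟩
  choose v hv using hv
  have hnorm : ∀ a b, ‖f a - f b‖ = ‖a - b‖ ^ Fintype.card Fq := fun a b => by
    rw [← map_sub, hf, norm_pow]
  have hcu : CauchySeq u := hux.cauchySeq
  have hcv : CauchySeq v := by
    rw [Metric.cauchySeq_iff] at hcu ⊢
    intro ε hε
    obtain ⟨N, hN⟩ := hcu (ε ^ Fintype.card Fq) (by positivity)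
    refine ⟨N, fun m hm n hn => ?_⟩
    have := hN m hm n hn
    rw [dist_eq_norm, ← hv, ← hv, hnorm] at this
    rw [dist_eq_norm]
    exact lt_of_pow_lt_pow_left₀ _ hε.le this
  obtain ⟨y, hy⟩ := cauchySeq_tendsto_of_complete hcv
  refine ⟨y, tendsto_nhds_unique ?_ hux⟩
  have : Filter.Tendsto (fun n => v n ^ Fintype.card Fq) Filter.atTop (nhds (f y)) := hy.pow _
  simpa only [← hf, hv] using this

theorem frobenius_bijective_KBar :
    Function.Bijective (FiniteField.frobeniusAlgHom Fq (KBar Fq)) := by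
  refine ⟨RingHom.injective _, fun x => ?_⟩
  obtain ⟨y, hy⟩ := (frobenius_bijective_CInfty Fq).2 (algebraMap (KBar Fq) (CInfty Fq) x)
  have hy' : y ^ Fintype.card Fq = algebraMap (KBar Fq) (CInfty Fq) x := hy
  have hx : IsAlgebraic (RatFunc Fq) (algebraMap (KBar Fq) (CInfty Fq) x) :=
    (mem_algebraicClosure_iff).mp x.2
  have : y ∈ algebraicClosure (RatFunc Fq) (CInfty Fq) := by
    rw [mem_algebraicClosure_iff]
    rw [← hy'] at hx
    exact hx.of_pow Fintype.card_pos
  exact ⟨⟨y, this⟩, (algebraMap (KBar Fq) (CInfty Fq)).injective hy⟩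

/-- The automorphism `x ↦ x ^ q` of `ℂ_∞`. -/
def frobCInfty : CInfty Fq ≃ₐ[Fq] CInfty Fq :=
  AlgEquiv.ofBijective _ (frobenius_bijective_CInfty Fq)

/-- The automorphism `x ↦ x ^ q` of `k̄`. -/
def frobKBar : KBar Fq ≃ₐ[Fq] KBar Fq :=
  AlgEquiv.ofBijective _ (frobenius_bijective_KBar Fq)

theorem frobCInfty_apply (x : CInfty Fq) : frobCInfty Fq x = x ^ Fintype.card Fq := rfl

theorem frobKBar_apply (x : KBar Fq) : frobKBar Fq x = x ^ Fintype.card Fq := rfl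

theorem algebraMap_frobKBar_symm (x : KBar Fq) :
    algebraMap (KBar Fq) (CInfty Fq) ((frobKBar Fq).symm x) =
      (frobCInfty Fq).symm (algebraMap (KBar Fq) (CInfty Fq) x) := by
  rw [AlgEquiv.eq_symm_apply, frobCInfty_apply, ← map_pow, ← frobKBar_apply,
    AlgEquiv.apply_symm_apply]

end Fields

/-! ### Twisting and skew polynomial rings -/

section Skew

variable (Fq : Type*) [Field Fq] [Fintype Fq]

/-- The action of `ℕ` on `k̄` in which `n` acts as the twist `x ↦ x ^ (q ^ (-n))`. -/
instance : MulSemiringAction (Multiplicative ℕ) (KBar Fq) :=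
  MulSemiringAction.compHom (KBar Fq)
    (powersHom (KBar Fq →+* KBar Fq) ((frobKBar Fq).symm : KBar Fq →+* KBar Fq))

theorem ofAdd_one_smul (x : KBar Fq) :
    Multiplicative.ofAdd (1 : ℕ) • x = (frobKBar Fq).symm x := by
  change (((frobKBar Fq).symm : KBar Fq →+* KBar Fq) ^ 1) • x = _
  rw [pow_one]
  rfl

theorem smul_algebraMap_Fq (n : Multiplicative ℕ) (c : Fq) :
    n • algebraMap Fq (KBar Fq) c = algebraMap Fq (KBar Fq) c := by
  induction n using Multiplicative.rec with | _ n =>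
  induction n with
  | zero => exact one_smul _ _
  | succ n ih => rw [ofAdd_add, mul_smul, ofAdd_one_smul, AlgEquiv.commutes, ih]

instance : SMulCommClass Fq (Multiplicative ℕ) (KBar Fq) where
  smul_comm c n x := by
    rw [Algebra.smul_def, Algebra.smul_def, smul_mul', smul_algebraMap_Fq]

instance : SMulCommClass (Multiplicative ℕ) Fq (KBar Fq) := SMulCommClass.symm _ _ _

/-- `L̄ = k̄ ⊗_{𝔽_q} L`. -/
def LBar (L : Type*) [CommRing L] [Algebra Fq L] : Type _ := KBar Fq ⊗[Fq] L

section LBar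

variable (L : Type*) [CommRing L] [Algebra Fq L]

instance : CommRing (LBar Fq L) := inferInstanceAs (CommRing (KBar Fq ⊗[Fq] L))

instance : Algebra (KBar Fq) (LBar Fq L) := inferInstanceAs (Algebra (KBar Fq) (KBar Fq ⊗[Fq] L))

instance : DistribMulAction (Multiplicative ℕ) (LBar Fq L) :=
  inferInstanceAs (DistribMulAction (Multiplicative ℕ) (KBar Fq ⊗[Fq] L))

variable {L} in
/-- The pure tensor `x ⊗ a` in `L̄`. -/
def LBar.tmul (x : KBar Fq) (a : L) : LBar Fq L := x ⊗ₜ[Fq] a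

theorem LBar.smul_tmul (n : Multiplicative ℕ) (x : KBar Fq) (a : L) :
    n • LBar.tmul Fq x a = LBar.tmul Fq (n • x) a := rfl

theorem LBar.tmul_mul_tmul (x y : KBar Fq) (a b : L) :
    LBar.tmul Fq x a * LBar.tmul Fq y b = LBar.tmul Fq (x * y) (a * b) :=
  Algebra.TensorProduct.tmul_mul_tmul x y a b

variable {Fq L} in
theorem LBar.induction_on {motive : LBar Fq L → Prop} (z : LBar Fq L) (zero : motive 0)
    (tmul : ∀ x a, motive (LBar.tmul Fq x a)) (add : ∀ x y, motive x → motive y → motive (x + y)) :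
    motive z :=
  TensorProduct.induction_on z zero tmul add

/-- The `L`-linear extension to `k̄ ⊗ L` of the twisting action on `k̄`, that is,
`n • (x ⊗ a) = x ^ (q ^ (-n)) ⊗ a`. -/
instance : MulSemiringAction (Multiplicative ℕ) (LBar Fq L) where
  smul_one n := by
    change n • LBar.tmul Fq 1 1 = LBar.tmul Fq 1 1
    rw [LBar.smul_tmul, smul_one]
  smul_mul n x y := by
    induction x using LBar.induction_on with
    | zero => simp only [zero_mul, smul_zero]
    | add x₁ x₂ h₁ h₂ => simp only [add_mul, smul_add, h₁, h₂]
    | tmul a b =>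
      induction y using LBar.induction_on with
      | zero => simp only [mul_zero, smul_zero]
      | add y₁ y₂ h₁ h₂ => simp only [mul_add, smul_add, h₁, h₂]
      | tmul c d => simp only [LBar.tmul_mul_tmul, LBar.smul_tmul, smul_mul']

end LBar

/-- The ring of skew polynomials `∑ a_i σ ^ i` over a commutative ring `R` on which `ℕ` acts by
endomorphisms, with `σ a = (1 • a) σ`. -/
def SkewPoly (R : Type*) [CommRing R] [MulSemiringAction (Multiplicative ℕ) R] : Type _ :=
  SkewPolynomial R

namespace SkewPoly

variable {R : Type*} [CommRing R] [MulSemiringAction (Multiplicative ℕ) R]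
  {S : Type*} [CommRing S] [MulSemiringAction (Multiplicative ℕ) S]

instance : Ring (SkewPoly R) := inferInstanceAs (Ring (SkewPolynomial R))

/-- The inclusion of the coefficient ring. -/
def C : R →+* SkewPoly R := SkewPolynomial.CRingHom

variable (R) in
/-- The variable `σ`. -/
def sigma : SkewPoly R := SkewPolynomial.X (R := R)

theorem sigma_mul_C (r : R) :
    sigma R * C r = C (Multiplicative.ofAdd (1 : ℕ) • r) * sigma R := by
  have h : (SkewPolynomial.X : SkewPolynomial R) * SkewPolynomial.C r =
      SkewPolynomial.C (Multiplicative.ofAdd (1 : ℕ) • r) * SkewPolynomial.X := by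
    rw [← SkewPolynomial.monomial_one_one_eq_X, SkewPolynomial.monomial_mul_C,
      SkewPolynomial.C_mul_monomial, Function.iterate_one, MulSemiringAction.toRingHom_apply,
      one_mul, mul_one]
  exact h

theorem induction_on {motive : SkewPoly R → Prop} (p : SkewPoly R)
    (add : ∀ x y, motive x → motive y → motive (x + y))
    (monomial : ∀ r n, motive (C r * sigma R ^ n)) : motive p := by
  refine SkewPolynomial.induction (R := R) (motive := motive) p ?_ fun n r q _ _ hq => ?_
  · have h := monomial 0 0
    rwa [map_zero, zero_mul] at h
  · refine add _ _ ?_ hq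
    have h := monomial r n
    have e : C r * sigma R ^ n = (SkewPolynomial.monomial n r : SkewPolynomial R) := by
      change SkewPolynomial.C r * SkewPolynomial.X (R := R) ^ n = SkewPolynomial.monomial n r
      rw [← SkewPolynomial.monomial_one_right_eq_X_pow, SkewPolynomial.C_mul_monomial, mul_one]
    rwa [e] at h

/-- A ring homomorphism compatible with the actions induces a homomorphism of skew polynomial rings
fixing `σ`. -/
def map (f : R →+* S) (hf : ∀ (n : Multiplicative ℕ) (x : R), f (n • x) = n • f x) :
    SkewPoly R →+* SkewPoly S :=
  SkewMonoidAlgebra.liftNCRingHom (k := R) (R := SkewPolynomial S) (SkewPolynomial.CRingHom.comp f)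
    (SkewMonoidAlgebra.of S (Multiplicative ℕ)) (by
      intro x y
      change SkewMonoidAlgebra.single 1 (f (y • x)) * SkewMonoidAlgebra.single y 1 =
        SkewMonoidAlgebra.single y 1 * SkewMonoidAlgebra.single 1 (f x)
      rw [SkewMonoidAlgebra.single_mul_single, SkewMonoidAlgebra.single_mul_single, hf]
      simp)

theorem map_C (f : R →+* S) (hf : ∀ (n : Multiplicative ℕ) (x : R), f (n • x) = n • f x) (r : R) :
    map f hf (C r) = C (f r) := by
  have h : SkewMonoidAlgebra.liftNC (k := R) (R := SkewPolynomial S)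
      ((SkewPolynomial.CRingHom.comp f : R →+* SkewPolynomial S) : R →+ SkewPolynomial S)
      (SkewMonoidAlgebra.of S (Multiplicative ℕ)) (SkewMonoidAlgebra.single 1 r) =
      SkewPolynomial.C (f r) := by
    rw [SkewMonoidAlgebra.liftNC_single, map_one, mul_one]
    rfl
  exact h

theorem map_sigma (f : R →+* S) (hf : ∀ (n : Multiplicative ℕ) (x : R), f (n • x) = n • f x) :
    map f hf (sigma R) = sigma S := by
  have h : SkewMonoidAlgebra.liftNC (k := R) (R := SkewPolynomial S)
      ((SkewPolynomial.CRingHom.comp f : R →+* SkewPolynomial S) : R →+ SkewPolynomial S)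
      (SkewMonoidAlgebra.of S (Multiplicative ℕ))
      (SkewMonoidAlgebra.single (Multiplicative.ofAdd 1) 1) = SkewPolynomial.X := by
    rw [SkewMonoidAlgebra.liftNC_single, AddMonoidHom.coe_coe, map_one, one_mul]
    rfl
  exact h

end SkewPoly

/-- `k̄[σ]`, with `σ x = x ^ (1 / q) σ`. -/
abbrev KSigma := SkewPoly (KBar Fq)

/-- `k̄[t, σ]`, as the ring of skew polynomials in `σ` over `k̄[t]`, with `σ a = a^{(-1)} σ`
where the twist `a ↦ a^{(-1)}` of `k̄[t]` acts on coefficients. -/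
abbrev KTSigma := SkewPoly (KBar Fq)[X]

/-- `L̄[σ]`, with `σ a = a^{(-1)} σ`. -/
abbrev LSigma (L : Type*) [CommRing L] [Algebra Fq L] := SkewPoly (LBar Fq L)

/-- The inclusion `k̄[σ] ⊂ k̄[t, σ]`. -/
def inclSigma : KSigma Fq →+* KTSigma Fq :=
  SkewPoly.map Polynomial.C fun n x => (Polynomial.smul_C n x).symm

/-- The inclusion `k̄[t] ⊂ k̄[t, σ]`. -/
def inclT : (KBar Fq)[X] →+* KTSigma Fq := SkewPoly.C

/-- The inclusion `k̄ ⊂ k̄[t, σ]`. -/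
def inclK : KBar Fq →+* KTSigma Fq := (inclT Fq).comp Polynomial.C

variable (L : Type*) [CommRing L] [Algebra Fq L]

/-- The inclusion of `L̄` into `L̄[σ]`. -/
def inclLBar : LBar Fq L →+* LSigma Fq L := SkewPoly.C

/-- The map `L → L̄`, `a ↦ 1 ⊗ a`. -/
def toLBar : L →+* LBar Fq L :=
  (Algebra.TensorProduct.includeRight : L →ₐ[Fq] KBar Fq ⊗[Fq] L).toRingHom

theorem toLBar_apply (a : L) : toLBar Fq L a = LBar.tmul Fq 1 a := rfl

theorem smul_toLBar (n : Multiplicative ℕ) (a : L) : n • toLBar Fq L a = toLBar Fq L a := by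
  rw [toLBar_apply, LBar.smul_tmul, smul_one]

/-- The map `L → L̄[σ]`, `a ↦ 1 ⊗ a`. -/
def inclL : L →+* LSigma Fq L := (inclLBar Fq L).comp (toLBar Fq L)

/-- The image of `L` is contained in the center of `L̄[σ]`. -/
theorem inclL_comm (a : L) (x : LSigma Fq L) : inclL Fq L a * x = x * inclL Fq L a := by
  have h : Commute (inclL Fq L a) (SkewPoly.sigma (LBar Fq L)) := by
    change SkewPoly.C (toLBar Fq L a) * _ = _ * SkewPoly.C (toLBar Fq L a)
    rw [SkewPoly.sigma_mul_C, smul_toLBar]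
  induction x using SkewPoly.induction_on with
  | add x y hx hy => rw [mul_add, add_mul, hx, hy]
  | monomial r n =>
    have h' : Commute (inclL Fq L a) (SkewPoly.C r) := by
      change SkewPoly.C _ * SkewPoly.C _ = SkewPoly.C _ * SkewPoly.C _
      rw [← map_mul, mul_comm, map_mul]
    exact h'.mul_right (h.pow_right n)

variable [Algebra Fq[X] L]

/-- The `k̄`-algebra homomorphism `k̄[t] → L̄`, `t ↦ 1 ⊗ t`. -/
def polyToLBar : (KBar Fq)[X] →+* LBar Fq L :=
  Polynomial.eval₂RingHom (algebraMap (KBar Fq) (LBar Fq L)) (toLBar Fq L (algebraMap Fq[X] L X))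

theorem polyToLBar_smul (n : Multiplicative ℕ) (p : (KBar Fq)[X]) :
    polyToLBar Fq L (n • p) = n • polyToLBar Fq L p := by
  induction p using Polynomial.induction_on' with
  | add p q hp hq => rw [smul_add, map_add, map_add, smul_add, hp, hq]
  | monomial m a =>
    rw [Polynomial.smul_monomial]
    simp only [polyToLBar, Polynomial.coe_eval₂RingHom, Polynomial.eval₂_monomial]
    rw [smul_mul', smul_pow', smul_toLBar]
    rfl

/-- The ring homomorphism `k̄[t, σ] → L̄[σ]`. -/
def bareHom : KTSigma Fq →+* LSigma Fq L :=
  SkewPoly.map (polyToLBar Fq L) (polyToLBar_smul Fq L)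

variable [IsScalarTower Fq Fq[X] L]

/-- For an `𝔽_q[t]`-subalgebra `K` of `L`, the map `K̄ → L̄`. -/
def subLBar (K : Subalgebra Fq[X] L) : LBar Fq K →+* LBar Fq L :=
  (Algebra.TensorProduct.map (AlgHom.id Fq (KBar Fq)) (K.val.restrictScalars Fq)).toRingHom

theorem subLBar_smul (K : Subalgebra Fq[X] L) (n : Multiplicative ℕ) (x : LBar Fq K) :
    subLBar Fq L K (n • x) = n • subLBar Fq L K x := by
  induction x using LBar.induction_on with
  | zero => rw [smul_zero, map_zero, smul_zero]
  | add x y hx hy => rw [smul_add, map_add, map_add, smul_add, hx, hy]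
  | tmul a b => rfl

/-- For an `𝔽_q[t]`-subalgebra `K` of `L`, the map `K̄[σ] → L̄[σ]`. -/
def subLSigma (K : Subalgebra Fq[X] L) : LSigma Fq K →+* LSigma Fq L :=
  SkewPoly.map (subLBar Fq L K) (subLBar_smul Fq L K)

end Skew

/-! ### Dual `t`-motives -/

/-- Restriction of scalars along a homomorphism of (possibly noncommutative) rings. -/
def Res {R S : Type*} [Semiring R] [Semiring S] (_f : R →+* S) (M : Type*) := M

section Res

variable {R S : Type*} [Semiring R] [Semiring S] (f : R →+* S) (M : Type*)

instance [AddCommGroup M] : AddCommGroup (Res f M) := inferInstanceAs (AddCommGroup M)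

instance [AddCommGroup M] [Module S M] : Module R (Res f M) := Module.compHom M f

/-- The identity map from `M` to its restriction of scalars. -/
def Res.of [AddCommGroup M] : M ≃+ Res f M := AddEquiv.refl M

theorem Res.smul_of [AddCommGroup M] [Module S M] (r : R) (m : M) :
    r • Res.of f M m = Res.of f M (f r • m) := rfl

variable {M}

/-- An `S`-submodule viewed as an `R`-submodule. -/
def Res.submodule [AddCommGroup M] [Module S M] (N : Submodule S M) : Submodule R (Res f M) where
  carrier := (N : Set M)
  add_mem' := N.add_mem
  zero_mem' := N.zero_mem
  smul_mem' r _ hm := N.smul_mem (f r) hm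

end Res

section Motives

variable (Fq : Type*) [Field Fq] [Fintype Fq]
variable (H : Type*) [AddCommGroup H] [Module (KTSigma Fq) H]

/-- A left `k̄[t, σ]`-module is a dual `t`-motive if it is free of finite rank over `k̄[t]` and over
`k̄[σ]` and `(t - T) ^ n H ⊂ σ H` for `n ≫ 0`. -/
structure IsDualTMotive : Prop where
  free_t : Module.Free (KBar Fq)[X] (Res (inclT Fq) H)
  finite_t : Module.Finite (KBar Fq)[X] (Res (inclT Fq) H)
  free_sigma : Module.Free (KSigma Fq) (Res (inclSigma Fq) H)
  finite_sigma : Module.Finite (KSigma Fq) (Res (inclSigma Fq) H)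
  pow_mem : ∀ᶠ n : ℕ in Filter.atTop, ∀ h : H, ∃ h' : H,
    inclT Fq ((X - C (T Fq)) ^ n) • h = SkewPoly.sigma (KBar Fq)[X] • h'

variable {H}

/-- For a subring `R` of `k̄[t, σ]` containing `k̄` and a `k̄[t, σ]`-submodule `N` of `H`, the sum of
all `R`-submodules `N'` of `H` for which `(N' + N) / N`, the image of `N'` in `H / N`, is of finite
dimension over `k̄`. -/
def saturationOver {R : Type*} [Ring R] (j : R →+* KTSigma Fq) (N : Submodule (KTSigma Fq) H) :
    Submodule R (Res j H) :=
  sSup {N' : Submodule R (Res j H) |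
    (Submodule.span (KBar Fq) {x : Res (inclK Fq) (H ⧸ N) | ∃ h : H, Res.of j H h ∈ N' ∧ x = Res.of (inclK Fq) (H ⧸ N) (N.mkQ h)}).FG}

/-- `N` is saturated in `H` if it equals its saturation, which is at once the sum of all
`k̄[σ]`-submodules `N'` and the sum of all `k̄[t]`-submodules `N'` of `H` such that `(N' + N) / N` is
of finite dimension over `k̄`. -/
def IsSaturated (N : Submodule (KTSigma Fq) H) : Prop :=
  saturationOver Fq (inclSigma Fq) N = Res.submodule (inclSigma Fq) N ∧
    saturationOver Fq (inclT Fq) N = Res.submodule (inclT Fq) N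

variable (H)

/-- A dual `t`-motive is simple if it is nonzero and has no saturated submodules other than `0` and
itself. -/
def IsSimpleMotive : Prop :=
  Nontrivial H ∧ ∀ N : Submodule (KTSigma Fq) H, IsSaturated Fq N → N = ⊥ ∨ N = ⊤

end Motives

/-! ### Rigid analytic triviality -/

section Betti

variable (Fq : Type*) [Field Fq] [Fintype Fq]

/-- `ℂ_∞{t}`, the ring of power series `∑ a_n t ^ n` over `ℂ_∞` convergent for `|t|_∞ ≤ 1`, that is,
with `|a_n|_∞ → 0`. -/
def tateSubring : Subring (PowerSeries (CInfty Fq)) := PowerSeries.IsRestricted.subring 1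

/-- `ℂ_∞{t}` as a type. -/
def Tate : Type _ := tateSubring Fq

instance : CommRing (Tate Fq) := inferInstanceAs (CommRing (tateSubring Fq))

theorem mem_tateSubring {f : PowerSeries (CInfty Fq)} : f ∈ tateSubring Fq ↔
    Filter.Tendsto (fun n => ‖PowerSeries.coeff n f‖) Filter.atTop (nhds 0) := by
  refine (PowerSeries.isRestricted_iff' 1 f).trans ?_
  simp

theorem coe_mem_tateSubring (p : (CInfty Fq)[X]) : (p : PowerSeries (CInfty Fq)) ∈ tateSubring Fq := by
  rw [mem_tateSubring]
  refine tendsto_const_nhds.congr' ?_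
  filter_upwards [Filter.eventually_gt_atTop p.natDegree] with n hn
  rw [Polynomial.coeff_coe, Polynomial.coeff_eq_zero_of_natDegree_lt hn, norm_zero]

/-- The inclusion `k̄[t] ⊂ ℂ_∞{t}`. -/
instance : Algebra (KBar Fq)[X] (Tate Fq) :=
  (((Polynomial.coeToPowerSeries.ringHom.comp
    (Polynomial.mapRingHom (algebraMap (KBar Fq) (CInfty Fq)))).codRestrict (tateSubring Fq)
      fun p => coe_mem_tateSubring Fq (p.map (algebraMap (KBar Fq) (CInfty Fq)))) :
    (KBar Fq)[X] →+* tateSubring Fq).toAlgebra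

/-- The inclusion `𝔽_q[t] ⊂ ℂ_∞{t}`. -/
instance : Algebra Fq[X] (Tate Fq) :=
  ((algebraMap (KBar Fq)[X] (Tate Fq)).comp
    (Polynomial.mapRingHom (algebraMap Fq (KBar Fq)))).toAlgebra

/-- The inclusion `ℂ_∞{t} ⊂ ℂ_∞[[t]]`. -/
def Tate.toPowerSeries : Tate Fq →+* PowerSeries (CInfty Fq) := (tateSubring Fq).subtype

theorem Tate.toPowerSeries_injective : Function.Injective (Tate.toPowerSeries Fq) :=
  Subtype.val_injective

theorem Tate.toPowerSeries_algebraMap (p : (KBar Fq)[X]) :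
    Tate.toPowerSeries Fq (algebraMap (KBar Fq)[X] (Tate Fq) p) =
      (p.map (algebraMap (KBar Fq) (CInfty Fq)) : (CInfty Fq)[X]) := rfl

instance : SMulCommClass (KBar Fq)[X] Fq[X] (Tate Fq) where
  smul_comm a b x := by
    simp only [Algebra.smul_def]
    ring

/-- The twist `f ↦ f^{(-1)}` of `ℂ_∞{t}`. -/
def tateTwist : Tate Fq →+* Tate Fq :=
  ((PowerSeries.map ((frobCInfty Fq).symm : CInfty Fq →+* CInfty Fq)).restrict
    (tateSubring Fq) (tateSubring Fq) fun f hf => by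
      rw [mem_tateSubring] at hf ⊢
      have key : ∀ n, ‖PowerSeries.coeff n
          (PowerSeries.map ((frobCInfty Fq).symm : CInfty Fq →+* CInfty Fq) f)‖ =
          ‖PowerSeries.coeff n f‖ ^ ((Fintype.card Fq : ℝ)⁻¹) := fun n => by
        have h : PowerSeries.coeff n f = ((frobCInfty Fq).symm (PowerSeries.coeff n f)) ^
            Fintype.card Fq := by
          rw [← frobCInfty_apply, AlgEquiv.apply_symm_apply]
        rw [PowerSeries.coeff_map]
        conv_rhs => rw [h, norm_pow, Real.pow_rpow_inv_natCast (norm_nonneg _) Fintype.card_ne_zero]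
        rfl
      simp only [key]
      have hq : (0 : ℝ) < (Fintype.card Fq : ℝ)⁻¹ := by
        have : 0 < Fintype.card Fq := Fintype.card_pos
        positivity
      simpa [Real.zero_rpow hq.ne'] using hf.rpow_const (Or.inr hq.le))

theorem Tate.toPowerSeries_tateTwist (f : Tate Fq) :
    Tate.toPowerSeries Fq (tateTwist Fq f) =
      PowerSeries.map ((frobCInfty Fq).symm : CInfty Fq →+* CInfty Fq)
        (Tate.toPowerSeries Fq f) := rfl

theorem tateTwist_algebraMap (p : (KBar Fq)[X]) :
    tateTwist Fq (algebraMap (KBar Fq)[X] (Tate Fq) p) =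
      algebraMap (KBar Fq)[X] (Tate Fq) (Multiplicative.ofAdd (1 : ℕ) • p) := by
  refine Tate.toPowerSeries_injective Fq (PowerSeries.ext fun n => ?_)
  rw [Tate.toPowerSeries_tateTwist, Tate.toPowerSeries_algebraMap, Tate.toPowerSeries_algebraMap,
    PowerSeries.coeff_map, Polynomial.coeff_coe, Polynomial.coeff_coe, Polynomial.coeff_map,
    Polynomial.coeff_map, Polynomial.coeff_smul, ofAdd_one_smul, algebraMap_frobKBar_symm]
  rfl

variable (H : Type*) [AddCommGroup H] [Module (KTSigma Fq) H]

/-- `H̃ = ℂ_∞{t} ⊗_{k̄[t]} H`. -/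
abbrev HTilde := Tate Fq ⊗[(KBar Fq)[X]] Res (inclT Fq) H

variable {H} in
theorem sigma_smul_inclT (p : (KBar Fq)[X]) (h : H) :
    SkewPoly.sigma (KBar Fq)[X] • inclT Fq p • h =
      inclT Fq (Multiplicative.ofAdd (1 : ℕ) • p) • SkewPoly.sigma (KBar Fq)[X] • h := by
  rw [smul_smul, smul_smul]
  exact congrArg (· • h) (SkewPoly.sigma_mul_C p)

/-- The action `σ (f ⊗ h) = f^{(-1)} ⊗ σ h` of `σ` on `H̃`. -/
def sigmaTilde : HTilde Fq H →+ HTilde Fq H :=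
  TensorProduct.liftAddHom
    (AddMonoidHom.mk' (fun f : Tate Fq =>
      AddMonoidHom.mk' (fun h : Res (inclT Fq) H =>
        tateTwist Fq f ⊗ₜ[(KBar Fq)[X]]
          Res.of (inclT Fq) H (SkewPoly.sigma (KBar Fq)[X] • (Res.of (inclT Fq) H).symm h))
        fun a b => by rw [← TensorProduct.tmul_add, map_add, smul_add, map_add])
      fun a b => by
        ext h
        change tateTwist Fq (a + b) ⊗ₜ[(KBar Fq)[X]] _ = _
        rw [map_add, TensorProduct.add_tmul]
        rfl)
    fun r f h => by
      change tateTwist Fq (r • f) ⊗ₜ[(KBar Fq)[X]] _ =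
        tateTwist Fq f ⊗ₜ[(KBar Fq)[X]] Res.of (inclT Fq) H
          (SkewPoly.sigma (KBar Fq)[X] • inclT Fq r • (Res.of (inclT Fq) H).symm h)
      rw [sigma_smul_inclT, Algebra.smul_def, map_mul, tateTwist_algebraMap, ← Algebra.smul_def,
        TensorProduct.smul_tmul, Res.smul_of]

theorem sigmaTilde_tmul (f : Tate Fq) (h : Res (inclT Fq) H) :
    sigmaTilde Fq H (f ⊗ₜ[(KBar Fq)[X]] h) = tateTwist Fq f ⊗ₜ[(KBar Fq)[X]]
      Res.of (inclT Fq) H (SkewPoly.sigma (KBar Fq)[X] • (Res.of (inclT Fq) H).symm h) := rfl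

theorem sigmaTilde_smul (a : Fq[X]) (x : HTilde Fq H) :
    sigmaTilde Fq H (a • x) = a • sigmaTilde Fq H x := by
  induction x using TensorProduct.induction_on with
  | zero => rw [smul_zero, map_zero, smul_zero]
  | add x y hx hy => rw [smul_add, map_add, map_add, smul_add, hx, hy]
  | tmul f h =>
    rw [TensorProduct.smul_tmul', sigmaTilde_tmul, sigmaTilde_tmul, TensorProduct.smul_tmul']
    congr 1
    rw [Algebra.smul_def, Algebra.smul_def, map_mul]
    congr 1
    change tateTwist Fq (algebraMap (KBar Fq)[X] (Tate Fq) (a.map _)) =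
      algebraMap (KBar Fq)[X] (Tate Fq) (a.map _)
    rw [tateTwist_algebraMap]
    congr 1
    ext n
    rw [Polynomial.coeff_smul, Polynomial.coeff_map, smul_algebraMap_Fq]

/-- `H^Betti`, the `𝔽_q[t]`-module of `σ`-invariant elements of `H̃`. -/
def betti : Submodule Fq[X] (HTilde Fq H) where
  carrier := {x | sigmaTilde Fq H x = x}
  add_mem' {x y} hx hy := by
    change sigmaTilde Fq H (x + y) = x + y
    rw [map_add, hx, hy]
  zero_mem' := map_zero _
  smul_mem' a x hx := by
    change sigmaTilde Fq H (a • x) = a • x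
    rw [sigmaTilde_smul, hx]

/-- `H` is rigid analytically trivial if the natural map
`ℂ_∞{t} ⊗_{𝔽_q[t]} H^Betti → H̃` is bijective. -/
def IsRigidAnalyticallyTrivial : Prop :=
  Function.Bijective ((betti Fq H).subtype.liftBaseChange (Tate Fq))

end Betti

/-! ### Geometric complex multiplication -/

section GCM

variable (Fq : Type*) [Field Fq] [Fintype Fq]
variable (L : Type*) [CommRing L] [Algebra Fq[X] L] [Algebra Fq L]

/-- `L` is a GCM `𝔽_q[t]`-algebra. -/
structure IsGCMAlgebra : Prop where
  free : Module.Free Fq[X] L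
  finite : Module.Finite Fq[X] L
  dedekind : IsDedekindDomain L
  dedekind_bar : IsDedekindDomain (LBar Fq L)

variable (H : Type*) [AddCommGroup H] [Module (LSigma Fq L) H]

/-- The `k̄[t, σ]`-module underlying an `L̄[σ]`-module. -/
abbrev Bare := Res (bareHom Fq L) H

/-- `H` is a dual `t`-motive with GCM by `L`: a left `L̄[σ]`-module which is projective of rank one
over `L̄` and whose underlying `k̄[t, σ]`-module is a dual `t`-motive. -/
structure HasGCM : Prop where
  projective : Module.Projective (LBar Fq L) (Res (inclLBar Fq L) H)
  rank_eq_one : Module.rank (LBar Fq L) (Res (inclLBar Fq L) H) = 1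
  isDualTMotive : IsDualTMotive Fq (Bare Fq L H)

/-- The GCM type of `H` with respect to `L`: the annihilator in `L̄` of `H / σ H`, i.e. the ideal of
all `a ∈ L̄` with `a H ⊂ σ H`. -/
def gcmType : Ideal (LBar Fq L) where
  carrier := {a | ∀ h : H, ∃ h' : H, inclLBar Fq L a • h = SkewPoly.sigma (LBar Fq L) • h'}
  add_mem' {a b} ha hb h := by
    obtain ⟨x, hx⟩ := ha h
    obtain ⟨y, hy⟩ := hb h
    exact ⟨x + y, by rw [map_add, add_smul, smul_add, hx, hy]⟩
  zero_mem' h := ⟨0, by rw [map_zero, zero_smul, smul_zero]⟩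
  smul_mem' c a ha h := by
    obtain ⟨x, hx⟩ := ha (inclLBar Fq L c • h)
    exact ⟨x, by rw [← hx, smul_eq_mul, mul_comm, map_mul, mul_smul]⟩

/-- The natural map `L → End_{k̄[t, σ]}(H)`, `a ↦ (h ↦ a h)`. -/
def toEnd : L →+* Module.End (KTSigma Fq) (Bare Fq L H) where
  toFun a :=
    { toFun := fun h => Res.of (bareHom Fq L) H (inclL Fq L a • (Res.of (bareHom Fq L) H).symm h)
      map_add' := fun x y => by rw [map_add, smul_add, map_add]
      map_smul' := fun r x => by
        obtain ⟨h, rfl⟩ := (Res.of (bareHom Fq L) H).surjective x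
        rw [RingHom.id_apply, Res.smul_of, Res.smul_of, AddEquiv.symm_apply_apply,
          AddEquiv.symm_apply_apply, smul_smul, smul_smul, inclL_comm] }
  map_one' := LinearMap.ext fun h => by
    change Res.of (bareHom Fq L) H (inclL Fq L 1 • _) = _
    rw [map_one, one_smul]
    rfl
  map_mul' a b := LinearMap.ext fun h => by
    change Res.of (bareHom Fq L) H (inclL Fq L (a * b) • _) = _
    rw [map_mul, mul_smul]
    rfl
  map_zero' := LinearMap.ext fun h => by
    change Res.of (bareHom Fq L) H (inclL Fq L 0 • _) = _
    rw [map_zero, zero_smul]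
    rfl
  map_add' a b := LinearMap.ext fun h => by
    change Res.of (bareHom Fq L) H (inclL Fq L (a + b) • _) = _
    rw [map_add, add_smul]
    rfl

theorem toEnd_apply (a : L) (h : H) :
    toEnd Fq L H a (Res.of (bareHom Fq L) H h) = Res.of (bareHom Fq L) H (inclL Fq L a • h) := rfl

/-- `H` has tight GCM by `L`: it has GCM by `L`, and the natural map `L → End_{k̄[t, σ]}(H)` is
bijective. -/
structure HasTightGCM : Prop extends HasGCM Fq L H where
  bijective : Function.Bijective (toEnd Fq L H)

variable [IsScalarTower Fq Fq[X] L]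

theorem inclL_algebraMap (p : Fq[X]) :
    inclL Fq L (algebraMap Fq[X] L p) =
      bareHom Fq L (inclT Fq (p.map (algebraMap Fq (KBar Fq)))) := by
  have h1 : bareHom Fq L (inclT Fq (p.map (algebraMap Fq (KBar Fq)))) =
      inclLBar Fq L (polyToLBar Fq L (p.map (algebraMap Fq (KBar Fq)))) :=
    SkewPoly.map_C _ _ _
  have h2 : ∀ c : Fq, toLBar Fq L (algebraMap Fq L c) =
      algebraMap (KBar Fq) (LBar Fq L) (algebraMap Fq (KBar Fq) c) := fun c => by
    have h := (Algebra.TensorProduct.includeRight : L →ₐ[Fq] KBar Fq ⊗[Fq] L).commutes c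
    exact h
  rw [h1]
  change inclLBar Fq L (toLBar Fq L (algebraMap Fq[X] L p)) = _
  congr 1
  rw [polyToLBar, Polynomial.coe_eval₂RingHom, Polynomial.eval₂_map]
  induction p using Polynomial.induction_on' with
  | add p q hp hq =>
    rw [map_add, map_add, Polynomial.eval₂_add]
    exact congrArg₂ (· + ·) (hp (SkewPoly.map_C _ _ _)) (hq (SkewPoly.map_C _ _ _))
  | monomial m a =>
    rw [Polynomial.eval₂_monomial, ← Polynomial.C_mul_X_pow_eq_monomial, map_mul, map_mul, map_pow,
      map_pow, ← Polynomial.algebraMap_eq, ← IsScalarTower.algebraMap_apply, h2]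
    rfl

/-- For `R = End_{k̄[t, σ]}(H)`, the subalgebra `{x ∈ L | (h ↦ x h) ∈ End_R(H)}` of `L`. -/
def endCentralizer : Subalgebra Fq[X] L where
  carrier := {x | ∀ (φ : Module.End (KTSigma Fq) (Bare Fq L H)) (h : Bare Fq L H),
    toEnd Fq L H x (φ h) = φ (toEnd Fq L H x h)}
  mul_mem' {x y} hx hy φ h := by
    rw [map_mul, Module.End.mul_apply, Module.End.mul_apply, hy, hx]
  add_mem' {x y} hx hy φ h := by
    rw [map_add, LinearMap.add_apply, LinearMap.add_apply, map_add, hx, hy]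
  algebraMap_mem' p φ h := by
    have key : ∀ h : Bare Fq L H, toEnd Fq L H (algebraMap Fq[X] L p) h =
        inclT Fq (p.map (algebraMap Fq (KBar Fq))) • h := fun h => by
      obtain ⟨h, rfl⟩ := (Res.of (bareHom Fq L) H).surjective h
      rw [toEnd_apply, Res.smul_of, inclL_algebraMap]
    rw [key, key, map_smul]

end GCM

end DualTMotive

end

/-! Write B for H^Betti, R for the endomorphism ring of H and F for 𝔽_q(t). Rigid analytic
triviality makes B a finite 𝔽_q[t]-module of the same rank as H over k̄[t], which is the rank of L;
so B has rank one over L. The action of R on B is faithful because B spans H̃, and its image is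
saturated: if cφ comes from R for some nonzero c ∈ 𝔽_q[t], so does φ (`exists_bettiEnd_eq_of_smul`).
This rests on the fact that f ∈ ℂ_∞{t} is a polynomial as soon as cf is one: its coefficients are
eventually periodic, and they tend to zero.

After tensoring with F, the module B becomes a line over the field L ⊗ F, which lies in R ⊗ F. It is
therefore simple, and its commutant lies in L ⊗ F, hence is K ⊗ F. The density theorem gives R ⊗ F =
End(B ⊗ F) over K ⊗ F, and saturation improves this to R = End_K(B)
(`Module.End.mem_of_forall_commute`). The algebra K is closed under division in L, so K and K̄
inherit the Dedekind property (`IsGCMAlgebra.subalgebra`). Thus B is projective over K and has a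
direct summand of rank one; the projection e onto it satisfies ReR = R and eRe = Ke
(`exists_rank_one_idempotent`).

Put H₀ = eH. A direct summand of H is again a rigid analytically trivial dual t-motive. Its rank is
read off from eB, and End(H₀) = eRe = K makes the GCM tight. Since ReR = R, the module H is a finite
sum of images of H₀ under elements of R; these commute with K̄ and with σ, which gives the
comparison of types (`gcmType_eq_map`).

For simplicity, every submodule of H has a complement up to isogeny, because the L-translates of one
minimal submodule generate H up to torsion (`HasGCM.exists_complement`). An isogenous submodule of H
contains cH for some nonzero c ∈ 𝔽_q[t] (`IsDualTMotive.exists_map_smul_mem`), so a nonzero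
saturated N ⊂ H₀ receives an endomorphism of H that is multiplication by c on N. Its compression to
H₀ is a nonzero x ∈ K with xH₀ ⊂ N, and this forces N = H₀. -/

noncomputable section

/-! ### Modules of rank one and projective modules over Dedekind domains -/

/-- In a module of rank one over a domain, `φ x • y = φ y • x`. -/
theorem LinearMap.apply_smul_comm_of_rank_eq_one {A M : Type*} [CommRing A] [IsDomain A]
    [AddCommGroup M] [Module A M] [Module.IsTorsionFree A M] (hr : Module.rank A M ≤ 1)
    (φ : M →ₗ[A] A) (x y : M) : φ x • y = φ y • x := by
  have h : ¬ LinearIndependent A ![x, y] := fun h => by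
    have := h.cardinal_lift_le_rank.trans (Cardinal.lift_le.mpr hr)
    norm_num at this
  rw [LinearIndependent.pair_iff] at h
  push Not at h
  obtain ⟨s, t, h0, hst⟩ := h
  have h1 : s * φ x + t * φ y = 0 := by simpa using congrArg φ h0
  by_cases hs : s = 0
  · have ht := hst hs
    rw [hs, zero_smul, zero_add] at h0
    rw [hs, zero_mul, zero_add] at h1
    have hy : y = 0 := (smul_eq_zero.mp h0).resolve_left ht
    simp [hy]
  · have : s • (φ x • y) = s • (φ y • x) := by
      rw [smul_smul, eq_neg_of_add_eq_zero_left h1, smul_comm s, eq_neg_of_add_eq_zero_left h0]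
      module
    exact smul_right_injective M hs this

/-- The trace of the identity is the rank: by the rank one relation, ∑ φᵢ(xᵢ) acts on y as ∑ φᵢ(y)
xᵢ = y. The second identity expresses that M is invertible, so that ideals can be recovered from the
submodules they generate in M. -/
theorem Module.exists_dualBasis_sum_eq_one {A M : Type*} [CommRing A] [IsDomain A]
    [AddCommGroup M] [Module A M] [Module.IsTorsionFree A M] [Module.Finite A M]
    [Module.Projective A M] (hr : Module.rank A M = 1) :
    ∃ (n : ℕ) (x : Fin n → M) (φ : Fin n → M →ₗ[A] A),
      (∀ y, ∑ i, φ i y • x i = y) ∧ ∑ i, φ i (x i) = 1 := by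
  obtain ⟨n, f, g, hf, hg, hfg⟩ := Module.Finite.exists_comp_eq_id_of_projective A M
  have key : ∀ y, ∑ i, ((LinearMap.proj i).comp g) y • f (Pi.single i 1) = y := fun y => by
    conv_rhs => rw [← LinearMap.id_apply (R := A) y, ← hfg, LinearMap.comp_apply,
      pi_eq_sum_univ' (g y), map_sum]
    refine Finset.sum_congr rfl fun i _ => ?_
    rw [map_smul]
    rfl
  refine ⟨n, fun i => f (Pi.single i 1), fun i => (LinearMap.proj i).comp g, key, ?_⟩
  have : Nontrivial M := by
    by_contra h
    rw [not_nontrivial_iff_subsingleton] at h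
    simp [rank_subsingleton'] at hr
  obtain ⟨y, hy⟩ := exists_ne (0 : M)
  refine smul_left_injective A hy ?_
  change (∑ i, ((LinearMap.proj i).comp g) (f (Pi.single i 1))) • y = (1 : A) • y
  rw [Finset.sum_smul, one_smul]
  conv_rhs => rw [← key y]
  exact Finset.sum_congr rfl fun i _ => LinearMap.apply_smul_comm_of_rank_eq_one hr.le _ _ _

/-- The quotient has rank zero, so it is torsion, and the product of annihilators of finitely many
generators kills it. -/
theorem Submodule.exists_smul_mem_of_finrank_le {A M : Type*} [CommRing A] [IsDomain A]
    [AddCommGroup M] [Module A M] [Module.Finite A M] (N : Submodule A M)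
    (h : Module.finrank A M ≤ Module.finrank A N) : ∃ a : A, a ≠ 0 ∧ ∀ x : M, a • x ∈ N := by
  have h0 : Module.finrank A (M ⧸ N) = 0 := by
    have := Submodule.finrank_quotient_add_finrank N
    omega
  have ht : Module.IsTorsion A (M ⧸ N) := by
    rw [← Module.finrank_eq_zero_iff_isTorsion]
    exact h0
  obtain ⟨s, hs⟩ := (Module.Finite.fg_top : (⊤ : Submodule A M).FG)
  choose c hc using fun x : M => ht (x := N.mkQ x)
  refine ⟨∏ x ∈ s, (c x : A), Finset.prod_ne_zero_iff.mpr fun x _ => nonZeroDivisors.coe_ne_zero _,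
    fun x => ?_⟩
  have hx : x ∈ Submodule.span A (s : Set M) := hs ▸ Submodule.mem_top
  induction hx using Submodule.span_induction with
  | mem x hx =>
    obtain ⟨d, hd⟩ := Finset.dvd_prod_of_mem (fun x => (c x : A)) hx
    rw [hd, mul_comm, mul_smul]
    refine N.smul_mem _ ?_
    have := hc x
    rwa [Submonoid.smul_def, ← map_smul, ← LinearMap.mem_ker, Submodule.ker_mkQ] at this
  | zero => simp
  | add x y _ _ hx hy => rw [smul_add]; exact N.add_mem hx hy
  | smul a x _ hx => rw [smul_comm]; exact N.smul_mem _ hx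

theorem Module.projective_of_isDedekindDomain {A M : Type*} [CommRing A] [IsDedekindDomain A]
    [AddCommGroup M] [Module A M] [Module.Finite A M] [Module.IsTorsionFree A M] :
    Module.Projective A M := by
  have := Module.finitePresentation_of_finite A M
  exact Module.Flat.projective_of_finitePresentation

/-- For y ≠ 0 the submodule Ay is a copy of A, so it has full rank over P and M/Ay is killed by a
nonzero element of P. This rank count over P replaces passing to fraction fields. -/
theorem Module.rank_eq_one_of_finrank_eq (P : Type*) {A M : Type*} [CommRing P] [IsDomain P]
    [CommRing A]
    [IsDomain A] [Algebra P A] [Module.Finite P A] [Module.IsTorsionFree P A] [AddCommGroup M]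
        [Module P M] [Module A M]
    [IsScalarTower P A M] [Module.Finite P M] [Module.IsTorsionFree A M]
    (h : Module.finrank P M = Module.finrank P A) :
    Module.rank A M = 1 ∧ ∀ y : M, y ≠ 0 → ∃ a : P, a ≠ 0 ∧ ∀ z : M, ∃ c : A, a • z = c • y := by
  have key : ∀ y : M, y ≠ 0 → ∃ a : P, a ≠ 0 ∧ ∀ z : M, ∃ c : A, a • z = c • y := fun y hy => by
    have hinj : Function.Injective ((LinearMap.toSpanSingleton A M y).restrictScalars P) :=
      smul_left_injective A hy
    obtain ⟨a, ha, h⟩ := Submodule.exists_smul_mem_of_finrank_le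
      (LinearMap.range ((LinearMap.toSpanSingleton A M y).restrictScalars P))
      (by rw [LinearMap.finrank_range_of_inj hinj, h])
    exact ⟨a, ha, fun z => let ⟨c, hc⟩ := h z; ⟨c, hc.symm⟩⟩
  refine ⟨le_antisymm ?_ ?_, key⟩
  · rw [← Nat.cast_one]
    refine rank_le fun s hs => ?_
    by_contra! hc
    obtain ⟨x, hx, y, hy, hxy⟩ := Finset.one_lt_card.mp hc
    have hy0 : y ≠ 0 := hs.ne_zero (⟨y, hy⟩ : s)
    obtain ⟨a, ha, h⟩ := key y hy0
    obtain ⟨c, hc⟩ := h x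
    have h2 : LinearIndependent A ![x, y] := by
      convert hs.comp ![⟨x, hx⟩, ⟨y, hy⟩] ?_ using 1
      · ext i; fin_cases i <;> rfl
      · intro i j h
        fin_cases i <;> fin_cases j <;> simp_all
    rw [LinearIndependent.pair_iff] at h2
    have h3 := (h2 (algebraMap P A a) (-c) (by rw [algebraMap_smul, hc]; module)).1
    exact ha ((FaithfulSMul.algebraMap_eq_zero_iff P A).mp h3)
  · rw [Cardinal.one_le_iff_pos, rank_pos_iff_exists_ne_zero]
    have : 0 < Module.finrank P A := Module.finrank_pos
    rw [← h] at this
    have := Module.nontrivial_of_finrank_pos this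
    exact exists_ne 0

/-- A functional that is nonzero at x embeds M into A, and a ↦ ax embeds A into M. -/
theorem Module.finrank_eq_of_rank_eq_one (P : Type*) {A M : Type*} [CommRing P] [IsDomain P]
    [CommRing A]
    [IsDomain A] [Algebra P A] [Module.Finite P A] [AddCommGroup M] [Module P M] [Module A M]
    [IsScalarTower P A M] [Module.Finite P M] [Module.IsTorsionFree A M] [Module.Projective A M]
    (h : Module.rank A M = 1) : Module.finrank P M = Module.finrank P A := by
  have : Module.Finite A M := Module.Finite.of_restrictScalars_finite P A M
  obtain ⟨n, x, φ, h1, h2⟩ := Module.exists_dualBasis_sum_eq_one h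
  obtain ⟨i, -, hi⟩ := Finset.exists_ne_zero_of_sum_ne_zero (h2.trans_ne one_ne_zero)
  have hx : x i ≠ 0 := fun h0 => hi (by rw [h0, map_zero])
  refine le_antisymm ?_ ?_
  · refine LinearMap.finrank_le_finrank_of_injective (f := (φ i).restrictScalars P) ?_
    rw [← LinearMap.ker_eq_bot, LinearMap.ker_eq_bot']
    intro y hy
    have := LinearMap.apply_smul_comm_of_rank_eq_one h.le (φ i) y (x i)
    rw [show φ i y = 0 from hy, zero_smul] at this
    exact (smul_eq_zero.mp this.symm).resolve_left hi
  · exact LinearMap.finrank_le_finrank_of_injective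
      (f := (LinearMap.toSpanSingleton A M (x i)).restrictScalars P) (smul_left_injective A hx)

/-- A fraction of A that is integral over A is integral over C, hence lies in C; the hypothesis,
which says that C/A is torsion-free, puts it back into A. The Noetherian property and dimension at
most one come from finiteness over P. -/
theorem IsDedekindDomain.of_isTorsionFree_quotient (P : Type*) {A C : Type*} [CommRing P]
    [IsDomain P]
    [IsPrincipalIdealRing P] [CommRing A] [CommRing C] [IsDomain C] [IsIntegrallyClosed C]
    [Algebra P A] [Module.Finite P A] (j : A →+* C) (hj : Function.Injective j)
    (h : ∀ (a b : A) (c : C), b ≠ 0 → j b * c = j a → ∃ d, j d = c) : IsDedekindDomain A := by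
  have : IsDomain A := hj.isDomain
  have : Algebra.IsIntegral P A := Algebra.IsIntegral.of_finite P A
  have : IsNoetherianRing A := IsNoetherianRing.of_finite P A
  have hd : Ring.DimensionLEOne A := Ring.DimensionLEOne.of_isIntegral P A
  have hi : IsIntegrallyClosed A := by
    rw [isIntegrallyClosed_iff (FractionRing A)]
    intro x hx
    obtain ⟨a, b, hb, rfl⟩ := IsFractionRing.div_surjective (A := A) x
    have hj' : Function.Injective ((algebraMap C (FractionRing C)).comp j) :=
      (IsFractionRing.injective C (FractionRing C)).comp hj
    have hx' : IsIntegral C (IsFractionRing.lift hj'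
        (algebraMap A (FractionRing A) a / algebraMap A (FractionRing A) b)) :=
      hx.map_of_comp_eq j (IsFractionRing.lift hj') (by ext; simp)
    obtain ⟨c, hc⟩ := IsIntegrallyClosed.isIntegral_iff.mp hx'
    have hb' : algebraMap C (FractionRing C) (j b) ≠ 0 := fun h0 =>
      nonZeroDivisors.ne_zero hb (hj' (by rw [map_zero]; exact h0))
    rw [map_div₀, IsFractionRing.lift_algebraMap, IsFractionRing.lift_algebraMap,
      RingHom.comp_apply, RingHom.comp_apply, eq_div_iff hb', ← map_mul] at hc
    obtain ⟨d, hd⟩ := h a b c (nonZeroDivisors.ne_zero hb)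
      (by rw [mul_comm]; exact IsFractionRing.injective C (FractionRing C) hc)
    refine ⟨d, ?_⟩
    have hb0 : algebraMap A (FractionRing A) b ≠ 0 := fun h0 =>
      nonZeroDivisors.ne_zero hb (IsFractionRing.injective A (FractionRing A) (by rw [h0,
          map_zero]))
    rw [eq_div_iff hb0, ← map_mul]
    refine congrArg _ (hj ?_)
    rw [map_mul, hd]
    exact IsFractionRing.injective C (FractionRing C) hc
  exact (isDedekindDomain_iff A (FractionRing A)).mpr
    ⟨inferInstance, inferInstance, hd, (isIntegrallyClosed_iff _).mp hi⟩

/-- The image I of a nonzero functional B → K is a nonzero ideal, hence projective of rank one, so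
the functional splits and e is the projection of B onto a copy of I. Fullness holds because an
invertible module is a generator, and the corner e End(B) e is End(I) = K. -/
theorem exists_rank_one_idempotent {K B : Type*} [CommRing K] [IsDedekindDomain K]
    [AddCommGroup B] [Module K B] [Module.Finite K B] [Module.IsTorsionFree K B] [Nontrivial B] :
    ∃ e : Module.End K B, e * e = e ∧ Module.rank K (LinearMap.range e) = 1 ∧
      (∃ (n : ℕ) (a b : Fin n → Module.End K B), ∑ i, a i * e * b i = 1) ∧
      ∀ f : Module.End K B, e * f * e = f → ∃ x : K, f = x • e := by
  have := Module.projective_of_isDedekindDomain (A := K) (M := B)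
  obtain ⟨n, f, g, hf, hg, hfg⟩ := Module.Finite.exists_comp_eq_id_of_projective K B
  obtain ⟨y, hy⟩ := exists_ne (0 : B)
  obtain ⟨i, hi⟩ : ∃ i, g y i ≠ 0 := by
    by_contra! h
    exact hy (hg (by rw [map_zero]; exact funext h))
  set φ : B →ₗ[K] K := (LinearMap.proj i).comp g with hφ
  set I := LinearMap.range φ with hI
  have hIproj : Module.Projective K I := Module.projective_of_isDedekindDomain
  have hIrank : Module.rank K I = 1 := by
    refine le_antisymm ((Submodule.rank_le I).trans_eq (Module.rank_self K)) ?_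
    rw [Cardinal.one_le_iff_pos, rank_pos_iff_exists_ne_zero]
    exact ⟨⟨φ y, y, rfl⟩, fun h => hi (congrArg Subtype.val h)⟩
  obtain ⟨s, hs⟩ := Module.projective_lifting_property φ.rangeRestrict LinearMap.id
    φ.surjective_rangeRestrict
  set p := φ.rangeRestrict with hp
  have hps : ∀ x, p (s x) = x := fun x => LinearMap.congr_fun hs x
  obtain ⟨m, x, ψ, hx, hψ⟩ := Module.exists_dualBasis_sum_eq_one hIrank
  refine ⟨s.comp p, ?_, ?_, ?_, ?_⟩
  · ext z
    simp [hps]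
  · have : LinearMap.range (s.comp p) = LinearMap.range s :=
      LinearMap.range_comp_of_range_eq_top s (LinearMap.range_eq_top.mpr φ.surjective_rangeRestrict)
    rw [this]
    have h2 := lift_rank_range_of_injective s
      (Function.LeftInverse.injective (g := p) hps)
    rw [hIrank, Cardinal.lift_one] at h2
    exact Cardinal.lift_eq_one.mp h2
  -- The factorisation of 1 through e: for each pair (j, i), send z to its i-th coordinate times
  -- s(xⱼ), then apply ψⱼ and return to the i-th generator. The sum over j contributes ∑ ψⱼ(xⱼ) = 1.
  · have key : ∀ z : B, ∑ j, g z j • f (Pi.single j 1) = z := fun z => by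
      conv_rhs => rw [← LinearMap.id_apply (R := K) z, ← hfg, LinearMap.comp_apply,
        pi_eq_sum_univ' (g z), map_sum]
      exact Finset.sum_congr rfl fun i _ => (map_smul f _ _).symm
    refine ⟨_, fun k => ((ψ (finProdFinEquiv.symm k).1).comp p).smulRight
        (f (Pi.single (finProdFinEquiv.symm k).2 1)),
      fun k => ((LinearMap.proj (finProdFinEquiv.symm k).2).comp g).smulRight
        (s (x (finProdFinEquiv.symm k).1)), ?_⟩
    ext z
    rw [Equiv.sum_comp finProdFinEquiv.symm (fun k : Fin m × Fin n =>
      ((ψ k.1).comp p).smulRight (f (Pi.single k.2 1)) * s.comp p *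
        ((LinearMap.proj k.2).comp g).smulRight (s (x k.1))), Fintype.sum_prod_type,
      LinearMap.sum_apply]
    simp only [LinearMap.sum_apply, Module.End.mul_apply, LinearMap.smulRight_apply,
      LinearMap.comp_apply, map_smul, hps, LinearMap.proj_apply, Module.End.one_apply]
    rw [Finset.sum_comm]
    simp only [← Finset.smul_sum, ← Finset.sum_smul, hψ, one_smul, key]
  · intro h hh
    -- An endomorphism of a module of rank one is multiplication by its trace, here computed on I.
    refine ⟨∑ i, ψ i (p (h (s (x i)))), ?_⟩
    have h1 : ∀ z, s (p (h (s (p z)))) = h z := fun z => LinearMap.congr_fun hh z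
    ext z
    rw [← h1, LinearMap.smul_apply, LinearMap.comp_apply, ← map_smul]
    congr 1
    conv_lhs => rw [← hx (p z)]
    simp only [map_sum, map_smul, Finset.sum_smul]
    exact Finset.sum_congr rfl fun i _ =>
      LinearMap.apply_smul_comm_of_rank_eq_one hIrank.le _ _ _

/-! ### Density and the double commutant -/

/-- The density theorem for a ring acting transitively on the nonzero elements of a module. -/
theorem Module.exists_smul_eq_of_transitive {A V : Type*} [Ring A] [AddCommGroup V] [Module A V]
    [Nontrivial V] (h : ∀ v w : V, v ≠ 0 → ∃ r : A, r • v = w) (f : V →+ V)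
    (hf : ∀ (g : Module.End A V) (v : V), f (g v) = g (f v)) (t : Finset V) :
    ∃ r : A, ∀ v ∈ t, f v = r • v := by
  have : IsSimpleModule A V := by
    rw [isSimpleModule_iff_toSpanSingleton_surjective]
    exact ⟨inferInstance, fun v hv w => h v w hv⟩
  exact jacobson_density (R := A) (M := V)
    { toFun := f, map_add' := map_add _, map_smul' := hf } t

/-- A saturated subalgebra of `End_F B` containing a maximal commutative domain `L` is its own
    double
commutant. -/
theorem Module.End.mem_of_forall_commute {F L B : Type*} [CommRing F] [IsDomain F] [CommRing L]
    [IsDomain L] [Algebra F L] [Module.Finite F L] [Module.IsTorsionFree F L] [AddCommGroup B]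
    [Module F B] [Module L B] [IsScalarTower F L B] [Module.Finite F B] [Module.IsTorsionFree F B]
    [Module.IsTorsionFree L B] (hr : Module.finrank F B = Module.finrank F L)
    (S : Subalgebra F (Module.End F B)) (hL : ∀ x : L, Algebra.lsmul F F B x ∈ S)
    (hS : ∀ (c : F) (f : Module.End F B), c ≠ 0 → c • f ∈ S → f ∈ S) (f : Module.End F B)
    (hf : ∀ x : L, (∀ s ∈ S, ∀ b, s (x • b) = x • s b) → ∀ b, f (x • b) = x • f b) : f ∈ S := by
  obtain ⟨hrank, hdep⟩ := Module.rank_eq_one_of_finrank_eq F hr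
  have hnt : Nontrivial B := by
    have : 0 < Module.finrank F L := Module.finrank_pos
    exact Module.nontrivial_of_finrank_pos (R := F) (hr ▸ this)
  obtain ⟨b₀, hb₀⟩ := exists_ne (0 : B)
  let Q := FractionRing F
  let V := Q ⊗[F] B
  let i : B →ₗ[F] V := TensorProduct.mk F Q B 1
  have hloc : IsLocalizedModule (nonZeroDivisors F) i :=
    (isLocalizedModule_iff_isBaseChange (nonZeroDivisors F) Q i).mpr (TensorProduct.isBaseChange
        F B Q)
  have hi : Function.Injective i := by
    rw [← LinearMap.ker_eq_bot, LinearMap.ker_eq_bot']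
    intro b hb
    obtain ⟨c, hc⟩ := (IsLocalizedModule.eq_zero_iff (nonZeroDivisors F) i).mp hb
    exact (smul_eq_zero.mp hc).resolve_left (nonZeroDivisors.coe_ne_zero c)
  have hsurj : ∀ v : V, ∃ c : F, c ≠ 0 ∧ ∃ b, c • v = i b := fun v => by
    obtain ⟨⟨b, c⟩, h⟩ := IsLocalizedModule.surj (nonZeroDivisors F) i v
    exact ⟨c, nonZeroDivisors.coe_ne_zero c, b, h⟩
  have hcV : ∀ {c : F}, c ≠ 0 → Function.Injective (fun v : V => c • v) := fun {c} hc v w h => by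
    have hc' : algebraMap F Q c ≠ 0 := (FaithfulSMul.algebraMap_eq_zero_iff F Q).not.mpr hc
    refine smul_right_injective V hc' ?_
    simpa only [algebraMap_smul] using h
  have hbc : ∀ (s : Module.End F B) b, s.baseChange Q (i b) = i (s b) :=
    fun s b => LinearMap.baseChange_tmul _ _ _
  -- S' is the localisation of S inside End_Q(V): the operators that a nonzero c ∈ F carries into S.
  obtain ⟨S', hmem⟩ : ∃ S' : Subring (Module.End Q V), ∀ ψ, ψ ∈ S' ↔
      ∃ c : F, c ≠ 0 ∧ ∃ s ∈ S, ∀ b, c • ψ (i b) = i (s b) := ⟨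
    { carrier := {ψ | ∃ c : F, c ≠ 0 ∧ ∃ s ∈ S, ∀ b, c • ψ (i b) = i (s b)}
      one_mem' := ⟨1, one_ne_zero, 1, S.one_mem, fun b => by simp⟩
      zero_mem' := ⟨1, one_ne_zero, 0, S.zero_mem, fun b => by simp⟩
      neg_mem' := by
        rintro ψ ⟨c, hc, s, hs, h⟩
        exact ⟨c, hc, -s, S.neg_mem hs, fun b => by simp [h]⟩
      mul_mem' := by
        rintro ψ χ ⟨c, hc, s, hs, h⟩ ⟨d, hd, t, ht, h'⟩
        refine ⟨c * d, mul_ne_zero hc hd, s * t, S.mul_mem hs ht, fun b => ?_⟩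
        rw [mul_smul, Module.End.mul_apply, ← LinearMap.map_smul_of_tower ψ, h', h]
        rfl
      add_mem' := by
        rintro ψ χ ⟨c, hc, s, hs, h⟩ ⟨d, hd, t, ht, h'⟩
        refine ⟨c * d, mul_ne_zero hc hd, d • s + c • t,
          S.add_mem (S.smul_mem hs d) (S.smul_mem ht c), fun b => ?_⟩
        rw [LinearMap.add_apply, smul_add, LinearMap.add_apply, map_add, LinearMap.smul_apply,
          LinearMap.smul_apply, map_smul, map_smul, ← h, ← h', mul_smul, mul_smul, smul_comm c d]
              }, fun _ => Iff.rfl⟩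
  have hS' : ∀ s ∈ S, s.baseChange Q ∈ S' := fun s hs =>
    (hmem _).mpr ⟨1, one_ne_zero, s, hs, fun b => by rw [one_smul, hbc]⟩
  have hFS : ∀ d : F, algebraMap F _ d ∈ S' := fun d =>
    (hmem _).mpr ⟨1, one_ne_zero, d • 1, S.smul_mem S.one_mem d, fun b => by simp⟩
  have hF : ∀ (d : F), d ≠ 0 → ∃ ψ ∈ S', ∀ v : V, d • ψ v = v := fun d hd => by
    have hd' : algebraMap F Q d ≠ 0 := (FaithfulSMul.algebraMap_eq_zero_iff F Q).not.mpr hd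
    have h : ∀ v : V, d • (algebraMap F Q d)⁻¹ • v = v := fun v => by
      rw [← algebraMap_smul Q d, smul_inv_smul₀ hd']
    exact ⟨(algebraMap F Q d)⁻¹ • 1, (hmem _).mpr ⟨d, hd, 1, S.one_mem, fun b => h _⟩, h⟩
  -- Up to denominators v and w are b and b' in B, and B/Lb is torsion, so some x ∈ L takes b to a
  -- multiple of b'. Hence V is simple over S'.
  have htrans : ∀ v w : V, v ≠ 0 → ∃ ψ ∈ S', ψ v = w := fun v w hv => by
    obtain ⟨c, hc, b, hb⟩ := hsurj v
    obtain ⟨d, hd, b', hb'⟩ := hsurj w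
    have hb0 : b ≠ 0 := fun h => hv (hcV hc (by simp [hb, h]))
    obtain ⟨a, ha, h⟩ := hdep b hb0
    obtain ⟨x, hx⟩ := h b'
    obtain ⟨ψ, hψ, h1⟩ := hF (a * d) (mul_ne_zero ha hd)
    refine ⟨ψ * ((Algebra.lsmul F F B x).baseChange Q) * algebraMap F _ c, 
      S'.mul_mem (S'.mul_mem hψ (hS' _ (hL x))) (hFS c), ?_⟩
    refine hcV (mul_ne_zero ha hd) ?_
    change (a * d) • ψ ((Algebra.lsmul F F B x).baseChange Q (c • v)) = (a * d) • w
    rw [h1, hb, mul_smul, hb', ← map_smul, hx, hbc]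
    rfl
  have hntV : Nontrivial V := ⟨i b₀, 0, fun h => hb₀ (hi (by rw [h, map_zero]))⟩
  have hcomm : ∀ (g : Module.End S' V) (v : V), f.baseChange Q (g v) = g (f.baseChange Q v) := by
    intro g
    have hg : ∀ ψ ∈ S', ∀ v, g (ψ v) = ψ (g v) := fun ψ hψ v => g.map_smul ⟨ψ, hψ⟩ v
    have hgF : ∀ (d : F) v, g (d • v) = d • g v := fun d v =>
      hg (algebraMap F _ d) (hFS d) v
    -- As g commutes with L and V is a line over the fraction field of L, it is determined by its
    -- value at b₀: it is multiplication by x/(ac).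
    obtain ⟨c, hc, b', hb'⟩ := hsurj (g (i b₀))
    obtain ⟨a, ha, h⟩ := hdep b₀ hb₀
    obtain ⟨x, hx⟩ := h b'
    have hbS : ∀ x : L, ∀ b, (Algebra.lsmul F F B x).baseChange Q (i b) = i (x • b) :=
      fun x b => hbc _ _
    have h0 : (a * c) • g (i b₀) = i (x • b₀) := by
      rw [mul_smul, hb', ← map_smul, hx]
    have key : ∀ v, (a * c) • g v = (Algebra.lsmul F F B x).baseChange Q v := by
      have h1 : ∀ b, (a * c) • g (i b) = i (x • b) := fun b => by
        obtain ⟨d, hd, h⟩ := hdep b₀ hb₀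
        obtain ⟨y, hy⟩ := h b
        refine hcV hd ?_
        change d • (a * c) • g (i b) = d • i (x • b)
        rw [smul_comm d, ← hgF d, ← map_smul i, hy, ← hbS, hg _ (hS' _ (hL y)),
          ← LinearMap.map_smul_of_tower, h0, hbS, ← map_smul i, smul_comm d x b, hy, smul_comm x]
      intro v
      obtain ⟨d, hd, b, hb⟩ := hsurj v
      refine hcV hd ?_
      change d • (a * c) • g v = d • _
      rw [smul_comm d, ← hgF d, hb, h1, ← LinearMap.map_smul_of_tower, hb, hbS]
    -- Since g commutes with S', so does x; hence the hypothesis on f applies to x.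
    have hxS : ∀ s ∈ S, ∀ b, s (x • b) = x • s b := fun s hs b => by
      apply hi
      rw [← hbc, ← hbS, ← hbS, ← hbc, ← key, ← key, hg _ (hS' s hs), LinearMap.map_smul_of_tower]
    have hfx := hf x hxS
    intro v
    refine hcV (mul_ne_zero ha hc) ?_
    change (a * c) • f.baseChange Q (g v) = (a * c) • g (f.baseChange Q v)
    rw [← LinearMap.map_smul_of_tower, key, key, ← Module.End.mul_apply, ← Module.End.mul_apply,
      ← LinearMap.baseChange_mul, ← LinearMap.baseChange_mul]
    congr 2
    exact LinearMap.ext hfx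
  -- Density controls f only on a finite set; generators of B suffice. Clearing the denominator of r
  -- gives cf ∈ S, and saturation removes c.
  obtain ⟨t, ht⟩ := (Module.Finite.fg_top : (⊤ : Submodule F B).FG)
  classical
  obtain ⟨⟨r, hrS⟩, hrt⟩ := Module.exists_smul_eq_of_transitive (A := S') (V := V)
    (fun v w hv => let ⟨ψ, hψ, h⟩ := htrans v w hv; ⟨⟨ψ, hψ⟩, h⟩)
    (f.baseChange Q).toAddMonoidHom hcomm (t.image i)
  obtain ⟨c, hc, s, hs, hr⟩ := (hmem r).mp hrS
  refine hS c f hc ?_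
  convert hs
  refine LinearMap.ext_on ht fun b hb => hi ?_
  have h1 : f.baseChange Q (i b) = r (i b) := hrt (i b) (Finset.mem_image_of_mem i hb)
  rw [← hr, ← h1, hbc, LinearMap.smul_apply, map_smul]

/-! ### Submodules of free modules over left principal ideal domains, and k̄[σ] -/

/-- Induction on coordinates: the image in the first coordinate is a principal left ideal, free for
lack of zero divisors, so M splits as this image plus a kernel inside Rⁿ. Commutativity plays no
role, so the argument serves both k̄[t] and k̄[σ]. -/
theorem Module.free_and_finite_of_injective_pi {R : Type*} [Ring R] [NoZeroDivisors R]
    [IsPrincipalIdealRing R] (n : ℕ) {M : Type*} [AddCommGroup M] [Module R M]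
    (f : M →ₗ[R] (Fin n → R)) (hf : Function.Injective f) :
    Module.Free R M ∧ Module.Finite R M := by
  induction n generalizing M with
  | zero =>
    have : Subsingleton M := hf.subsingleton
    exact ⟨inferInstance, inferInstance⟩
  | succ n ih =>
    let π : M →ₗ[R] R := (LinearMap.proj 0).comp f
    obtain ⟨h1, h2⟩ := ih ((LinearMap.funLeft R R Fin.succ).comp (f.comp (LinearMap.ker
        π).subtype)) (by
      rw [← LinearMap.ker_eq_bot, LinearMap.ker_eq_bot']
      intro x hx
      refine Subtype.ext (hf ?_)
      rw [Submodule.coe_zero, map_zero]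
      funext i
      refine Fin.cases ?_ (fun j => ?_) i
      · exact x.2
      · exact congrFun hx j)
    have hI : Module.Free R (LinearMap.range π) ∧ Module.Finite R (LinearMap.range π) := by
      obtain ⟨b, hb⟩ := (IsPrincipalIdealRing.principal (LinearMap.range π)).principal
      by_cases h0 : b = 0
      · have : Subsingleton (LinearMap.range π) := by
          rw [hb, h0, Submodule.span_zero_singleton]
          infer_instance
        exact ⟨inferInstance, inferInstance⟩
      · have e : R ≃ₗ[R] LinearMap.range π := by
          rw [hb, ← LinearMap.range_toSpanSingleton]
          exact LinearEquiv.ofInjective _ (mul_left_injective₀ h0)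
        exact ⟨Module.Free.of_equiv e, Module.Finite.equiv e⟩
    have := hI.1
    have := hI.2
    obtain ⟨s, hs⟩ := Module.projective_lifting_property π.rangeRestrict LinearMap.id
      π.surjective_rangeRestrict
    have e : M ≃ₗ[R] LinearMap.ker π × LinearMap.range π := by
      have hex : Function.Exact (LinearMap.ker π).subtype π.rangeRestrict := by
        rw [LinearMap.exact_iff, Submodule.range_subtype, LinearMap.ker_rangeRestrict]
      exact (hex.splitSurjectiveEquiv (Submodule.subtype_injective _) ⟨s, hs⟩).1
    exact ⟨Module.Free.of_equiv e.symm, Module.Finite.equiv e.symm⟩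

theorem Module.free_and_finite_of_injective {R : Type*} [Ring R] [NoZeroDivisors R]
    [IsPrincipalIdealRing R] {M N : Type*} [AddCommGroup M] [Module R M] [AddCommGroup N]
    [Module R N] [Module.Free R M] [Module.Finite R M] (i : N →ₗ[R] M) (hi : Function.Injective i) :
    Module.Free R N ∧ Module.Finite R N := by
  rcases subsingleton_or_nontrivial R with h | h
  · have := Module.subsingleton R N
    exact ⟨inferInstance, inferInstance⟩
  let e := (Module.Free.chooseBasis R M).equivFun
  have e' := e.trans (LinearEquiv.funCongrLeft R R (Fintype.equivFin _).symm)
  exact free_and_finite_of_injective_pi _ (e'.toLinearMap.comp i) (e'.injective.comp hi)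

namespace SkewPolynomial

variable {K : Type*} [Field K]

theorem exists_coeff_ne_zero {p : SkewPolynomial K} (hp : p ≠ 0) :
    ∃ n, coeff p n ≠ 0 ∧ ∀ m, n < m → coeff p m = 0 := by
  have hs : p.support.Nonempty := by
    rw [Finset.nonempty_iff_ne_empty]
    intro h
    refine hp (SkewPolynomial.ext_iff.mpr fun n => ?_)
    have : n ∉ p.support := by simp [h]
    rwa [notMem_support_iff] at this
  refine ⟨p.support.max' hs, mem_support_iff.mp (p.support.max'_mem hs), fun m hm => ?_⟩
  by_contra h
  exact (hm.trans_le (p.support.le_max' m (mem_support_iff.mpr h))).false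

variable [MulSemiringAction (Multiplicative ℕ) K]

theorem coeff_monomial_mul_add (k : ℕ) (c : K) (p : SkewPolynomial K) (n : ℕ) :
    coeff (monomial k c * p) (k + n) = c * (Multiplicative.ofAdd k • coeff p n) :=
  SkewMonoidAlgebra.coeff_single_mul_aux _ fun a => by
    rw [ofAdd_add]
    exact mul_right_inj _

theorem coeff_mul_eq_zero (k n : ℕ) (p q : SkewPolynomial K) (hp : ∀ m, k ≤ m → coeff p m = 0)
    (hq : ∀ m, n < m → coeff q m = 0) : coeff (p * q) (k + n) = 0 := by
  induction k generalizing p n with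
  | zero =>
    have : p = 0 := SkewPolynomial.ext_iff.mpr fun m => hp m (Nat.zero_le m)
    rw [this, zero_mul]; rfl
  | succ k ih =>
    rw [← monomial_add_erase p k, add_mul, coeff_add, add_assoc, coeff_monomial_mul_add,
      hq _ (by omega), smul_zero, mul_zero, zero_add]
    refine ih (1 + n) _ (fun m hm => ?_) fun m hm => hq m (by omega)
    rw [coeff_erase]
    split_ifs with h
    · rfl
    · exact hp m (by omega)

theorem smul_ne_zero_of_field (g : Multiplicative ℕ) {x : K} (hx : x ≠ 0) : g • x ≠ 0 :=
  (map_ne_zero (MulSemiringAction.toRingHom (Multiplicative ℕ) K g)).mpr hx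

/-- Leading coefficients multiply up to a twist, which is injective on a field. -/
theorem noZeroDivisors : NoZeroDivisors (SkewPolynomial K) where
  eq_zero_or_eq_zero_of_mul_eq_zero {p q} h := by
    by_contra! h0
    obtain ⟨k, hk, hk'⟩ := exists_coeff_ne_zero h0.1
    obtain ⟨n, hn, hn'⟩ := exists_coeff_ne_zero h0.2
    have h1 : coeff (p * q) (k + n) = 0 := by rw [h]; rfl
    rw [← monomial_add_erase p k, add_mul, coeff_add, coeff_monomial_mul_add,
      coeff_mul_eq_zero k n _ q (fun m hm => ?_) hn', add_zero] at h1
    · exact mul_ne_zero hk (smul_ne_zero_of_field _ hn) h1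
    · rw [coeff_erase]
      split_ifs with h
      · rfl
      · exact hk' m (by omega)

/-- Left ideals are generated by an element b of least degree, by division with remainder.
Multiplying b on the left by a monomial twists its leading coefficient but leaves it invertible, so
division needs no root extraction. -/
theorem isPrincipalIdealRing : IsPrincipalIdealRing (SkewPolynomial K) where
  principal I := by
    classical
    by_cases hI : I = ⊥
    · rw [hI]; infer_instance
    obtain ⟨p, hp, hp0⟩ := Submodule.exists_mem_ne_zero_of_ne_bot hI
    have hex : ∃ n, ∃ b ∈ I, coeff b n ≠ 0 ∧ ∀ m, n < m → coeff b m = 0 := by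
      obtain ⟨n, hn⟩ := exists_coeff_ne_zero hp0
      exact ⟨n, p, hp, hn⟩
    obtain ⟨b, hb, hbn, hb'⟩ := Nat.find_spec hex
    set n := Nat.find hex with hn
    refine ⟨b, le_antisymm (fun a ha => ?_) ((Submodule.span_singleton_le_iff_mem _ _).mpr hb)⟩
    have key : ∀ (m : ℕ) (a : SkewPolynomial K), a ∈ I → (∀ j, m ≤ j → coeff a j = 0) →
        a ∈ Submodule.span (SkewPolynomial K) {b} := by
      intro m
      induction m with
      | zero =>
        intro a _ h
        have : a = 0 := SkewPolynomial.ext_iff.mpr fun m => h m (Nat.zero_le m)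
        rw [this]
        exact zero_mem _
      | succ m ih =>
        intro a ha h
        rcases lt_or_ge m n with hmn | hmn
        · refine ih a ha fun j hj => ?_
          by_contra h0
          obtain rfl : j = m := by
            by_contra hj'
            exact h0 (h j (by omega))
          exact Nat.find_min hex hmn ⟨a, ha, h0, fun i hi => h i hi⟩
        · obtain ⟨d, rfl⟩ := Nat.exists_eq_add_of_le' hmn
          set c := coeff a (d + n) / (Multiplicative.ofAdd d • coeff b n) with hc
          have hmem : monomial d c * b ∈ Submodule.span (SkewPolynomial K) {b} :=
            Submodule.smul_mem _ _ (Submodule.mem_span_singleton_self b)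
          have h1 : monomial d c * b ∈ I := I.mul_mem_left _ hb
          rw [← sub_add_cancel a (monomial d c * b)]
          refine add_mem (ih _ (sub_mem ha h1) fun j hj => ?_) hmem
          obtain ⟨i, rfl⟩ := Nat.exists_eq_add_of_le hj
          rw [coeff_sub, add_assoc, coeff_monomial_mul_add]
          rcases Nat.eq_zero_or_pos i with rfl | hi
          · rw [add_zero, hc, div_mul_cancel₀ _ (smul_ne_zero_of_field _ hbn), sub_self]
          · rw [hb' _ (by omega), smul_zero, mul_zero, h _ (by omega), sub_zero]
    by_cases h0 : a = 0
    · rw [h0]; exact zero_mem _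
    · obtain ⟨k, -, hk⟩ := exists_coeff_ne_zero h0
      exact key (k + 1) a ha fun j hj => hk j hj

end SkewPolynomial

namespace DualTMotive

variable (Fq : Type*) [Field Fq] [Fintype Fq]

instance : NoZeroDivisors (KSigma Fq) := SkewPolynomial.noZeroDivisors (K := KBar Fq)

instance : IsPrincipalIdealRing (KSigma Fq) := SkewPolynomial.isPrincipalIdealRing (K := KBar Fq)

end DualTMotive

/-! ### Divisibility in ℂ_∞{t} by elements of 𝔽_q[t] -/

namespace DualTMotive

/-- A nonzero polynomial over a finite field divides some `X ^ (m + n) - X ^ m`. -/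
theorem exists_dvd_X_pow_sub_X_pow {Fq : Type*} [Field Fq] [Finite Fq] {c : Fq[X]} (hc : c ≠ 0) :
    ∃ m n : ℕ, 0 < n ∧ c ∣ X ^ (m + n) - X ^ m := by
  -- The residue ring is finite, so two distinct powers of X agree in it.
  have : Finite (Fq[X] ⧸ Ideal.span {c}) := by
    have : Module.Finite Fq (AdjoinRoot c) := (AdjoinRoot.powerBasis hc).finite
    exact Module.finite_of_finite Fq (M := AdjoinRoot c)
  obtain ⟨i, j, hij, h⟩ := Finite.exists_ne_map_eq_of_infinite
    (fun n : ℕ => Ideal.Quotient.mk (Ideal.span {c}) (X ^ n))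
  wlog hlt : i < j generalizing i j
  · exact this j i hij.symm h.symm (by omega)
  refine ⟨i, j - i, by omega, ?_⟩
  rw [Nat.add_sub_cancel' hlt.le, ← Ideal.mem_span_singleton, ← Ideal.Quotient.eq]
  exact h.symm

variable (Fq : Type*) [Field Fq] [Fintype Fq]

instance : IsDomain (Tate Fq) := inferInstanceAs (IsDomain (tateSubring Fq))

theorem algebraMap_Fq_Tate (c : Fq[X]) : algebraMap Fq[X] (Tate Fq) c =
    algebraMap (KBar Fq)[X] (Tate Fq) (c.map (algebraMap Fq (KBar Fq))) := rfl

theorem algebraMap_KBar_Tate_injective :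
    Function.Injective (algebraMap (KBar Fq)[X] (Tate Fq)) := by
  intro p q h
  have h1 := congrArg (Tate.toPowerSeries Fq) h
  rw [Tate.toPowerSeries_algebraMap, Tate.toPowerSeries_algebraMap] at h1
  exact Polynomial.map_injective _ (algebraMap (KBar Fq) (CInfty Fq)).injective
    (Polynomial.coe_injective _ h1)

/-- If `c f` is a polynomial for some nonzero `c ∈ 𝔽_q[t]` then `f` is a polynomial. -/
theorem exists_eq_algebraMap_of_smul_eq {c : Fq[X]} (hc : c ≠ 0) (f : Tate Fq) (p : (KBar Fq)[X])
    (h : c • f = algebraMap (KBar Fq)[X] (Tate Fq) p) :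
    ∃ g, f = algebraMap (KBar Fq)[X] (Tate Fq) g := by
  obtain ⟨m, n, hn, d, hd⟩ := exists_dvd_X_pow_sub_X_pow hc
  set F := Tate.toPowerSeries Fq f with hF
  set r : (CInfty Fq)[X] := (d.map (algebraMap Fq (KBar Fq)) * p).map (algebraMap (KBar Fq)
      (CInfty Fq))
  have h1 : (PowerSeries.X ^ (m + n) - PowerSeries.X ^ m) * F = (r : PowerSeries (CInfty Fq)) := by
    have h2 : (X ^ (m + n) - X ^ m : Fq[X]) • f =
        algebraMap (KBar Fq)[X] (Tate Fq) (d.map (algebraMap Fq (KBar Fq)) * p) := by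
      rw [hd, mul_comm, mul_smul, h, Algebra.smul_def, algebraMap_Fq_Tate, map_mul]
    rw [← Tate.toPowerSeries_algebraMap, ← h2, Algebra.smul_def, map_mul, algebraMap_Fq_Tate,
      Tate.toPowerSeries_algebraMap]
    simp [hF]
  -- Multiplying by a suitable polynomial replaces c by X^(m+n) - X^m, and then the coefficients of
  -- F beyond the degree of r are n-periodic. As they tend to zero, they vanish.
  have hper : ∀ j, r.natDegree < j → PowerSeries.coeff (j + n) F = PowerSeries.coeff j F := by
    intro j hj
    have h2 := congrArg (PowerSeries.coeff (j + (m + n))) h1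
    rw [Polynomial.coeff_coe, Polynomial.coeff_eq_zero_of_natDegree_lt (by omega), sub_mul, map_sub,
      PowerSeries.coeff_X_pow_mul, show j + (m + n) = j + n + m by ring,
      PowerSeries.coeff_X_pow_mul, sub_eq_zero] at h2
    exact h2.symm
  have hper' : ∀ j, r.natDegree < j → ∀ k, PowerSeries.coeff (j + n * k) F = PowerSeries.coeff j
      F := by
    intro j hj k
    induction k with
    | zero => simp
    | succ k ih => rw [mul_add, mul_one, ← add_assoc, hper _ (by omega), ih]
  have hzero : ∀ j, r.natDegree < j → PowerSeries.coeff j F = 0 := by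
    intro j hj
    have hlim := (mem_tateSubring Fq).mp f.2
    have h3 : Filter.Tendsto (fun k : ℕ => j + n * k) Filter.atTop Filter.atTop :=
      Filter.tendsto_atTop_mono (fun k => (Nat.le_mul_of_pos_left k hn).trans (Nat.le_add_left _ _))
        Filter.tendsto_id
    have h4 := hlim.comp h3
    have h5 : (fun k : ℕ => ‖PowerSeries.coeff j F‖) = (fun n => ‖PowerSeries.coeff n f.1‖) ∘ fun
        k : ℕ => j + n * k :=
      funext fun k => congrArg _ (hper' j hj k).symm
    rw [← h5] at h4
    exact norm_eq_zero.mp (tendsto_nhds_unique tendsto_const_nhds h4)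
  set G : (CInfty Fq)[X] := PowerSeries.trunc (r.natDegree + 1) F
  have hG : (G : PowerSeries (CInfty Fq)) = F := by
    ext j
    rw [Polynomial.coeff_coe, PowerSeries.coeff_trunc]
    split_ifs with hj
    · rfl
    · exact (hzero j (by omega)).symm
  -- F is now a polynomial over ℂ_∞, and divisibility of polynomials descends from ℂ_∞ to k̄.
  have hdvd : (c.map (algebraMap Fq (KBar Fq))) ∣ p := by
    rw [← Polynomial.map_dvd_map' (algebraMap (KBar Fq) (CInfty Fq))]
    refine ⟨G, Polynomial.coe_injective _ ?_⟩
    rw [Polynomial.coe_mul, hG, ← Tate.toPowerSeries_algebraMap, ← Tate.toPowerSeries_algebraMap,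
      ← h, Algebra.smul_def, map_mul]
    rfl
  obtain ⟨g, rfl⟩ := hdvd
  refine ⟨g, ?_⟩
  have hc' : algebraMap (KBar Fq)[X] (Tate Fq) (c.map (algebraMap Fq (KBar Fq))) ≠ 0 := by
    rw [Ne, ← (algebraMap (KBar Fq)[X] (Tate Fq)).map_zero,
      (algebraMap_KBar_Tate_injective Fq).eq_iff]
    exact (Polynomial.map_ne_zero_iff (algebraMap Fq (KBar Fq)).injective).mpr hc
  refine mul_left_cancel₀ hc' ?_
  rw [← map_mul, ← h, Algebra.smul_def, algebraMap_Fq_Tate]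

theorem algebraMap_Fq_Tate_injective : Function.Injective (algebraMap Fq[X] (Tate Fq)) :=
  (algebraMap_KBar_Tate_injective Fq).comp
    (Polynomial.map_injective _ (algebraMap Fq (KBar Fq)).injective)

instance : Module.IsTorsionFree Fq[X] (Tate Fq) :=
  Module.isTorsionFree_iff_algebraMap_injective.mpr (algebraMap_Fq_Tate_injective Fq)

theorem isUnit_of_isUnit_algebraMap_Tate {c : Fq[X]} (h : IsUnit (algebraMap Fq[X] (Tate Fq) c)) :
    IsUnit c := by
  obtain ⟨f, hf⟩ := h.exists_right_inv
  have hc : c ≠ 0 := by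
    rintro rfl
    rw [map_zero, zero_mul] at hf
    exact zero_ne_one hf
  obtain ⟨g, rfl⟩ := exists_eq_algebraMap_of_smul_eq Fq hc f 1
    (by rw [Algebra.smul_def, hf, map_one])
  rw [algebraMap_Fq_Tate, ← map_mul, ← map_one (algebraMap (KBar Fq)[X] (Tate Fq)),
    (algebraMap_KBar_Tate_injective Fq).eq_iff] at hf
  have h1 : IsUnit (c.map (algebraMap Fq (KBar Fq))) := .of_mul_eq_one _ hf
  rw [Polynomial.isUnit_iff_degree_eq_zero] at h1 ⊢
  rwa [Polynomial.degree_map] at h1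

/-- Torsion-free modules over a principal ideal domain are flat. Faithfulness means that no nonunit
c becomes a unit in ℂ_∞{t}: an inverse would be a polynomial by the divisibility statement above. -/
instance : Module.FaithfullyFlat Fq[X] (Tate Fq) where
  submodule_ne_top m hm h := by
    obtain ⟨c, rfl⟩ := (IsPrincipalIdealRing.principal m).principal
    refine hm.ne_top ?_
    have h1 : (1 : Tate Fq) ∈ (Ideal.span {c} • ⊤ : Submodule Fq[X] (Tate Fq)) := by
      rw [Ideal.submodule_span_eq] at h
      rw [h]
      exact Submodule.mem_top
    rw [Submodule.ideal_span_singleton_smul] at h1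
    obtain ⟨f, -, hf⟩ := Submodule.mem_smul_pointwise_iff_exists _ _ _ |>.mp h1
    rw [Ideal.submodule_span_eq, Ideal.span_singleton_eq_top]
    refine isUnit_of_isUnit_algebraMap_Tate Fq (.of_mul_eq_one f ?_)
    rw [← hf, Algebra.smul_def]

end DualTMotive

/-! ### Functoriality of H̃ and H^Betti, and the action of endomorphisms -/

namespace DualTMotive

section ResMap

variable {R S : Type*} [Semiring R] [Semiring S] (j : R →+* S) {M M' M'' : Type*}
  [AddCommGroup M] [Module S M] [AddCommGroup M'] [Module S M'] [AddCommGroup M''] [Module S M'']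

/-- Restriction of scalars of a linear map. -/
def Res.map (f : M →ₗ[S] M') : Res j M →ₗ[R] Res j M' where
  toFun m := Res.of j M' (f ((Res.of j M).symm m))
  map_add' x y := by simp
  map_smul' r x := f.map_smul (j r) x

theorem Res.map_id : Res.map j (LinearMap.id : M →ₗ[S] M) = LinearMap.id := rfl

theorem Res.map_comp (g : M' →ₗ[S] M'') (f : M →ₗ[S] M') :
    Res.map j (g.comp f) = (Res.map j g).comp (Res.map j f) := rfl

end ResMap

variable (Fq : Type*) [Field Fq] [Fintype Fq]

theorem smul_map_Fq (n : Multiplicative ℕ) (p : Fq[X]) :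
    n • p.map (algebraMap Fq (KBar Fq)) = p.map (algebraMap Fq (KBar Fq)) := by
  ext i
  rw [Polynomial.coeff_smul, Polynomial.coeff_map, smul_algebraMap_Fq]

theorem inclT_map_comm (p : Fq[X]) (x : KTSigma Fq) :
    inclT Fq (p.map (algebraMap Fq (KBar Fq))) * x =
      x * inclT Fq (p.map (algebraMap Fq (KBar Fq))) := by
  have h : Commute (inclT Fq (p.map (algebraMap Fq (KBar Fq)))) (SkewPoly.sigma (KBar Fq)[X]) := by
    change SkewPoly.C _ * _ = _ * SkewPoly.C _
    rw [SkewPoly.sigma_mul_C, smul_map_Fq]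
  induction x using SkewPoly.induction_on with
  | add x y hx hy => rw [mul_add, add_mul, hx, hy]
  | monomial r n =>
    have h' : Commute (inclT Fq (p.map (algebraMap Fq (KBar Fq)))) (SkewPoly.C r) := by
      change SkewPoly.C _ * SkewPoly.C _ = SkewPoly.C _ * SkewPoly.C _
      rw [← map_mul, mul_comm, map_mul]
    exact h'.mul_right (h.pow_right n)

variable {M M' M'' : Type*} [AddCommGroup M] [Module (KTSigma Fq) M] [AddCommGroup M']
  [Module (KTSigma Fq) M'] [AddCommGroup M''] [Module (KTSigma Fq) M'']

variable (M) in
/-- Multiplication by an element of `𝔽_q[t]`, as an endomorphism of a `k̄[t, σ]`-module. -/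
def scalarEnd (c : Fq[X]) : Module.End (KTSigma Fq) M where
  toFun m := inclT Fq (c.map (algebraMap Fq (KBar Fq))) • m
  map_add' := smul_add _
  map_smul' x m := by rw [RingHom.id_apply, smul_smul, smul_smul, inclT_map_comm]

theorem scalarEnd_apply (c : Fq[X]) (m : M) :
    scalarEnd Fq M c m = inclT Fq (c.map (algebraMap Fq (KBar Fq))) • m := rfl

/-- The functor `H ↦ H̃` on morphisms. -/
def HTilde.map (f : M →ₗ[KTSigma Fq] M') : HTilde Fq M →ₗ[Tate Fq] HTilde Fq M' :=
  (Res.map (inclT Fq) f).baseChange (Tate Fq)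

theorem HTilde.map_tmul (f : M →ₗ[KTSigma Fq] M') (a : Tate Fq) (m : Res (inclT Fq) M) :
    HTilde.map Fq f (a ⊗ₜ m) = a ⊗ₜ Res.map (inclT Fq) f m := rfl

theorem HTilde.map_id : HTilde.map Fq (LinearMap.id : M →ₗ[KTSigma Fq] M) = LinearMap.id := by
  rw [HTilde.map, Res.map_id, LinearMap.baseChange_id]

theorem HTilde.map_comp (g : M' →ₗ[KTSigma Fq] M'') (f : M →ₗ[KTSigma Fq] M') :
    HTilde.map Fq (g.comp f) = (HTilde.map Fq g).comp (HTilde.map Fq f) := by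
  rw [HTilde.map, Res.map_comp, LinearMap.baseChange_comp]; rfl

theorem HTilde.map_sigmaTilde (f : M →ₗ[KTSigma Fq] M') (x : HTilde Fq M) :
    HTilde.map Fq f (sigmaTilde Fq M x) = sigmaTilde Fq M' (HTilde.map Fq f x) := by
  induction x using TensorProduct.induction_on with
  | zero => simp only [map_zero]
  | add x y hx hy => simp only [map_add, hx, hy]
  | tmul a m =>
    rw [sigmaTilde_tmul, HTilde.map_tmul, HTilde.map_tmul, sigmaTilde_tmul]
    congr 1
    exact f.map_smul _ _

/-- The functor `H ↦ H^Betti` on morphisms. -/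
def bettiMap (f : M →ₗ[KTSigma Fq] M') : betti Fq M →ₗ[Fq[X]] betti Fq M' :=
  ((HTilde.map Fq f).restrictScalars Fq[X]).restrict fun x (hx : sigmaTilde Fq M x = x) => by
    change sigmaTilde Fq M' (HTilde.map Fq f x) = HTilde.map Fq f x
    rw [← HTilde.map_sigmaTilde, hx]

theorem bettiMap_id : bettiMap Fq (LinearMap.id : M →ₗ[KTSigma Fq] M) = LinearMap.id :=
  LinearMap.ext fun _ => Subtype.ext (LinearMap.congr_fun (HTilde.map_id Fq) _)

theorem bettiMap_comp (g : M' →ₗ[KTSigma Fq] M'') (f : M →ₗ[KTSigma Fq] M') :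
    bettiMap Fq (g.comp f) = (bettiMap Fq g).comp (bettiMap Fq f) :=
  LinearMap.ext fun _ => Subtype.ext (LinearMap.congr_fun (HTilde.map_comp Fq g f) _)

variable (M) in
/-- The action of the endomorphism ring of `H` on `H^Betti`. -/
def bettiEnd : Module.End (KTSigma Fq) M →+* Module.End Fq[X] (betti Fq M) where
  toFun f := bettiMap Fq f
  map_one' := bettiMap_id Fq
  map_mul' f g := bettiMap_comp Fq f g
  map_zero' := LinearMap.ext fun _ => Subtype.ext
    (LinearMap.congr_fun (LinearMap.baseChange_zero : (0 : Res (inclT Fq) M →ₗ[(KBar Fq)[X]]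
      Res (inclT Fq) M).baseChange (Tate Fq) = 0) _)
  map_add' f g := LinearMap.ext fun _ => Subtype.ext
    (LinearMap.congr_fun (LinearMap.baseChange_add (Res.map (inclT Fq) f) (Res.map (inclT Fq) g)) _)

theorem finrank_range_bettiEnd_of_retract (i : M' →ₗ[KTSigma Fq] M) (p : M →ₗ[KTSigma Fq] M')
    (hpi : p.comp i = LinearMap.id) :
    Module.finrank Fq[X] (LinearMap.range (bettiEnd Fq M (i.comp p))) =
      Module.finrank Fq[X] (betti Fq M') := by
  have hB : (bettiMap Fq p).comp (bettiMap Fq i) = LinearMap.id := by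
    rw [← bettiMap_comp, hpi, bettiMap_id]
  have hrange : LinearMap.range (bettiEnd Fq M (i.comp p)) = LinearMap.range (bettiMap Fq i) :=
    (congrArg LinearMap.range (bettiMap_comp Fq i p)).trans <|
      LinearMap.range_comp_of_range_eq_top _ <| LinearMap.range_eq_top.mpr <|
        Function.RightInverse.surjective (LinearMap.congr_fun hB)
  rw [hrange, LinearMap.finrank_range_of_inj
    (Function.LeftInverse.injective (g := bettiMap Fq p) (LinearMap.congr_fun hB))]

theorem smul_inclT_tmul (c : Fq[X]) (a : Tate Fq) (m : Res (inclT Fq) M) :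
    a ⊗ₜ[(KBar Fq)[X]] (c.map (algebraMap Fq (KBar Fq)) • m) = (c • a) ⊗ₜ m := by
  rw [← TensorProduct.smul_tmul, Algebra.smul_def, Algebra.smul_def, algebraMap_Fq_Tate]

theorem HTilde.map_scalarEnd (c : Fq[X]) (x : HTilde Fq M) :
    HTilde.map Fq (scalarEnd Fq M c) x = c • x := by
  induction x using TensorProduct.induction_on with
  | zero => simp only [map_zero, smul_zero]
  | add x y hx hy => simp only [map_add, hx, hy, smul_add]
  | tmul a m => exact smul_inclT_tmul Fq c a m

theorem bettiEnd_scalarEnd (c : Fq[X]) :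
    bettiEnd Fq M (scalarEnd Fq M c) = algebraMap Fq[X] _ c :=
  LinearMap.ext fun x => Subtype.ext (HTilde.map_scalarEnd (M := M) Fq c x)

theorem IsRigidAnalyticallyTrivial.induction_on (hrat : IsRigidAnalyticallyTrivial Fq M)
    {motive : HTilde Fq M → Prop} (y : HTilde Fq M) (zero : motive 0)
    (smul : ∀ (a : Tate Fq), ∀ x ∈ betti Fq M, motive (a • x))
    (add : ∀ x y, motive x → motive y → motive (x + y)) : motive y := by
  obtain ⟨z, rfl⟩ := hrat.2 y
  induction z using TensorProduct.induction_on with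
  | zero => rwa [map_zero]
  | add x y hx hy => rw [map_add]; exact add _ _ hx hy
  | tmul a x => rw [LinearMap.liftBaseChange_tmul]; exact smul a x x.2

theorem HTilde.map_ext_of_betti (hrat : IsRigidAnalyticallyTrivial Fq M)
    {f g : HTilde Fq M →ₗ[Tate Fq] HTilde Fq M'} (h : ∀ x ∈ betti Fq M, f x = g x) : f = g := by
  refine LinearMap.ext fun y => ?_
  induction y using hrat.induction_on with
  | zero => simp only [map_zero]
  | smul a x hx => rw [map_smul, map_smul, h x hx]
  | add x y hx hy => rw [map_add, map_add, hx, hy]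

theorem HTilde.map_liftBaseChange (f : M →ₗ[KTSigma Fq] M') (x : Tate Fq ⊗[Fq[X]] betti Fq M) :
    HTilde.map Fq f ((betti Fq M).subtype.liftBaseChange (Tate Fq) x) =
      (betti Fq M').subtype.liftBaseChange (Tate Fq) ((bettiMap Fq f).baseChange (Tate Fq) x) := by
  induction x using TensorProduct.induction_on with
  | zero => simp only [map_zero]
  | add x y hx hy => simp only [map_add, hx, hy]
  | tmul a x =>
    rw [LinearMap.liftBaseChange_tmul, LinearMap.baseChange_tmul, LinearMap.liftBaseChange_tmul,
      map_smul]
    rfl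

/-- The comparison map is natural in H, and a retract of a bijection is a bijection. -/
theorem IsRigidAnalyticallyTrivial.of_retract (i : M' →ₗ[KTSigma Fq] M) (p : M →ₗ[KTSigma Fq] M')
    (hpi : p.comp i = LinearMap.id) (hrat : IsRigidAnalyticallyTrivial Fq M) :
    IsRigidAnalyticallyTrivial Fq M' := by
  have hH : ∀ y, HTilde.map Fq p (HTilde.map Fq i y) = y := fun y => by
    rw [← LinearMap.comp_apply, ← HTilde.map_comp, hpi, HTilde.map_id, LinearMap.id_apply]
  have hB : (bettiMap Fq p).comp (bettiMap Fq i) = LinearMap.id :=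
    LinearMap.ext fun x => Subtype.ext (hH x)
  constructor
  · refine (injective_iff_map_eq_zero _).mpr fun x hx => ?_
    have h1 := HTilde.map_liftBaseChange Fq i x
    rw [hx, map_zero] at h1
    have h2 := (injective_iff_map_eq_zero _).mp hrat.1 _ h1.symm
    have h3 := congrArg ((bettiMap Fq p).baseChange (Tate Fq)) h2
    rwa [map_zero, ← LinearMap.comp_apply, ← LinearMap.baseChange_comp, hB,
      LinearMap.baseChange_id, LinearMap.id_apply] at h3
  · intro y
    obtain ⟨z, hz⟩ := hrat.2 (HTilde.map Fq i y)
    exact ⟨(bettiMap Fq p).baseChange (Tate Fq) z, by rw [← HTilde.map_liftBaseChange, hz, hH]⟩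

/-- Finiteness descends from H̃ along the faithfully flat extension 𝔽_q[t] ⊂ ℂ_∞{t}. -/
theorem IsRigidAnalyticallyTrivial.finite_betti
    [Module.Finite (KBar Fq)[X] (Res (inclT Fq) M)] (hrat : IsRigidAnalyticallyTrivial Fq M) :
    Module.Finite Fq[X] (betti Fq M) := by
  have : Module.Finite (Tate Fq) (Tate Fq ⊗[Fq[X]] betti Fq M) :=
    Module.Finite.equiv (LinearEquiv.ofBijective _ hrat).symm
  exact Module.Finite.of_finite_tensorProduct_of_faithfullyFlat (R := Fq[X]) (M := betti Fq M)
      (Tate Fq)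

section

variable [Module.Free (KBar Fq)[X] (Res (inclT Fq) M)]

theorem HTilde.tmul_injective :
    Function.Injective fun m : Res (inclT Fq) M => (1 : Tate Fq) ⊗ₜ[(KBar Fq)[X]] m := by
  have h := Module.Flat.rTensor_preserves_injective_linearMap (M := Res (inclT Fq) M)
    (Algebra.linearMap (KBar Fq)[X] (Tate Fq)) (algebraMap_KBar_Tate_injective Fq)
  intro x y hxy
  have h1 := @h (1 ⊗ₜ x) (1 ⊗ₜ y) (by simpa using hxy)
  simpa using congrArg (TensorProduct.lid _ _) h1

/-- In a k̄[t]-basis of M this is coordinatewise the divisibility statement for ℂ_∞{t}. -/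
theorem exists_scalarEnd_eq {c : Fq[X]} (hc : c ≠ 0)
    (m : Res (inclT Fq) M) (y : HTilde Fq M) (h : (1 : Tate Fq) ⊗ₜ m = c • y) :
    ∃ m' : Res (inclT Fq) M, m = c.map (algebraMap Fq (KBar Fq)) • m' := by
  let b := Module.Free.chooseBasis (KBar Fq)[X] (Res (inclT Fq) M)
  let b' := b.baseChange (Tate Fq)
  have h1 : ∀ i, ∃ g, b.repr m i = c.map (algebraMap Fq (KBar Fq)) * g := fun i => by
    have h2 : b'.repr (c • y) i = c • b'.repr y i := by
      rw [Algebra.smul_def, ← smul_eq_mul, ← Finsupp.smul_apply, ← map_smul, algebraMap_smul]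
    have h3 : c • b'.repr y i = algebraMap (KBar Fq)[X] (Tate Fq) (b.repr m i) := by
      rw [← h2, ← h]
      simp [b', Algebra.smul_def]
    obtain ⟨g, hg⟩ := exists_eq_algebraMap_of_smul_eq Fq hc _ (b.repr m i) h3
    refine ⟨g, algebraMap_KBar_Tate_injective Fq ?_⟩
    rw [← h3, hg, map_mul, Algebra.smul_def, algebraMap_Fq_Tate]
  choose g hg using h1
  refine ⟨∑ i ∈ (b.repr m).support, g i • b i, ?_⟩
  conv_lhs => rw [← b.linearCombination_repr m, Finsupp.linearCombination_apply, Finsupp.sum]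
  rw [Finset.smul_sum]
  exact Finset.sum_congr rfl fun i _ => by rw [hg, mul_smul]

theorem isTorsionFree_betti : Module.IsTorsionFree Fq[X] (betti Fq M) := by
  have : Module.IsTorsionFree Fq[X] (HTilde Fq M) := Module.IsTorsionFree.trans_faithfulSMul
      Fq[X] (Tate Fq) _
  infer_instance

/-- An endomorphism of H̃ is determined on H^Betti, which spans, and M embeds into H̃ by flatness.
-/
theorem bettiEnd_injective (hrat : IsRigidAnalyticallyTrivial Fq M) :
    Function.Injective (bettiEnd Fq M) := by
  intro f g hfg
  have h := HTilde.map_ext_of_betti Fq hrat (f := HTilde.map Fq f) (g := HTilde.map Fq g)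
    fun x hx => congrArg Subtype.val (LinearMap.congr_fun hfg ⟨x, hx⟩)
  exact LinearMap.ext fun m => HTilde.tmul_injective Fq (LinearMap.congr_fun h (1 ⊗ₜ m))

theorem scalarEnd_injective {c : Fq[X]} (hc : c ≠ 0) : Function.Injective (scalarEnd Fq M c) := by
  have hc' : c.map (algebraMap Fq (KBar Fq)) ≠ 0 :=
    (Polynomial.map_ne_zero_iff (algebraMap Fq (KBar Fq)).injective).mpr hc
  exact fun x y h => smul_right_injective (R := (KBar Fq)[X]) (Res (inclT Fq) M) hc'
    (a₁ := Res.of (inclT Fq) M x) (a₂ := Res.of (inclT Fq) M y) h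

/-- The image of the endomorphism ring in `End(H^Betti)` is saturated. -/
theorem exists_bettiEnd_eq_of_smul (hrat : IsRigidAnalyticallyTrivial Fq M) {c : Fq[X]} (hc : c ≠ 0)
    (φ : Module.End Fq[X] (betti Fq M)) (f : Module.End (KTSigma Fq) M)
    (h : bettiEnd Fq M f = c • φ) : ∃ g, bettiEnd Fq M g = φ := by
  let E : (Tate Fq ⊗[Fq[X]] betti Fq M) ≃ₗ[Tate Fq] HTilde Fq M := LinearEquiv.ofBijective _ hrat
  let Φ : HTilde Fq M →ₗ[Tate Fq] HTilde Fq M :=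
    E.toLinearMap.comp ((φ.baseChange (Tate Fq)).comp E.symm.toLinearMap)
  have hE : ∀ x : betti Fq M, E (1 ⊗ₜ x) = x := fun x => by
    change (betti Fq M).subtype.liftBaseChange (Tate Fq) (1 ⊗ₜ x) = x
    rw [LinearMap.liftBaseChange_tmul, one_smul]
    rfl
  have hΦ : ∀ x : betti Fq M, Φ x = φ x := fun x => by
    change E (φ.baseChange (Tate Fq) (E.symm x)) = φ x
    rw [← hE x, LinearEquiv.symm_apply_apply, LinearMap.baseChange_tmul, hE]
  have hf : HTilde.map Fq f = algebraMap Fq[X] (Tate Fq) c • Φ :=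
    HTilde.map_ext_of_betti Fq hrat fun x hx => by
      rw [LinearMap.smul_apply, algebraMap_smul, hΦ ⟨x, hx⟩]
      exact congrArg Subtype.val (LinearMap.congr_fun h ⟨x, hx⟩)
  -- Φ extends φ to H̃ and cΦ is induced by f, so f(m) is divisible by c in H̃, hence in M. The
  -- quotient is linear over k̄[t, σ] because multiplication by c is injective and central.
  have key : ∀ m : M, ∃ m' : M, f m = scalarEnd Fq M c m' := fun m =>
    exists_scalarEnd_eq Fq hc (Res.of (inclT Fq) M (f m)) (Φ (1 ⊗ₜ Res.of (inclT Fq) M m)) <| by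
      rw [← algebraMap_smul (Tate Fq) c, ← LinearMap.smul_apply, ← hf]
      rfl
  choose g hg using key
  have hinj := scalarEnd_injective (M := M) Fq hc
  let G : Module.End (KTSigma Fq) M :=
    { toFun := g
      map_add' := fun x y => hinj (by rw [map_add, ← hg, ← hg, ← hg, map_add])
      map_smul' := fun r x => hinj (by rw [RingHom.id_apply, map_smul, ← hg, ← hg, map_smul]) }
  refine ⟨G, ?_⟩
  have hG : scalarEnd Fq M c * G = f := LinearMap.ext fun m => (hg m).symm
  have := isTorsionFree_betti (M := M) Fq
  refine smul_right_injective (Module.End Fq[X] (betti Fq M)) hc ?_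
  change c • bettiEnd Fq M G = c • φ
  rw [← h, ← hG, map_mul, bettiEnd_scalarEnd, Algebra.smul_def]

variable [Module.Finite (KBar Fq)[X] (Res (inclT Fq) M)]

/-- Both sides are the rank of H̃ over ℂ_∞{t}. -/
theorem IsRigidAnalyticallyTrivial.finrank_betti (hrat : IsRigidAnalyticallyTrivial Fq M) :
    Module.finrank Fq[X] (betti Fq M) = Module.finrank (KBar Fq)[X] (Res (inclT Fq) M) := by
  have := hrat.finite_betti
  have := isTorsionFree_betti (M := M) Fq
  have : Module.Free Fq[X] (betti Fq M) :=
    Module.free_of_finite_type_torsion_free' (R := Fq[X]) (M := betti Fq M)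
  rw [← Module.finrank_baseChange (R := Tate Fq) (S := Fq[X]),
    (LinearEquiv.ofBijective _ hrat).finrank_eq, Module.finrank_baseChange]

end

end DualTMotive

/-! ### The ring L̄ over k̄[t], and subalgebras closed under division -/

namespace DualTMotive

variable (Fq : Type*) [Field Fq] [Fintype Fq] (L : Type*) [CommRing L] [Algebra Fq[X] L]
  [Algebra Fq L]

instance : Algebra (KBar Fq)[X] (LBar Fq L) := (polyToLBar Fq L).toAlgebra

theorem algebraMap_LBar (p : (KBar Fq)[X]) :
    algebraMap (KBar Fq)[X] (LBar Fq L) p = polyToLBar Fq L p := rfl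

theorem polyToLBar_C (x : KBar Fq) : polyToLBar Fq L (C x) = LBar.tmul Fq x 1 := by
  rw [polyToLBar, Polynomial.coe_eval₂RingHom, Polynomial.eval₂_C]
  rfl

theorem polyToLBar_X : polyToLBar Fq L X = toLBar Fq L (algebraMap Fq[X] L X) := by
  rw [polyToLBar, Polynomial.coe_eval₂RingHom, Polynomial.eval₂_X]

theorem C_smul_tmul (x y : KBar Fq) (a : L) :
    (C x : (KBar Fq)[X]) • LBar.tmul Fq y a = LBar.tmul Fq (x * y) a := by
  rw [Algebra.smul_def, algebraMap_LBar, polyToLBar_C, LBar.tmul_mul_tmul, one_mul]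

theorem X_smul_tmul (y : KBar Fq) (a : L) :
    (X : (KBar Fq)[X]) • LBar.tmul Fq y a = LBar.tmul Fq y ((X : Fq[X]) • a) := by
  rw [Algebra.smul_def, algebraMap_LBar, polyToLBar_X, toLBar_apply, LBar.tmul_mul_tmul, one_mul,
    Algebra.smul_def]

omit [Algebra Fq[X] L] in
theorem toLBar_injective : Function.Injective (toLBar Fq L) :=
  Algebra.TensorProduct.includeRight_injective (R := Fq) (A := KBar Fq) (B := L)
    (algebraMap Fq (KBar Fq)).injective

variable [IsScalarTower Fq Fq[X] L]

/-- An `𝔽_q[t]`-basis of `L` is a `k̄[t]`-basis of `L̄`. -/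
def LBar.equivFun {ι : Type*} [Fintype ι] [DecidableEq ι] (b : Module.Basis ι Fq[X] L) :
    LBar Fq L ≃ₗ[(KBar Fq)[X]] (ι → (KBar Fq)[X]) :=
  let e₀ : KBar Fq ⊗[Fq] L ≃+ (ι → (KBar Fq)[X]) :=
    (((TensorProduct.congr (LinearEquiv.refl Fq (KBar Fq)) (b.equivFun.restrictScalars Fq)).trans
      (TensorProduct.piRight Fq Fq (KBar Fq) fun _ : ι => Fq[X])).trans
      (LinearEquiv.piCongrRight fun _ => (polyEquivTensor Fq (KBar
          Fq)).symm.toLinearEquiv.restrictScalars Fq)).toAddEquiv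
  let e : LBar Fq L ≃+ (ι → (KBar Fq)[X]) := e₀
  have he : ∀ (x : KBar Fq) (a : L) i, e (LBar.tmul Fq x a) i = C x * (b.equivFun a i).map
      (algebraMap Fq (KBar Fq)) := by
    intro x a i
    change (polyEquivTensor Fq (KBar Fq)).symm (x ⊗ₜ b.equivFun a i) = _
    rw [polyEquivTensor_symm_apply_tmul_eq_smul, Polynomial.smul_eq_C_mul]
  { e with
    map_smul' := fun p z => by
      change e (p • z : LBar Fq L) = p • e z
      induction p using Polynomial.induction_on generalizing z with
      | C x =>
        induction z using LBar.induction_on with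
        | zero => rw [smul_zero]; rw [e.map_zero, smul_zero]
        | add z w hz hw => rw [smul_add, e.map_add, e.map_add, hz, hw, smul_add]
        | tmul y a =>
          rw [C_smul_tmul]
          funext i
          refine (he _ _ _).trans ?_
          rw [Pi.smul_apply, he, C_mul, mul_assoc, smul_eq_mul]
      | add p q hp hq => rw [add_smul, e.map_add, hp, hq, add_smul]
      | monomial n x h =>
        rw [pow_succ', mul_left_comm, mul_smul, mul_smul X, ← h]
        generalize (C x * X ^ n : (KBar Fq)[X]) • z = z
        induction z using LBar.induction_on with
        | zero => rw [smul_zero]; rw [e.map_zero, smul_zero]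
        | add z w hz hw => rw [smul_add, e.map_add, e.map_add, hz, hw, smul_add]
        | tmul y a =>
          rw [X_smul_tmul]
          funext i
          refine (he _ _ _).trans ?_
          rw [Pi.smul_apply, he, map_smul, Pi.smul_apply, smul_eq_mul, smul_eq_mul,
            Polynomial.map_mul, Polynomial.map_X, mul_left_comm] }

section

variable [Module.Free Fq[X] L] [Module.Finite Fq[X] L]

instance : Module.Finite (KBar Fq)[X] (LBar Fq L) := by
  classical
  have := Module.Finite.finite_basis (Module.Free.chooseBasis Fq[X] L)
  exact Module.Finite.equiv (LBar.equivFun Fq L (Module.Free.chooseBasis Fq[X] L)).symm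

instance : Module.Free (KBar Fq)[X] (LBar Fq L) := by
  classical
  have := Module.Finite.finite_basis (Module.Free.chooseBasis Fq[X] L)
  exact Module.Free.of_equiv (LBar.equivFun Fq L (Module.Free.chooseBasis Fq[X] L)).symm

theorem finrank_LBar : Module.finrank (KBar Fq)[X] (LBar Fq L) = Module.finrank Fq[X] L := by
  classical
  have := Module.Finite.finite_basis (Module.Free.chooseBasis Fq[X] L)
  rw [(LBar.equivFun Fq L (Module.Free.chooseBasis Fq[X] L)).finrank_eq,
    Module.finrank_fintype_fun_eq_card, Module.finrank_eq_card_chooseBasisIndex]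

end

theorem subLBar_injective (K : Subalgebra Fq[X] L) : Function.Injective (subLBar Fq L K) :=
  Module.Flat.lTensor_preserves_injective_linearMap (M := KBar Fq)
    (K.val.restrictScalars Fq).toLinearMap Subtype.val_injective

theorem subLBar_tmul (K : Subalgebra Fq[X] L) (x : KBar Fq) (a : K) :
    subLBar Fq L K (LBar.tmul Fq x a) = LBar.tmul Fq x (a : L) := rfl

variable {Fq L} in
-- Closure under division says that L/K is torsion-free over K. For K itself this gives integral
-- closedness. As K is then Dedekind, L/K is projective and K is a K-linear retract of L; tensoring
-- with k̄ yields a K̄-linear retraction of L̄, so K̄ is closed under division in L̄ as well.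
theorem IsGCMAlgebra.subalgebra (hL : IsGCMAlgebra Fq L) (K : Subalgebra Fq[X] L)
    (hK : ∀ a ∈ K, a ≠ 0 → ∀ c : L, a * c ∈ K → c ∈ K) : IsGCMAlgebra Fq K := by
  have := hL.free
  have := hL.finite
  have := hL.dedekind
  have := hL.dedekind_bar
  have hfin : Module.Finite Fq[X] K := Module.Finite.of_injective K.val.toLinearMap
      Subtype.val_injective
  have htf : Module.IsTorsionFree Fq[X] K := inferInstance
  have hfree : Module.Free Fq[X] K := Module.free_of_finite_type_torsion_free'
  have hded : IsDedekindDomain K :=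
    IsDedekindDomain.of_isTorsionFree_quotient Fq[X] (K.val : K →+* L) Subtype.val_injective
      fun a b c hb h => ⟨⟨c, hK b b.2 (fun h0 => hb (Subtype.ext h0)) c (by
        rw [show (b : L) * c = a from h]; exact a.2)⟩, rfl⟩
  refine ⟨hfree, hfin, hded, ?_⟩
  let Q := L ⧸ LinearMap.range (Algebra.linearMap K L)
  have hQfin : Module.Finite K L := Module.Finite.of_restrictScalars_finite Fq[X] K L
  have hQtf : Module.IsTorsionFree K Q := by
    refine Module.IsTorsionFree.of_smul_eq_zero fun a y h => ?_
    obtain ⟨y, rfl⟩ := Submodule.mkQ_surjective _ y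
    by_contra! h0
    rw [← map_smul, ← LinearMap.mem_ker, Submodule.ker_mkQ] at h
    obtain ⟨b, hb⟩ := h
    have hb' : (a : L) * y ∈ K := by
      rw [show (a : L) * y = b from hb.symm]
      exact b.2
    refine h0.2 ?_
    rw [← LinearMap.mem_ker, Submodule.ker_mkQ]
    exact ⟨⟨y, hK a a.2 (fun h => h0.1 (Subtype.ext h)) y hb'⟩, rfl⟩
  have hQ : Module.Projective K Q := Module.projective_of_isDedekindDomain
  obtain ⟨s, hs⟩ := Module.projective_lifting_property
    (LinearMap.range (Algebra.linearMap K L)).mkQ LinearMap.id (Submodule.mkQ_surjective _)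
  obtain ⟨r, hr⟩ : ∃ r : L →ₗ[K] K, ∀ a : K, r a = a := by
    have hi : Function.Injective (Algebra.linearMap K L) := Subtype.val_injective
    let t : L →ₗ[K] L := LinearMap.id - s.comp (LinearMap.range (Algebra.linearMap K L)).mkQ
    have ht : ∀ y, t y ∈ LinearMap.range (Algebra.linearMap K L) := fun y => by
      rw [← Submodule.ker_mkQ (LinearMap.range (Algebra.linearMap K L)), LinearMap.mem_ker,
        LinearMap.sub_apply, map_sub, LinearMap.id_apply, LinearMap.comp_apply, sub_eq_zero]
      exact (LinearMap.congr_fun hs _).symm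
    refine ⟨(LinearEquiv.ofInjective _ hi).symm.toLinearMap.comp
      (t.codRestrict _ ht), fun a => ?_⟩
    rw [LinearMap.comp_apply, LinearEquiv.coe_coe, LinearEquiv.symm_apply_eq]
    refine Subtype.ext ?_
    have h0 : (LinearMap.range (Algebra.linearMap K L)).mkQ a = 0 := by
      rw [← LinearMap.mem_ker, Submodule.ker_mkQ]
      exact ⟨a, rfl⟩
    change (a : L) - s ((LinearMap.range (Algebra.linearMap K L)).mkQ a) = a
    rw [h0, map_zero, sub_zero]
  let r' : LBar Fq L →+ LBar Fq K := ((r.restrictScalars Fq).lTensor (KBar Fq)).toAddMonoidHom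
  have hr' : ∀ z w, r' (subLBar Fq L K z * w) = z * r' w := by
    intro z w
    induction z using LBar.induction_on with
    | zero => rw [map_zero, zero_mul, map_zero, zero_mul]
    | add x y hx hy => rw [map_add, add_mul, map_add, hx, hy, add_mul]
    | tmul x a =>
      induction w using LBar.induction_on with
      | zero => rw [mul_zero, map_zero, mul_zero]
      | add u v hu hv => rw [mul_add, map_add, hu, hv, map_add, mul_add]
      | tmul y b =>
        rw [subLBar_tmul, LBar.tmul_mul_tmul]
        change LBar.tmul Fq (x * y) (r ((a : L) * b)) = LBar.tmul Fq x a * LBar.tmul Fq y (r b)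
        rw [LBar.tmul_mul_tmul, ← smul_eq_mul a (r b), ← map_smul]
        rfl
  have hone : r' 1 = 1 := by
    change LBar.tmul Fq 1 (r 1) = LBar.tmul Fq 1 1
    rw [show r 1 = 1 from hr 1]
  -- If bc = a with a, b ∈ K̄, the retraction gives b r'(c) = a, so c = r'(c) lies in K̄.
  refine IsDedekindDomain.of_isTorsionFree_quotient (KBar Fq)[X] (subLBar Fq L K)
    (subLBar_injective Fq L K) fun a b c hb h => ⟨r' c, ?_⟩
  have h1 := hr' b c
  rw [h, ← mul_one (subLBar Fq L K a), hr', hone, mul_one] at h1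
  have h2 : subLBar Fq L K b ≠ 0 := fun h0 => hb (subLBar_injective Fq L K (by rw [h0, map_zero]))
  refine mul_left_cancel₀ h2 ?_
  rw [← map_mul, ← h1, h]

end DualTMotive

/-! ### The full primitive idempotent of the endomorphism ring -/

/-- A nonzero element of L divides a nonzero element of F. -/
theorem Module.isTorsionFree_of_isIntegral (F : Type*) {L B : Type*} [CommRing F] [IsDomain F]
    [CommRing L] [IsDomain L] [Algebra F L] [Algebra.IsIntegral F L] [AddCommGroup B] [Module F B]
    [Module L B] [IsScalarTower F L B] [Module.IsTorsionFree F B] : Module.IsTorsionFree L B := by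
  refine Module.IsTorsionFree.of_smul_eq_zero fun x b h => ?_
  by_contra! h0
  obtain ⟨p, hp, y, hy⟩ := (Algebra.IsIntegral.isIntegral (R := F) x).isAlgebraic.exists_nonzero_dvd
    (mem_nonZeroDivisors_of_ne_zero h0.1)
  have : p • b = 0 := by rw [← algebraMap_smul L, hy, mul_comm, mul_smul, h, smul_zero]
  exact h0.2 ((smul_eq_zero.mp this).resolve_left hp)

/-- Let `E` be a ring acting faithfully on a module `B` with saturated image, and suppose that `E`
contains a maximal commutative domain `L`. Then `E` contains a full primitive idempotent. -/
theorem exists_full_primitive_idempotent {F L E B : Type*} [CommRing F] [IsDomain F] [CommRing L]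
    [IsDomain L] [Algebra F L] [Module.Finite F L] [Module.IsTorsionFree F L] [AddCommGroup B]
    [Module F B] [Module L B] [IsScalarTower F L B] [Module.Finite F B] [Module.IsTorsionFree F B]
    (hrank : Module.finrank F B = Module.finrank F L) [Ring E] (ρ : E →+* Module.End F B)
    (hρ : Function.Injective ρ) (j : L →+* E) (hj : ∀ (x : L) (b : B), ρ (j x) b = x • b)
    (hsat : ∀ (c : F) (φ : Module.End F B) (f : E), c ≠ 0 → ρ f = c • φ → ∃ g, ρ g = φ)
    (K : Subalgebra F L) (hK : ∀ x, x ∈ K ↔ ∀ f, j x * f = f * j x) [IsDedekindDomain K]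
    [Module.Finite F K] :
    ∃ e : E, e * e = e ∧ (∃ (n : ℕ) (a b : Fin n → E), ∑ i, a i * e * b i = 1) ∧
      (∀ f, e * f * e = f → ∃ x : K, f = j x * e) ∧
      Module.finrank F (LinearMap.range (ρ e)) = Module.finrank F K := by
  have : Module.IsTorsionFree L B := Module.isTorsionFree_of_isIntegral F
  have hnt : Nontrivial B := by
    have : 0 < Module.finrank F L := Module.finrank_pos
    exact Module.nontrivial_of_finrank_pos (R := F) (hrank ▸ this)
  have : Module.Finite K B := Module.Finite.of_restrictScalars_finite F K _
  have : Module.IsTorsionFree K B := Module.isTorsionFree_of_isIntegral F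
  let S : Subalgebra F (Module.End F B) :=
    { ρ.range with
      algebraMap_mem' := fun c => ⟨j (algebraMap F L c), LinearMap.ext fun b => by
        rw [hj, algebraMap_smul]; rfl⟩ }
  -- Double commutant: an element of L commuting with the image of E lies in K, so every K-linear
  -- endomorphism of B comes from E. With the next step, E = End_K(B).
  have hS : ∀ f : Module.End K B, f.restrictScalars F ∈ S := fun f => by
    refine Module.End.mem_of_forall_commute hrank S (fun x => ⟨j x, LinearMap.ext (hj x)⟩) ?_ _ ?_
    · rintro c φ hc ⟨g, hg⟩
      exact hsat c φ g hc hg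
    · intro x hx b
      have hxK : x ∈ K := (hK x).mpr fun g => hρ <| by
        rw [map_mul, map_mul]
        refine LinearMap.ext fun b => ?_
        rw [Module.End.mul_apply, Module.End.mul_apply, hj, hj]
        exact (hx _ ⟨g, rfl⟩ b).symm
      exact f.map_smul ⟨x, hxK⟩ b
  have hendK : ∀ f : E, ∃ φ : Module.End K B, ∀ b, φ b = ρ f b := fun f =>
    ⟨{ ρ f with
      map_smul' := fun x b => by
        have := LinearMap.congr_fun (congrArg ρ ((hK _).mp x.2 f)) b
        rw [map_mul, map_mul, Module.End.mul_apply, Module.End.mul_apply, hj, hj] at this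
        exact this.symm }, fun _ => rfl⟩
  obtain ⟨e, he, hr, ⟨n, a, b, hab⟩, hprim⟩ := exists_rank_one_idempotent (K := K) (B := B)
  choose lift hlift using hS
  have hlift' : ∀ f b, ρ (lift f) b = f b := fun f b => LinearMap.congr_fun (hlift f) b
  refine ⟨lift e, ?_, ⟨n, fun i => lift (a i), fun i => lift (b i), ?_⟩, fun f hf => ?_, ?_⟩
  · refine hρ (LinearMap.ext fun b => ?_)
    rw [map_mul, Module.End.mul_apply, hlift', hlift']
    exact LinearMap.congr_fun he b
  · refine hρ (LinearMap.ext fun y => ?_)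
    rw [map_sum, map_one, LinearMap.sum_apply]
    simp only [map_mul, Module.End.mul_apply, hlift']
    simpa using LinearMap.congr_fun hab y
  · obtain ⟨φ, hφ⟩ := hendK f
    obtain ⟨x, hx⟩ := hprim φ <| LinearMap.ext fun y => by
      have := LinearMap.congr_fun (congrArg ρ hf) y
      simp only [map_mul, Module.End.mul_apply, hlift', ← hφ] at this
      exact this
    refine ⟨x, hρ (LinearMap.ext fun y => ?_)⟩
    rw [← hφ, hx, map_mul, Module.End.mul_apply, hlift', hj]
    rfl
  · have := Module.projective_of_isDedekindDomain (A := K) (M := LinearMap.range e)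
    have : Module.Finite F (LinearMap.range e) :=
      Module.Finite.of_surjective (e.rangeRestrict.restrictScalars F) e.surjective_rangeRestrict
    rw [← Module.finrank_eq_of_rank_eq_one F hr, hlift]
    rfl

namespace DualTMotive

variable (Fq : Type*) [Field Fq] [Fintype Fq] (L : Type*) [CommRing L] [Algebra Fq[X] L]
  [Algebra Fq L] (H : Type*) [AddCommGroup H] [Module (LSigma Fq L) H]

theorem bareHom_inclT (p : (KBar Fq)[X]) :
    bareHom Fq L (inclT Fq p) = inclLBar Fq L (polyToLBar Fq L p) := SkewPoly.map_C _ _ _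

theorem bareHom_sigma : bareHom Fq L (SkewPoly.sigma (KBar Fq)[X]) = SkewPoly.sigma (LBar Fq L) :=
  SkewPoly.map_sigma _ _

instance : Module (LBar Fq L) (Res (inclT Fq) (Bare Fq L H)) :=
  inferInstanceAs (Module (LBar Fq L) (Res (inclLBar Fq L) H))

instance : IsScalarTower (KBar Fq)[X] (LBar Fq L) (Res (inclT Fq) (Bare Fq L H)) where
  smul_assoc p z h := by
    let h' : H := h
    change inclLBar Fq L (polyToLBar Fq L p * z) • h' =
      bareHom Fq L (inclT Fq p) • inclLBar Fq L z • h'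
    rw [map_mul, mul_smul, bareHom_inclT]

variable {Fq L H}

theorem HasGCM.isTorsionFree [IsDomain (LBar Fq L)] (hH : HasGCM Fq L H) :
    Module.IsTorsionFree (LBar Fq L) (Res (inclT Fq) (Bare Fq L H)) := by
  have : Module.Projective (LBar Fq L) (Res (inclT Fq) (Bare Fq L H)) := hH.projective
  infer_instance

theorem HasGCM.toEnd_injective (hL : IsGCMAlgebra Fq L) (hH : HasGCM Fq L H) {a : L} (ha : a ≠ 0) :
    Function.Injective (toEnd Fq L H a) := by
  have := hL.dedekind_bar
  have := hH.isTorsionFree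
  have h0 : toLBar Fq L a ≠ 0 := fun h => ha (toLBar_injective Fq L (by rw [h, map_zero]))
  intro x y hxy
  exact smul_right_injective (R := LBar Fq L) (Res (inclT Fq) (Bare Fq L H)) h0
    (a₁ := Res.of (inclT Fq) _ x) (a₂ := Res.of (inclT Fq) _ y) hxy

variable [IsScalarTower Fq Fq[X] L]

/-- With the rank formula for H^Betti, this shows that H^Betti has rank one over L. -/
theorem HasGCM.finrank (hL : IsGCMAlgebra Fq L) (hH : HasGCM Fq L H) :
    Module.finrank (KBar Fq)[X] (Res (inclT Fq) (Bare Fq L H)) = Module.finrank Fq[X] L := by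
  have := hL.free
  have := hL.finite
  have := hL.dedekind_bar
  have := hH.isDualTMotive.finite_t
  have := hH.isTorsionFree
  have : Module.Projective (LBar Fq L) (Res (inclT Fq) (Bare Fq L H)) := hH.projective
  have h1 : Module.rank (LBar Fq L) (Res (inclT Fq) (Bare Fq L H)) = 1 := hH.rank_eq_one
  rw [← finrank_LBar]
  exact Module.finrank_eq_of_rank_eq_one (KBar Fq)[X] h1

theorem toEnd_algebraMap (c : Fq[X]) :
    toEnd Fq L H (algebraMap Fq[X] L c) = scalarEnd Fq (Bare Fq L H) c :=
  LinearMap.ext fun h => by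
    obtain ⟨h, rfl⟩ := (Res.of (bareHom Fq L) H).surjective h
    rw [toEnd_apply, inclL_algebraMap, scalarEnd_apply, Res.smul_of]

theorem mem_endCentralizer {x : L} : x ∈ endCentralizer Fq L H ↔
    ∀ f : Module.End (KTSigma Fq) (Bare Fq L H), toEnd Fq L H x * f = f * toEnd Fq L H x :=
  ⟨fun h f => LinearMap.ext fun m => h f m, fun h f m => LinearMap.congr_fun (h f) m⟩

/-- If a and ac commute with f then a(cf - fc) = 0, and a ≠ 0 acts injectively on H; so the
centralizer is closed under division in L. -/
theorem HasGCM.isGCMAlgebra_endCentralizer (hL : IsGCMAlgebra Fq L) (hH : HasGCM Fq L H) :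
    IsGCMAlgebra Fq (endCentralizer Fq L H) := by
  refine hL.subalgebra _ fun a ha ha0 c hac => mem_endCentralizer.mpr fun f => ?_
  refine LinearMap.ext fun m => hH.toEnd_injective hL ha0 ?_
  have h1 := mem_endCentralizer.mp hac f
  rw [map_mul, mul_assoc, ← mul_assoc f, ← mem_endCentralizer.mp ha, mul_assoc] at h1
  exact LinearMap.congr_fun h1 m

/-- The endomorphism ring of `H` contains an idempotent which is primitive and full. -/
theorem HasGCM.exists_idempotent (hL : IsGCMAlgebra Fq L) (hH : HasGCM Fq L H)
    (hrat : IsRigidAnalyticallyTrivial Fq (Bare Fq L H)) :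
    ∃ e : Module.End (KTSigma Fq) (Bare Fq L H), e * e = e ∧
      (∃ (n : ℕ) (a b : Fin n → Module.End (KTSigma Fq) (Bare Fq L H)), ∑ i, a i * e * b i = 1) ∧
      (∀ f, e * f * e = f → ∃ x : endCentralizer Fq L H, f = toEnd Fq L H x * e) ∧
      Module.finrank Fq[X] (LinearMap.range (bettiEnd Fq (Bare Fq L H) e)) =
        Module.finrank Fq[X] (endCentralizer Fq L H) := by
  have hK := hH.isGCMAlgebra_endCentralizer hL
  have := hL.free
  have := hL.finite
  have := hL.dedekind
  have := hK.free
  have := hK.finite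
  have := hK.dedekind
  have := hH.isDualTMotive.free_t
  have := hH.isDualTMotive.finite_t
  let M := Bare Fq L H
  have hBtf := isTorsionFree_betti (M := M) Fq
  have hBfin := hrat.finite_betti
  let _ : Module L (betti Fq M) := Module.compHom _ ((bettiEnd Fq M).comp (toEnd Fq L H))
  have hsmul : ∀ (x : L) (b : betti Fq M), x • b = bettiEnd Fq M (toEnd Fq L H x) b := fun _ _ =>
      rfl
  have : IsScalarTower Fq[X] L (betti Fq M) := ⟨fun c x b => by
    rw [hsmul, hsmul, Algebra.smul_def, map_mul, map_mul, toEnd_algebraMap, bettiEnd_scalarEnd]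
    rfl⟩
  have hrank : Module.finrank Fq[X] (betti Fq M) = Module.finrank Fq[X] L := by
    rw [hrat.finrank_betti, hH.finrank hL]
  have hLtf : Module.IsTorsionFree Fq[X] L := inferInstance
  have hLdom : IsDomain L := inferInstance
  have key := @exists_full_primitive_idempotent Fq[X] L (Module.End (KTSigma Fq) M) (betti Fq M)
    _ _ _ hLdom _ hL.finite hLtf _ _ _ _ hBfin hBtf hrank _ (bettiEnd Fq M)
  have key' := key (bettiEnd_injective Fq hrat) (toEnd Fq L H) (fun _ _ => rfl)
    (fun c φ f hc => exists_bettiEnd_eq_of_smul Fq hrat hc φ f)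
  exact @key' (endCentralizer Fq L H) (fun x => mem_endCentralizer) hK.dedekind hK.finite

end DualTMotive

/-! ### The direct summand eH and its GCM type -/

namespace DualTMotive

variable {Fq : Type*} [Field Fq] [Fintype Fq]

/-- Freeness passes to submodules because k̄[t] and k̄[σ] are left principal ideal domains; the
condition on (t - T)^n is transported by the projection. -/
theorem IsDualTMotive.of_retract {M M' : Type*} [AddCommGroup M] [Module (KTSigma Fq) M]
    [AddCommGroup M'] [Module (KTSigma Fq) M'] (i : M' →ₗ[KTSigma Fq] M) (p : M →ₗ[KTSigma Fq] M')
    (hpi : p.comp i = LinearMap.id) (hM : IsDualTMotive Fq M) : IsDualTMotive Fq M' := by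
  have := hM.free_t
  have := hM.finite_t
  have := hM.free_sigma
  have := hM.finite_sigma
  have hi : Function.Injective i := Function.LeftInverse.injective (LinearMap.congr_fun hpi)
  obtain ⟨h1, h2⟩ := Module.free_and_finite_of_injective (Res.map (inclT Fq) i) hi
  obtain ⟨h3, h4⟩ := Module.free_and_finite_of_injective (Res.map (inclSigma Fq) i) hi
  refine ⟨h1, h2, h3, h4, hM.pow_mem.mono fun n hn h => ?_⟩
  obtain ⟨h', hh'⟩ := hn (i h)
  refine ⟨p h', ?_⟩
  rw [← map_smul, ← hh', map_smul]
  congr 1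
  exact (LinearMap.congr_fun hpi h).symm

variable {L : Type*} [CommRing L] [Algebra Fq L]

variable (Fq L) in
theorem LBar.exists_smul_eq (z : LBar Fq L) : ∃ w : LBar Fq L, Multiplicative.ofAdd (1 : ℕ) • w =
    z := by
  induction z using LBar.induction_on with
  | zero => exact ⟨0, smul_zero _⟩
  | add x y hx hy =>
    obtain ⟨x', rfl⟩ := hx
    obtain ⟨y', rfl⟩ := hy
    exact ⟨x' + y', smul_add _ _ _⟩
  | tmul x a =>
    refine ⟨LBar.tmul Fq (frobKBar Fq x) a, ?_⟩
    rw [LBar.smul_tmul, ofAdd_one_smul, AlgEquiv.symm_apply_apply]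

variable [Algebra Fq[X] L] {H : Type*} [AddCommGroup H] [Module (LSigma Fq L) H]

instance : Module (LSigma Fq L) (Bare Fq L H) := inferInstanceAs (Module (LSigma Fq L) H)

theorem sigma_smul_bare (m : Bare Fq L H) :
    SkewPoly.sigma (KBar Fq)[X] • m = SkewPoly.sigma (LBar Fq L) • m := by
  rw [← bareHom_sigma]; rfl

/-- The image of `σ` is an `L̄`-submodule. -/
theorem inclLBar_smul_sigma_smul (z : LBar Fq L) (m : Bare Fq L H) :
    ∃ m' : Bare Fq L H, inclLBar Fq L z • SkewPoly.sigma (LBar Fq L) • m =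
      SkewPoly.sigma (LBar Fq L) • m' := by
  obtain ⟨w, rfl⟩ := LBar.exists_smul_eq Fq L z
  refine ⟨inclLBar Fq L w • m, ?_⟩
  rw [smul_smul, smul_smul]
  exact congrArg (· • m) (SkewPoly.sigma_mul_C w).symm

/-- In a motive with complex multiplication, `σ H` is `I H` for the complex multiplication type
`I`. -/
theorem HasGCM.sigma_smul_mem (hL : IsGCMAlgebra Fq L) (hH : HasGCM Fq L H) (m : Bare Fq L H) :
    ∃ (n : ℕ) (c : Fin n → LBar Fq L) (x : Fin n → Bare Fq L H), (∀ i, c i ∈ gcmType Fq L H) ∧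
      SkewPoly.sigma (LBar Fq L) • m = ∑ i, inclLBar Fq L (c i) • x i := by
  have := hL.dedekind_bar
  have := hH.isTorsionFree
  have := hH.isDualTMotive.finite_t
  let N := Res (inclT Fq) (Bare Fq L H)
  have : Module.Projective (LBar Fq L) N := hH.projective
  have : Module.Finite (LBar Fq L) N := Module.Finite.of_restrictScalars_finite (KBar Fq)[X] _ _
  have hr : Module.rank (LBar Fq L) N = 1 := hH.rank_eq_one
  -- Expand σm in a dual basis. The coefficient φᵢ(σm) lies in the type: φᵢ(σm) y = φᵢ(y) σm, and σH
  -- is stable under L̄.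
  obtain ⟨n, x, φ, hx, -⟩ := Module.exists_dualBasis_sum_eq_one hr
  let s : N := Res.of (inclT Fq) _ (SkewPoly.sigma (LBar Fq L) • m)
  refine ⟨n, fun i => φ i s, fun i => (Res.of (inclT Fq) _).symm (x i), fun i y => ?_, (hx s).symm⟩
  let y' : N := y
  obtain ⟨m', hm'⟩ := inclLBar_smul_sigma_smul (φ i y') m
  exact ⟨m', (LinearMap.apply_smul_comm_of_rank_eq_one hr.le (φ i) s y').trans hm'⟩

/-- From aH ⊂ JH follows a ∈ J because H is invertible: a = ∑ φᵢ(a xᵢ), and each φᵢ maps JH into J.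
-/
theorem HasGCM.mem_of_forall_smul (hL : IsGCMAlgebra Fq L) (hH : HasGCM Fq L H) (J : Ideal (LBar
    Fq L))
    (a : LBar Fq L) (h : ∀ m : Bare Fq L H, ∃ (ι : Type) (_ : Fintype ι) (c : ι → LBar Fq L)
      (x : ι → Bare Fq L H), (∀ i, c i ∈ J) ∧
      inclLBar Fq L a • m = ∑ i, inclLBar Fq L (c i) • x i) : a ∈ J := by
  have := hL.dedekind_bar
  have := hH.isTorsionFree
  have := hH.isDualTMotive.finite_t
  let N := Res (inclT Fq) (Bare Fq L H)
  have : Module.Projective (LBar Fq L) N := hH.projective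
  have : Module.Finite (LBar Fq L) N := Module.Finite.of_restrictScalars_finite (KBar Fq)[X] _ _
  have hr : Module.rank (LBar Fq L) N = 1 := hH.rank_eq_one
  obtain ⟨n, x, φ, -, hφ⟩ := Module.exists_dualBasis_sum_eq_one hr
  rw [← mul_one a, ← hφ, Finset.mul_sum]
  refine J.sum_mem fun i _ => ?_
  obtain ⟨ι, _, c, y, hc, hy⟩ := h ((Res.of (inclT Fq) _).symm (x i))
  have hy' : a • x i = ∑ j, c j • Res.of (inclT Fq) (Bare Fq L H) (y j) := hy
  rw [← smul_eq_mul, ← map_smul, hy', map_sum]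
  refine J.sum_mem fun j _ => ?_
  rw [map_smul, smul_eq_mul]
  exact J.mul_mem_right _ (hc j)

variable [IsScalarTower Fq Fq[X] L]

section Sub

variable (K : Subalgebra Fq[X] L)

theorem subLSigma_inclLBar (z : LBar Fq K) :
    subLSigma Fq L K (inclLBar Fq K z) = inclLBar Fq L (subLBar Fq L K z) := SkewPoly.map_C _ _ _

theorem subLSigma_sigma : subLSigma Fq L K (SkewPoly.sigma _) = SkewPoly.sigma _ :=
  SkewPoly.map_sigma _ _

theorem subLBar_polyToLBar (p : (KBar Fq)[X]) :
    subLBar Fq L K (polyToLBar Fq K p) = polyToLBar Fq L p := by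
  rw [polyToLBar, polyToLBar, Polynomial.coe_eval₂RingHom, Polynomial.coe_eval₂RingHom,
    Polynomial.hom_eval₂]
  rfl

theorem subLSigma_bareHom (r : KTSigma Fq) : subLSigma Fq L K (bareHom Fq K r) = bareHom Fq L r
    := by
  induction r using SkewPoly.induction_on with
  | add x y hx hy => simp only [map_add, hx, hy]
  | monomial p n =>
    rw [map_mul, map_mul, map_mul, map_pow, map_pow, map_pow, bareHom_sigma, bareHom_sigma,
      subLSigma_sigma]
    congr 1
    exact ((congrArg _ (bareHom_inclT Fq K p)).trans (subLSigma_inclLBar K _)).trans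
      ((congrArg _ (subLBar_polyToLBar K p)).trans (bareHom_inclT Fq L p).symm)

variable {K} (hK : ∀ x ∈ K, ∀ f : Module.End (KTSigma Fq) (Bare Fq L H),
  toEnd Fq L H x * f = f * toEnd Fq L H x)

include hK in
theorem apply_subLBar_smul (f : Module.End (KTSigma Fq) (Bare Fq L H)) (z : LBar Fq K) (h : H) :
    f (Res.of (bareHom Fq L) H (inclLBar Fq L (subLBar Fq L K z) • h)) = Res.of (bareHom Fq L) H
      (inclLBar Fq L (subLBar Fq L K z) • (Res.of (bareHom Fq L) H).symm (f (Res.of (bareHom Fq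
          L) H h))) := by
  induction z using LBar.induction_on with
  | zero => simp only [map_zero, zero_smul]
  | add x y hx hy => simp only [map_add, add_smul, hx, hy]
  | tmul x a =>
    have h1 : inclLBar Fq L (subLBar Fq L K (LBar.tmul Fq x a)) =
        bareHom Fq L (inclT Fq (C x)) * inclL Fq L a := by
      rw [subLBar_tmul, bareHom_inclT, polyToLBar_C]
      change _ = inclLBar Fq L _ * inclLBar Fq L (LBar.tmul Fq 1 a)
      rw [← map_mul, LBar.tmul_mul_tmul, mul_one, one_mul]
    rw [h1, mul_smul, mul_smul, ← Res.smul_of, ← Res.smul_of, map_smul]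
    congr 1
    exact (LinearMap.congr_fun (hK a a.2 f) (Res.of (bareHom Fq L) H h)).symm

/-- An endomorphism of the bare module is `K̄[σ]`-linear if it commutes with `K`. -/
def kSigmaEnd (f : Module.End (KTSigma Fq) (Bare Fq L H)) :
    Module.End (LSigma Fq K) (Res (subLSigma Fq L K) H) where
  toFun h := f h
  map_add' := f.map_add
  map_smul' r h := by
    let h' : H := h
    change f (Res.of (bareHom Fq L) H (subLSigma Fq L K r • h')) = Res.of (bareHom Fq L) H
      (subLSigma Fq L K r • (Res.of (bareHom Fq L) H).symm (f (Res.of (bareHom Fq L) H h')))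
    induction r using SkewPoly.induction_on with
    | add x y hx hy => simp only [map_add, add_smul, hx, hy]
    | monomial z n =>
      have h1 : subLSigma Fq L K (SkewPoly.C z * SkewPoly.sigma _ ^ n) =
          inclLBar Fq L (subLBar Fq L K z) * bareHom Fq L (SkewPoly.sigma _ ^ n) := by
        rw [map_mul, map_pow, map_pow, subLSigma_sigma, bareHom_sigma]
        congr 1
        exact subLSigma_inclLBar K z
      rw [h1, mul_smul, apply_subLBar_smul hK, ← Res.smul_of, f.map_smul, mul_smul]
      rfl

/-- The image of an idempotent, as a `K̄[σ]`-submodule. -/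
def fixedSubmodule (e : Module.End (KTSigma Fq) (Bare Fq L H)) :
    Submodule (LSigma Fq K) (Res (subLSigma Fq L K) H) :=
  LinearMap.eqLocus (kSigmaEnd hK e) LinearMap.id

variable {e : Module.End (KTSigma Fq) (Bare Fq L H)} (he : e * e = e)

/-- The inclusion of the image of an idempotent. -/
def fixedIncl : Bare Fq K (fixedSubmodule hK e) →ₗ[KTSigma Fq] Bare Fq L H where
  toFun h := Res.of (bareHom Fq L) H ((Res.of (bareHom Fq K) (fixedSubmodule hK e)).symm h).1
  map_add' _ _ := rfl
  map_smul' r h := by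
    let h' : fixedSubmodule hK e := h
    let h'' : H := h'.1
    change subLSigma Fq L K (bareHom Fq K r) • h'' = bareHom Fq L r • h''
    rw [subLSigma_bareHom]

/-- The projection to the image of an idempotent. -/
def fixedProj : Bare Fq L H →ₗ[KTSigma Fq] Bare Fq K (fixedSubmodule hK e) where
  toFun h := Res.of (bareHom Fq K) (fixedSubmodule hK e) ⟨e h, LinearMap.congr_fun he h⟩
  map_add' x y := Subtype.ext (e.map_add x y)
  map_smul' r h := by
    refine Subtype.ext ((e.map_smul r h).trans ?_)
    let h' : H := e h
    change bareHom Fq L r • h' = subLSigma Fq L K (bareHom Fq K r) • h'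
    rw [subLSigma_bareHom]

theorem fixedProj_comp_fixedIncl :
    (fixedProj hK he).comp (fixedIncl hK) = LinearMap.id :=
  LinearMap.ext fun h => Subtype.ext h.2

theorem fixedIncl_comp_fixedProj :
    (fixedIncl hK).comp (fixedProj hK he) = e := rfl

theorem fixedIncl_injective : Function.Injective (fixedIncl hK (e := e)) :=
  fun _ _ h => Subtype.ext h

theorem fixedIncl_smul (z : LBar Fq K) (h : fixedSubmodule hK e) :
    fixedIncl hK (Res.of (bareHom Fq K) _ (inclLBar Fq K z • h)) = Res.of (bareHom Fq L) H
      (inclLBar Fq L (subLBar Fq L K z) •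
        (Res.of (bareHom Fq L) H).symm (fixedIncl hK (Res.of (bareHom Fq K) _ h))) := by
  let h' : H := h.1
  change subLSigma Fq L K (inclLBar Fq K z) • h' = inclLBar Fq L (subLBar Fq L K z) • h'
  rw [subLSigma_inclLBar]

theorem fixedIncl_toEnd (x : K) (h : Bare Fq K (fixedSubmodule hK e)) :
    fixedIncl hK (toEnd Fq K _ x h) = toEnd Fq L H x (fixedIncl hK h) :=
  fixedIncl_smul hK (toLBar Fq K x) h

include he in
-- The k̄[t]-rank of eH is the 𝔽_q[t]-rank of e on H^Betti, which is that of K, and this is the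
-- k̄[t]-rank of K̄. As eH is torsion-free over the Dedekind domain K̄, it is projective of rank
-- one.
theorem hasGCM_fixedSubmodule (hL : IsGCMAlgebra Fq L) (hKL : IsGCMAlgebra Fq K) (hH : HasGCM Fq
    L H)
    (hrat : IsRigidAnalyticallyTrivial Fq (Bare Fq L H))
    (hrank : Module.finrank Fq[X] (LinearMap.range (bettiEnd Fq (Bare Fq L H) e)) =
      Module.finrank Fq[X] K) : HasGCM Fq K (fixedSubmodule hK e) := by
  have := hL.dedekind_bar
  have := hKL.dedekind_bar
  have := hKL.free
  have := hKL.finite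
  have hpi := fixedProj_comp_fixedIncl hK he
  have hmot := hH.isDualTMotive.of_retract _ _ hpi
  have hrat' := hrat.of_retract _ _ _ hpi
  have := hmot.free_t
  have := hmot.finite_t
  let N := Res (inclT Fq) (Bare Fq K (fixedSubmodule hK e))
  have hfin : Module.Finite (LBar Fq K) N := Module.Finite.of_restrictScalars_finite (KBar Fq)[X]
      _ _
  have htf : Module.IsTorsionFree (LBar Fq K) N := by
    have := hH.isTorsionFree
    refine Module.IsTorsionFree.of_smul_eq_zero fun z x h => ?_
    have h1 : subLBar Fq L K z • Res.of (inclT Fq) _ (fixedIncl hK x) = 0 :=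
      (fixedIncl_smul hK z x).symm.trans ((congrArg (fixedIncl hK) h).trans (map_zero _))
    refine (smul_eq_zero.mp h1).imp (fun h => subLBar_injective Fq L K (by rw [h, map_zero])) fun
        h =>
      fixedIncl_injective hK (h.trans (map_zero _).symm)
  have hfr : Module.finrank (KBar Fq)[X] N = Module.finrank (KBar Fq)[X] (LBar Fq K) := by
    rw [finrank_LBar, ← hrat'.finrank_betti, ← hrank,
      ← finrank_range_bettiEnd_of_retract Fq _ _ hpi, fixedIncl_comp_fixedProj]
  exact ⟨Module.projective_of_isDedekindDomain (A := LBar Fq K) (M := N),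
    (Module.rank_eq_one_of_finrank_eq (KBar Fq)[X] hfr).1, hmot⟩

include hK in
theorem apply_inclLBar_subLBar_smul (f : Module.End (KTSigma Fq) (Bare Fq L H)) (z : LBar Fq K)
    (m : Bare Fq L H) : f (inclLBar Fq L (subLBar Fq L K z) • m) =
      inclLBar Fq L (subLBar Fq L K z) • f m :=
  apply_subLBar_smul hK f z _

theorem fixedIncl_inclLBar_smul (z : LBar Fq K) (m : Bare Fq K (fixedSubmodule hK e)) :
    fixedIncl hK (inclLBar Fq K z • m) = inclLBar Fq L (subLBar Fq L K z) • fixedIncl hK m :=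
  fixedIncl_smul hK z _

include he in
-- Fullness writes H as ∑ aₖ(H₀), where aₖ commutes with σ and with K̄. If I₀ is the type of H₀,
-- then σH₀ = I₀H₀ gives σH ⊂ I₀H, and invertibility of H over L̄ puts every element of its type
-- into I₀L̄. Conversely I₀H₀ ⊂ σH₀ gives I₀H ⊂ σH.
theorem gcmType_eq_map (hL : IsGCMAlgebra Fq L) (hKL : IsGCMAlgebra Fq K) (hH : HasGCM Fq L H)
    (hH₀ : HasGCM Fq K (fixedSubmodule hK e)) {n : ℕ}
    (a b : Fin n → Module.End (KTSigma Fq) (Bare Fq L H)) (hab : ∑ i, a i * e * b i = 1) :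
    gcmType Fq L H = (gcmType Fq K (fixedSubmodule hK e)).map (subLBar Fq L K) := by
  have := hL.dedekind_bar
  have := hKL.dedekind_bar
  have hdec : ∀ h : Bare Fq L H, ∃ y : Fin n → Bare Fq K (fixedSubmodule hK e),
      h = ∑ k, a k (fixedIncl hK (y k)) := fun h => by
    refine ⟨fun k => fixedProj hK he (b k h), ?_⟩
    conv_lhs => rw [← Module.End.one_apply (R := KTSigma Fq) h, ← hab, LinearMap.sum_apply]
    rfl
  apply le_antisymm
  · intro c hc
    refine hH.mem_of_forall_smul hL _ c fun m => ?_
    have hc' : ∃ m' : Bare Fq L H, inclLBar Fq L c • m = SkewPoly.sigma (LBar Fq L) • m' := hc m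
    obtain ⟨m', h1⟩ := hc'
    obtain ⟨y, hy⟩ := hdec m'
    choose k d x hd hx using fun i => hH₀.sigma_smul_mem hKL (y i)
    refine ⟨Σ i, Fin (k i), inferInstance, fun p => subLBar Fq L K (d p.1 p.2),
      fun p => a p.1 (fixedIncl hK (x p.1 p.2)), fun p => Ideal.mem_map_of_mem _ (hd _ _), ?_⟩
    rw [h1, hy, ← sigma_smul_bare, Finset.smul_sum, Fintype.sum_sigma]
    refine Finset.sum_congr rfl fun i _ => ?_
    rw [← map_smul, ← map_smul, sigma_smul_bare, hx, map_sum, map_sum]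
    refine Finset.sum_congr rfl fun j _ => ?_
    rw [fixedIncl_inclLBar_smul, apply_inclLBar_subLBar_smul hK]
  · rw [Ideal.map_le_iff_le_comap]
    intro z hz h
    obtain ⟨y, hy⟩ := hdec h
    choose w hw using fun k => hz (y k)
    refine ⟨∑ k, a k (fixedIncl hK (w k)), ?_⟩
    have hw' : ∀ k, inclLBar Fq K z • y k = SkewPoly.sigma (KBar Fq)[X] •
        Res.of (bareHom Fq K) (fixedSubmodule hK e) (w k) := fun k => by
      rw [sigma_smul_bare]; exact hw k
    have h1 : inclLBar Fq L (subLBar Fq L K z) • (∑ k, a k (fixedIncl hK (y k))) =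
        SkewPoly.sigma (KBar Fq)[X] • ∑ k, a k (fixedIncl hK (Res.of (bareHom Fq K) _ (w k))) := by
      rw [Finset.smul_sum, Finset.smul_sum]
      refine Finset.sum_congr rfl fun k _ => ?_
      rw [← apply_inclLBar_subLBar_smul hK, ← fixedIncl_inclLBar_smul, hw', map_smul, map_smul]
    rw [← hy, sigma_smul_bare] at h1
    exact h1

end Sub

end DualTMotive

/-! ### Polynomials invariant under the twist up to powers of t - T -/

namespace DualTMotive

variable (Fq : Type*) [Field Fq] [Fintype Fq]

theorem T_pow_injective : Function.Injective fun n : ℕ => T Fq ^ n := fun m n h => by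
  have h1 : (RatFunc.X : RatFunc Fq) ^ m = RatFunc.X ^ n :=
    (algebraMap (RatFunc Fq) (KBar Fq)).injective (by rw [map_pow, map_pow]; exact h)
  rw [← RatFunc.algebraMap_X, ← map_pow, ← map_pow] at h1
  simpa using congrArg natDegree (RatFunc.algebraMap_injective Fq h1)

theorem iterate_frobKBar (x : KBar Fq) (n : ℕ) :
    (frobKBar Fq)^[n] x = x ^ Fintype.card Fq ^ n := by
  induction n with
  | zero => simp
  | succ n ih => rw [Function.iterate_succ_apply', ih, frobKBar_apply, ← pow_mul, pow_succ]

/-- T is transcendental over 𝔽_q, so its Frobenius orbit is infinite in both directions; a nonzero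
polynomial cannot vanish on either half. -/
theorem iterate_frobKBar_T_injective : Function.Injective fun n : ℕ => (frobKBar Fq)^[n] (T Fq) :=
  fun m n h => by
    simp only [iterate_frobKBar] at h
    exact Nat.pow_right_injective Fintype.one_lt_card (T_pow_injective Fq h)

theorem iterate_frobKBar_symm_T_injective :
    Function.Injective fun n : ℕ => (frobKBar Fq).symm^[n] (T Fq) := fun m n h => by
  have key : ∀ (m n : ℕ), (frobKBar Fq)^[m + n] ((frobKBar Fq).symm^[m] (T Fq)) =
      (frobKBar Fq)^[n] (T Fq) := fun m n => by
    rw [add_comm, Function.iterate_add_apply,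
      (Function.LeftInverse.iterate (frobKBar Fq).apply_symm_apply m) (T Fq)]
  have h1 := key m n
  rw [show (frobKBar Fq).symm^[m] (T Fq) = (frobKBar Fq).symm^[n] (T Fq) from h, add_comm,
    key n m] at h1
  exact iterate_frobKBar_T_injective Fq h1

/-- X^q - X already splits over 𝔽_q, so all its roots in k̄ lie there. -/
theorem exists_algebraMap_eq_of_frobKBar_eq {x : KBar Fq} (hx : frobKBar Fq x = x) :
    ∃ c : Fq, algebraMap Fq (KBar Fq) c = x := by
  have h0 : (X ^ Fintype.card Fq - X : Fq[X]) ≠ 0 :=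
    FiniteField.X_pow_card_sub_X_ne_zero Fq Fintype.one_lt_card
  have h1 : (X ^ Fintype.card Fq - X : Fq[X]).Splits := by
    rw [splits_iff_card_roots, FiniteField.roots_X_pow_card_sub_X,
      FiniteField.X_pow_card_sub_X_natDegree_eq Fq Fintype.one_lt_card]
    rfl
  refine h1.mem_range_of_isRoot h0 ?_
  rw [IsRoot, Polynomial.map_sub, Polynomial.map_pow, map_X, eval_sub, eval_pow, eval_X,
    ← frobKBar_apply, hx, sub_self]

theorem eval_ofAdd_one_smul (a : (KBar Fq)[X]) (x : KBar Fq) :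
    eval ((frobKBar Fq).symm x) (Multiplicative.ofAdd (1 : ℕ) • a) =
      (frobKBar Fq).symm (eval x a) := by
  have h1 : Multiplicative.ofAdd (1 : ℕ) • a = a.map ((frobKBar Fq).symm : KBar Fq →+* KBar Fq)
      := by
    ext i
    rw [Polynomial.coeff_smul, Polynomial.coeff_map, ofAdd_one_smul]
    rfl
  rw [h1, ← eval₂_eq_eval_map]
  exact (hom_eval₂ a (RingHom.id _) ((frobKBar Fq).symm : KBar Fq →+* KBar Fq) x).symm

theorem smul_polynomial_injective :
    Function.Injective fun a : (KBar Fq)[X] => Multiplicative.ofAdd (1 : ℕ) • a := fun a b h => by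
  ext i
  have := congrArg (fun p => coeff p i) h
  simp only [Polynomial.coeff_smul, ofAdd_one_smul] at this
  exact (frobKBar Fq).symm.injective this

theorem smul_polynomial_surjective :
    Function.Surjective fun a : (KBar Fq)[X] => Multiplicative.ofAdd (1 : ℕ) • a := fun a => by
  refine ⟨a.map (frobKBar Fq : KBar Fq →+* KBar Fq), ?_⟩
  ext i
  simp only [Polynomial.coeff_smul, Polynomial.coeff_map, ofAdd_one_smul]
  exact (frobKBar Fq).symm_apply_apply _

/-- A monic polynomial which differs from its twist only by powers of `t - T` has coefficients in
`𝔽_q`. -/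
theorem exists_map_eq_of_dvd_mul_pow {a : (KBar Fq)[X]} (ha : a.Monic) (n : ℕ)
    (h1 : a ∣ (Multiplicative.ofAdd (1 : ℕ) • a) * (X - C (T Fq)) ^ n)
    (h2 : (Multiplicative.ofAdd (1 : ℕ) • a) ∣ a * (X - C (T Fq)) ^ n) :
    ∃ c : Fq[X], a = c.map (algebraMap Fq (KBar Fq)) := by
  set b := Multiplicative.ofAdd (1 : ℕ) • a with hb
  have hev : ∀ x, eval ((frobKBar Fq).symm x) b = (frobKBar Fq).symm (eval x a) :=
    eval_ofAdd_one_smul Fq a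
  have hroot : ∀ x, eval ((frobKBar Fq).symm x) b = 0 ↔ eval x a = 0 := fun x => by
    rw [hev, map_eq_zero_iff _ (frobKBar Fq).symm.injective]
  have hinf : ∀ f : ℕ → KBar Fq, Function.Injective f → ¬ ∀ n, eval (f n) a = 0 := fun f hf h =>
    ha.ne_zero (eq_zero_of_infinite_isRoot a (Set.infinite_of_injective_forall_mem hf h))
  have haT : eval (T Fq) a ≠ 0 := fun h => by
    -- A root T of a would propagate: if y is a root of a, then its q-th root y' is a root of the
    -- twist b, hence by `h2` of a, unless y' = T, which cannot recur along the orbit.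
    refine hinf _ (iterate_frobKBar_symm_T_injective Fq) fun k => ?_
    induction k with
    | zero => exact h
    | succ k ih =>
      have h3 : eval ((frobKBar Fq).symm^[k + 1] (T Fq)) b = 0 := by
        rw [Function.iterate_succ_apply', hroot]; exact ih
      have h4 := eval_dvd (x := (frobKBar Fq).symm^[k + 1] (T Fq)) h2
      rw [h3, zero_dvd_iff, eval_mul, eval_pow, eval_sub, eval_X, eval_C, mul_eq_zero] at h4
      refine h4.resolve_right fun h5 => ?_
      have h6 := sub_eq_zero.mp (IsReduced.eq_zero _ ⟨n, h5⟩)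
      exact k.succ_ne_zero (iterate_frobKBar_symm_T_injective Fq h6)
  have hbT : eval (T Fq) b ≠ 0 := fun h => by
    -- The same argument with `h1`, moving along the orbit in the other direction.
    refine hinf (fun k => (frobKBar Fq)^[k + 1] (T Fq))
      (fun m n h => by simpa using iterate_frobKBar_T_injective Fq h) fun k => ?_
    induction k with
    | zero =>
      refine (hroot _).mp ?_
      simpa using h
    | succ k ih =>
      have h4 := eval_dvd (x := (frobKBar Fq)^[k + 1] (T Fq)) h1
      rw [ih, zero_dvd_iff, eval_mul, eval_pow, eval_sub, eval_X, eval_C, mul_eq_zero] at h4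
      rw [← hroot, Function.iterate_succ_apply', AlgEquiv.symm_apply_apply]
      refine h4.resolve_right fun h5 => ?_
      have h6 := sub_eq_zero.mp (IsReduced.eq_zero _ ⟨n, h5⟩)
      exact k.succ_ne_zero (iterate_frobKBar_T_injective Fq h6)
  have hcop : ∀ p : (KBar Fq)[X], eval (T Fq) p ≠ 0 → IsCoprime p ((X - C (T Fq)) ^ n) :=
    fun p hp => IsCoprime.pow_right <| ((irreducible_X_sub_C _).coprime_iff_not_dvd.mpr
      fun h => hp (dvd_iff_isRoot.mp h)).symm
  -- Both polynomials are prime to t - T, so they divide each other; being monic, they agree, and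
  -- the coefficients are fixed by Frobenius.
  have hab : a ∣ b := (hcop a haT).dvd_of_dvd_mul_right h1
  have hba : b ∣ a := (hcop b hbT).dvd_of_dvd_mul_right h2
  have hbm : b.Monic := by
    have h3 : b = a.map ((frobKBar Fq).symm : KBar Fq →+* KBar Fq) := by
      ext i
      rw [hb, Polynomial.coeff_smul, Polynomial.coeff_map, ofAdd_one_smul]
      rfl
    rw [h3]
    exact ha.map _
  have heq : b = a := eq_of_monic_of_associated hbm ha (associated_of_dvd_dvd hba hab)
  have hcoeff : ∀ i, ∃ c : Fq, algebraMap Fq (KBar Fq) c = a.coeff i := fun i => by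
    refine exists_algebraMap_eq_of_frobKBar_eq Fq ?_
    have h3 := congrArg (fun p => coeff p i) heq
    simp only [hb, Polynomial.coeff_smul, ofAdd_one_smul] at h3
    exact ((AlgEquiv.symm_apply_eq _).mp h3).symm
  obtain ⟨c, hc⟩ := (mem_lifts a).mp ((lifts_iff_coeff_lifts a).mpr hcoeff)
  exact ⟨c, hc.symm⟩

end DualTMotive

/-- The image of a semilinear injective endomorphism over an automorphism of a domain has torsion
cokernel. -/
theorem Module.exists_smul_eq_of_semilinear {A V : Type*} [CommRing A] [IsDomain A]
    [AddCommGroup V] [Module A V] [Module.Finite A V] [Module.IsTorsionFree A V] (φ : A ≃+* A)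
    (s : V →+ V) (hs : Function.Injective s) (h : ∀ a v, s (a • v) = φ a • s v) :
    ∃ a : A, a ≠ 0 ∧ ∀ v, ∃ w, a • v = s w := by
  let W : Submodule A V :=
    { s.range with
      smul_mem' := by
        rintro a _ ⟨v, rfl⟩
        exact ⟨φ.symm a • v, by rw [h, φ.apply_symm_apply]⟩ }
  let j : V ≃+ W := AddEquiv.ofBijective (s.rangeRestrict)
    ⟨fun x y hxy => hs (congrArg Subtype.val hxy), s.rangeRestrict_surjective⟩
  have hr : Module.rank A V = Module.rank A W :=
    rank_eq_of_equiv_equiv φ j φ.bijective fun a v => Subtype.ext (h a v)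
  obtain ⟨a, ha, haW⟩ := Submodule.exists_smul_mem_of_finrank_le W (congrArg _ hr).le
  refine ⟨a, ha, fun v => ?_⟩
  obtain ⟨w, hw⟩ := haW v
  exact ⟨w, hw.symm⟩

/-! ### Torsion-closed submodules and projections up to isogeny -/

namespace DualTMotive

variable {Fq : Type*} [Field Fq] [Fintype Fq] {M : Type*} [AddCommGroup M] [Module (KTSigma Fq) M]

variable (Fq) in
/-- The twist of `k̄[t]` as an automorphism. -/
def twistEquiv : (KBar Fq)[X] ≃+* (KBar Fq)[X] :=
  RingEquiv.ofBijective (MulSemiringAction.toRingHom _ (KBar Fq)[X] (Multiplicative.ofAdd (1 : ℕ)))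
    ⟨smul_polynomial_injective Fq, smul_polynomial_surjective Fq⟩

theorem twistEquiv_apply (a : (KBar Fq)[X]) :
    twistEquiv Fq a = Multiplicative.ofAdd (1 : ℕ) • a := rfl

theorem inclSigma_sigma : inclSigma Fq (SkewPoly.sigma (KBar Fq)) = SkewPoly.sigma (KBar Fq)[X] :=
  SkewPoly.map_sigma _ _

theorem IsDualTMotive.sigma_smul_injective (hM : IsDualTMotive Fq M) :
    Function.Injective fun m : M => SkewPoly.sigma (KBar Fq)[X] • m := fun x y hxy => by
  have := hM.free_sigma
  have hs : SkewPoly.sigma (KBar Fq) ≠ 0 := SkewPolynomial.X_ne_zero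
  let b := Module.Free.chooseBasis (KSigma Fq) (Res (inclSigma Fq) M)
  have h : SkewPoly.sigma (KBar Fq) • Res.of (inclSigma Fq) M x =
      SkewPoly.sigma (KBar Fq) • Res.of (inclSigma Fq) M y := by
    rw [Res.smul_of, Res.smul_of, inclSigma_sigma]
    exact congrArg _ hxy
  refine b.repr.injective (a₁ := Res.of (inclSigma Fq) M x) (a₂ := Res.of (inclSigma Fq) M y)
    (Finsupp.ext fun i => ?_)
  have h1 := DFunLike.congr_fun (congrArg b.repr h) i
  rw [map_smul, map_smul, Finsupp.smul_apply, Finsupp.smul_apply, smul_eq_mul, smul_eq_mul] at h1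
  exact mul_left_cancel₀ hs h1

theorem IsDualTMotive.isTorsionFree (hM : IsDualTMotive Fq M) :
    Module.IsTorsionFree (KBar Fq)[X] (Res (inclT Fq) M) := by
  have := hM.free_t
  infer_instance

variable (Fq) in
/-- A submodule with torsion-free quotient over `k̄[t]`. -/
def IsTorsionClosed (N : Submodule (KTSigma Fq) M) : Prop :=
  ∀ (a : (KBar Fq)[X]) (m : M), a ≠ 0 → inclT Fq a • m ∈ N → m ∈ N

/-- Since σ is injective and semilinear over an automorphism of k̄[t], σN has full rank in N. So a
nonzero multiple of σm is σw with w ∈ N; untwisting the scalar gives bm = w with b ≠ 0, and N is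
torsion-closed. -/
theorem IsTorsionClosed.mem_of_sigma_smul_mem {N : Submodule (KTSigma Fq) M}
    (hN : IsTorsionClosed Fq N) (hM : IsDualTMotive Fq M) {m : M}
    (hm : SkewPoly.sigma (KBar Fq)[X] • m ∈ N) : m ∈ N := by
  have := hM.finite_t
  have := hM.isTorsionFree
  let s : Res.submodule (inclT Fq) N →+ Res.submodule (inclT Fq) N :=
    { toFun := fun n => ⟨Res.of (inclT Fq) M (SkewPoly.sigma (KBar Fq)[X] •
        (Res.of (inclT Fq) M).symm n.1), N.smul_mem _ n.2⟩
      map_zero' := Subtype.ext (smul_zero (A := M) _)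
      map_add' := fun x y => Subtype.ext (smul_add (A := M) _ _ _) }
  obtain ⟨a, ha, h⟩ := Module.exists_smul_eq_of_semilinear (twistEquiv Fq) s
    (fun x y hxy => Subtype.ext (hM.sigma_smul_injective (congrArg Subtype.val hxy)))
    (fun a v => Subtype.ext (sigma_smul_inclT (H := M) Fq a v.1))
  obtain ⟨b, rfl⟩ := (twistEquiv Fq).surjective a
  obtain ⟨w, hw⟩ := h ⟨Res.of (inclT Fq) M (SkewPoly.sigma (KBar Fq)[X] • m), hm⟩
  have hw' : inclT Fq (twistEquiv Fq b) • SkewPoly.sigma (KBar Fq)[X] • m =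
    SkewPoly.sigma (KBar Fq)[X] • (Res.of (inclT Fq) M).symm w.1 := congrArg Subtype.val hw
  rw [twistEquiv_apply, ← sigma_smul_inclT] at hw'
  refine hN b m (fun h => ha (by rw [h, map_zero])) ?_
  rw [hM.sigma_smul_injective hw']
  exact w.2

theorem IsTorsionClosed.exists_eq_sigma_smul {N : Submodule (KTSigma Fq) M}
    (hN : IsTorsionClosed Fq N) (hM : IsDualTMotive Fq M) {n : ℕ}
    (hn : ∀ m : M, ∃ m' : M,
      inclT Fq ((X - C (T Fq)) ^ n) • m = SkewPoly.sigma (KBar Fq)[X] • m') (m : M) (hm : m ∈ N) :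
    ∃ m' ∈ N, inclT Fq ((X - C (T Fq)) ^ n) • m = SkewPoly.sigma (KBar Fq)[X] • m' := by
  obtain ⟨m', h⟩ := hn m
  exact ⟨m', hN.mem_of_sigma_smul_mem hM (h ▸ N.smul_mem _ hm), h⟩

/-- If `P` is an isogenous submodule of `M`, then it contains `c M` for a nonzero `c ∈ 𝔽_q[t]`. -/
theorem IsDualTMotive.exists_map_smul_mem (hM : IsDualTMotive Fq M) {n : ℕ}
    (hn : ∀ m : M, ∃ m' : M,
      inclT Fq ((X - C (T Fq)) ^ n) • m = SkewPoly.sigma (KBar Fq)[X] • m')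
    (P : Submodule (KTSigma Fq) M)
    (hP : ∀ m ∈ P, ∃ m' ∈ P,
      inclT Fq ((X - C (T Fq)) ^ n) • m = SkewPoly.sigma (KBar Fq)[X] • m')
    {a₀ : (KBar Fq)[X]} (ha₀ : a₀ ≠ 0) (h₀ : ∀ m : M, inclT Fq a₀ • m ∈ P) :
    ∃ c : Fq[X], c ≠ 0 ∧ ∀ m : M, inclT Fq (c.map (algebraMap Fq (KBar Fq))) • m ∈ P := by
  obtain ⟨I, hI⟩ : ∃ I : Ideal (KBar Fq)[X], ∀ a, a ∈ I ↔ ∀ m : M, inclT Fq a • m ∈ P :=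
    ⟨{ carrier := {a | ∀ m : M, inclT Fq a • m ∈ P}
       add_mem' := fun ha hb m => by rw [map_add, add_smul]; exact P.add_mem (ha m) (hb m)
       zero_mem' := fun m => by rw [map_zero, zero_smul]; exact P.zero_mem
       smul_mem' := fun c a ha m => by
        rw [smul_eq_mul, map_mul, mul_smul]; exact P.smul_mem _ (ha m) }, fun _ => Iff.rfl⟩
  obtain ⟨a, ham, haI, hdvd⟩ : ∃ a : (KBar Fq)[X], a.Monic ∧ a ∈ I ∧ ∀ b ∈ I, a ∣ b := by
    have hg : Submodule.IsPrincipal.generator I ≠ 0 := fun h => ha₀ <| by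
      have h1 := (Submodule.IsPrincipal.mem_iff_generator_dvd I).mp ((hI a₀).mpr h₀)
      rwa [h, zero_dvd_iff] at h1
    refine ⟨_, monic_mul_leadingCoeff_inv hg,
      I.mul_mem_right _ (Submodule.IsPrincipal.generator_mem I), fun b hb => ?_⟩
    refine dvd_trans ?_ ((Submodule.IsPrincipal.mem_iff_generator_dvd I).mp hb)
    have hu : IsUnit (C (Submodule.IsPrincipal.generator I).leadingCoeff⁻¹) :=
      isUnit_C.mpr (isUnit_iff_ne_zero.mpr (inv_ne_zero (leadingCoeff_ne_zero.mpr hg)))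
    exact (hu.mul_right_dvd).mpr dvd_rfl
  -- I is the annihilator of M/P, with monic generator a. Since (t - T)^n m = σm', applying the
  -- twist of a gives σ(am') ∈ P.
  have h1 : (Multiplicative.ofAdd (1 : ℕ) • a) * (X - C (T Fq)) ^ n ∈ I := (hI _).mpr fun m => by
    obtain ⟨m', hm'⟩ := hn m
    rw [map_mul, mul_smul, hm', ← sigma_smul_inclT]
    exact P.smul_mem _ ((hI a).mp haI m')
  have h2 : (Multiplicative.ofAdd (1 : ℕ) • a) ∣ a * (X - C (T Fq)) ^ n := by
    obtain ⟨b, hb⟩ := (twistEquiv Fq).surjective (a * (X - C (T Fq)) ^ n)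
    -- Here b is the untwist of a(t - T)^n, so σ(bm) = (t - T)^n aσm lies in (t - T)^n P ⊂ σP, and σ
    -- is injective.
    have hbI : b ∈ I := (hI b).mpr fun m => by
      obtain ⟨p, hp, hpm⟩ := hP _ ((hI a).mp haI (SkewPoly.sigma (KBar Fq)[X] • m))
      have h1 : SkewPoly.sigma (KBar Fq)[X] • inclT Fq b • m = SkewPoly.sigma (KBar Fq)[X] • p := by
        rw [sigma_smul_inclT, ← twistEquiv_apply, hb, ← hpm, mul_comm, map_mul, mul_smul]
      rw [hM.sigma_smul_injective h1]
      exact hp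
    obtain ⟨d, rfl⟩ := hdvd b hbI
    refine ⟨Multiplicative.ofAdd (1 : ℕ) • d, ?_⟩
    rw [← hb, twistEquiv_apply, smul_mul']
  obtain ⟨c, hc⟩ := exists_map_eq_of_dvd_mul_pow Fq ham n (hdvd _ h1) h2
  refine ⟨c, fun h => ham.ne_zero (by rw [hc, h, Polynomial.map_zero]), fun m => ?_⟩
  rw [← hc]
  exact (hI a).mp haI m

/-- Up to isogeny, a torsion-closed complement provides a projection. -/
theorem IsDualTMotive.exists_projection (hM : IsDualTMotive Fq M) {N Q : Submodule (KTSigma Fq) M}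
    (hN : IsTorsionClosed Fq N) (hQ : IsTorsionClosed Fq Q) (hNQ : Disjoint N Q)
    {a : (KBar Fq)[X]} (ha : a ≠ 0) (h : ∀ m : M, inclT Fq a • m ∈ N ⊔ Q) :
    ∃ (c : Fq[X]) (π : Module.End (KTSigma Fq) M), c ≠ 0 ∧ (∀ m, π m ∈ N) ∧
      ∀ m ∈ N, π m = scalarEnd Fq M c m := by
  obtain ⟨n, hn⟩ := hM.pow_mem.exists
  obtain ⟨c, hc0, hc⟩ := hM.exists_map_smul_mem hn (N ⊔ Q) (fun m hm => by
    obtain ⟨x, hx, y, hy, rfl⟩ := Submodule.mem_sup.mp hm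
    obtain ⟨x', hx', hxx⟩ := hN.exists_eq_sigma_smul hM hn x hx
    obtain ⟨y', hy', hyy⟩ := hQ.exists_eq_sigma_smul hM hn y hy
    exact ⟨x' + y', Submodule.add_mem_sup hx' hy', by rw [smul_add, smul_add, hxx, hyy]⟩) ha h
  let ψ : N × Q →ₗ[KTSigma Fq] M := N.subtype.coprod Q.subtype
  have hψ : Function.Injective ψ := by
    rw [← LinearMap.ker_eq_bot, LinearMap.ker_coprod_of_disjoint_range, Submodule.ker_subtype,
      Submodule.ker_subtype, Submodule.prod_bot]
    simpa using hNQ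
  have hr : LinearMap.range ψ = N ⊔ Q := by simp [ψ, LinearMap.range_coprod]
  let s : M →ₗ[KTSigma Fq] LinearMap.range ψ :=
    (scalarEnd Fq M c).codRestrict _ fun m => by rw [hr]; exact hc m
  -- Multiplication by c lands in N ⊕ Q; π is its N-component.
  refine ⟨c, N.subtype ∘ₗ LinearMap.fst _ _ _ ∘ₗ
    (LinearEquiv.ofInjective ψ hψ).symm.toLinearMap ∘ₗ s, hc0, fun m => Submodule.coe_mem _,
    fun m hm => ?_⟩
  have h1 : s m = LinearEquiv.ofInjective ψ hψ
      (⟨scalarEnd Fq M c m, N.smul_mem _ hm⟩, 0) :=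
    Subtype.ext (by simp [s, ψ])
  simp only [LinearMap.comp_apply, h1, LinearEquiv.coe_coe, LinearEquiv.symm_apply_apply]
  rfl

/-- A saturated submodule is torsion-closed. -/
theorem IsSaturated.isTorsionClosed {N : Submodule (KTSigma Fq) M} (hN : IsSaturated Fq N) :
    IsTorsionClosed Fq N := by
  classical
  intro a m ha hm
  let N' : Submodule (KBar Fq)[X] (Res (inclT Fq) M) :=
    Submodule.span (KBar Fq)[X] {Res.of (inclT Fq) M m}
  have key : N' ≤ Res.submodule (inclT Fq) N := by
    rw [← hN.2]
    refine le_sSup ?_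
    -- Modulo N, multiples pm depend only on p modulo a, so the image of k̄[t]m is
    -- finite-dimensional and saturation applies.
    let f : (KBar Fq)[X] →ₗ[KBar Fq] Res (inclK Fq) (M ⧸ N) :=
      { toFun := fun p => Res.of (inclK Fq) (M ⧸ N) (N.mkQ (inclT Fq p • m))
        map_add' := fun p q => by rw [map_add, add_smul, map_add, map_add]
        map_smul' := fun c p => by
          rw [Polynomial.smul_eq_C_mul, map_mul, mul_smul, map_smul]
          rfl }
    have hf : ∀ p, f p = Res.of (inclK Fq) (M ⧸ N) (N.mkQ (inclT Fq p • m)) := fun _ => rfl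
    have hfg : ((degreeLT (KBar Fq) a.natDegree).map f).FG := by
      rw [degreeLT_eq_span_X_pow]
      exact Submodule.FG.map _ (Submodule.fg_span (Finset.finite_toSet _))
    have : Module.Finite (KBar Fq) ((degreeLT (KBar Fq) a.natDegree).map f) :=
      Module.Finite.iff_fg.mpr hfg
    refine hfg.of_le (Submodule.span_le.mpr ?_)
    rintro _ ⟨h, hh, rfl⟩
    obtain ⟨p, hp⟩ := Submodule.mem_span_singleton.mp hh
    have hp' : h = inclT Fq p • m := hp.symm
    refine ⟨p % a, mem_degreeLT.mpr ?_, ?_⟩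
    · rw [← degree_eq_natDegree ha]
      exact EuclideanDomain.mod_lt p ha
    · rw [hf, hp']
      congr 1
      rw [← sub_eq_zero, ← map_sub, Submodule.mkQ_apply, Submodule.Quotient.mk_eq_zero, ← sub_smul,
        ← map_sub, EuclideanDomain.mod_eq_sub_mul_div, sub_sub_cancel_left, mul_comm, map_neg,
        map_mul, neg_smul, mul_smul]
      exact N.neg_mem (N.smul_mem _ hm)
  exact key (Submodule.mem_span_singleton_self _)

end DualTMotive

/-! ### Complements up to isogeny -/

namespace DualTMotive

section Closure

variable {Fq : Type*} [Field Fq] [Fintype Fq] {M : Type*} [AddCommGroup M] [Module (KTSigma Fq) M]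

/-- The preimage of the `k̄[t]`-torsion of the quotient by `Q`. -/
def torsionClosure (Q : Submodule (KTSigma Fq) M) : Submodule (KTSigma Fq) M where
  carrier := {m | ∃ a : (KBar Fq)[X], a ≠ 0 ∧ inclT Fq a • m ∈ Q}
  add_mem' := by
    rintro x y ⟨a, ha, hx⟩ ⟨b, hb, hy⟩
    refine ⟨a * b, mul_ne_zero ha hb, ?_⟩
    rw [smul_add, map_mul, mul_smul, mul_smul (inclT Fq a), smul_smul, ← map_mul, mul_comm, map_mul,
      mul_smul]
    exact Q.add_mem (Q.smul_mem _ hx) (Q.smul_mem _ hy)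
  zero_mem' := ⟨1, one_ne_zero, by rw [smul_zero]; exact Q.zero_mem⟩
  smul_mem' r m hm := by
    induction r using SkewPoly.induction_on with
    | add x y hx hy =>
      obtain ⟨a, ha, hx⟩ := hx
      obtain ⟨b, hb, hy⟩ := hy
      refine ⟨a * b, mul_ne_zero ha hb, ?_⟩
      rw [add_smul, smul_add, map_mul, mul_smul, mul_smul (inclT Fq a), smul_smul, ← map_mul,
        mul_comm, map_mul, mul_smul]
      exact Q.add_mem (Q.smul_mem _ hx) (Q.smul_mem _ hy)
    | monomial p n =>
      have h : ∃ a : (KBar Fq)[X], a ≠ 0 ∧ inclT Fq a • SkewPoly.sigma (KBar Fq)[X] ^ n • m ∈ Q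
          := by
        induction n with
        | zero => simpa using hm
        | succ n ih =>
          obtain ⟨a, ha, h⟩ := ih
          refine ⟨twistEquiv Fq a, fun h => ha (by simpa using h), ?_⟩
          rw [pow_succ', mul_smul, twistEquiv_apply, ← sigma_smul_inclT]
          exact Q.smul_mem _ h
      obtain ⟨a, ha, h⟩ := h
      refine ⟨a, ha, ?_⟩
      have h1 : inclT Fq a • inclT Fq p • SkewPoly.sigma (KBar Fq)[X] ^ n • m ∈ Q := by
        rw [smul_smul, ← map_mul, mul_comm, map_mul, mul_smul]
        exact Q.smul_mem _ h
      rwa [← mul_smul (inclT Fq p)] at h1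

theorem mem_torsionClosure {Q : Submodule (KTSigma Fq) M} {m : M} :
    m ∈ torsionClosure Q ↔ ∃ a : (KBar Fq)[X], a ≠ 0 ∧ inclT Fq a • m ∈ Q := Iff.rfl

theorem le_torsionClosure (Q : Submodule (KTSigma Fq) M) : Q ≤ torsionClosure Q := fun m hm =>
  ⟨1, one_ne_zero, by rwa [map_one, one_smul]⟩

theorem isTorsionClosed_torsionClosure (Q : Submodule (KTSigma Fq) M) :
    IsTorsionClosed Fq (torsionClosure Q) := by
  rintro a m ha ⟨b, hb, h⟩
  exact ⟨b * a, mul_ne_zero hb ha, by rwa [map_mul, mul_smul]⟩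

theorem IsDualTMotive.smul_ne_zero (hM : IsDualTMotive Fq M) {a : (KBar Fq)[X]} (ha : a ≠ 0) {m : M}
    (hm : m ≠ 0) : inclT Fq a • m ≠ 0 := fun h => by
  have := hM.isTorsionFree
  have h1 : a • Res.of (inclT Fq) M m = 0 := h
  exact (smul_eq_zero.mp h1).elim ha hm

theorem IsDualTMotive.disjoint_torsionClosure (hM : IsDualTMotive Fq M)
    {N Q : Submodule (KTSigma Fq) M} (h : Disjoint N Q) : Disjoint N (torsionClosure Q) := by
  rw [Submodule.disjoint_def] at h ⊢
  rintro m hm ⟨a, ha, hmQ⟩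
  by_contra h0
  exact hM.smul_ne_zero ha h0 (h _ (N.smul_mem _ hm) hmQ)

theorem exists_maximal_disjoint (N : Submodule (KTSigma Fq) M) :
    ∃ Q, Disjoint N Q ∧ ∀ Q', Disjoint N Q' → Q ≤ Q' → Q' = Q := by
  obtain ⟨Q, -, hQ⟩ := zorn_le_nonempty₀ {Q : Submodule (KTSigma Fq) M | Disjoint N Q} (by
    intro c hc hch Q₀ hQ₀
    refine ⟨sSup c, ?_, fun z hz => le_sSup hz⟩
    exact (hch.directedOn.disjoint_sSup_right).mpr hc) ⊥ disjoint_bot_right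
  exact ⟨Q, hQ.1, fun Q' h1 h2 => le_antisymm (hQ.2 h1 h2) h2⟩

/-- A nonzero submodule of minimal rank is irreducible up to isogeny. -/
theorem IsDualTMotive.exists_minimal (hM : IsDualTMotive Fq M) [Nontrivial M] :
    ∃ N : Submodule (KTSigma Fq) M, N ≠ ⊥ ∧
      ∀ X ≤ N, X ≠ ⊥ → N ≤ torsionClosure X := by
  have := hM.finite_t
  have := hM.isTorsionFree
  let r : Submodule (KTSigma Fq) M → ℕ := fun N =>
    Module.finrank (KBar Fq)[X] (Res.submodule (inclT Fq) N)
  obtain ⟨N, hN, hmin⟩ := (measure r).wf.has_min {N : Submodule (KTSigma Fq) M | N ≠ ⊥}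
    ⟨⊤, top_ne_bot⟩
  refine ⟨N, hN, fun X hX hX0 m hm => ?_⟩
  let Y : Submodule (KBar Fq)[X] (Res.submodule (inclT Fq) N) :=
    (Res.submodule (inclT Fq) X).comap (Res.submodule (inclT Fq) N).subtype
  have hXN : Res.submodule (inclT Fq) X ≤ Res.submodule (inclT Fq) N := hX
  have hY : Module.finrank (KBar Fq)[X] Y = r X :=
    (Submodule.comapSubtypeEquivOfLe hXN).finrank_eq
  obtain ⟨a, ha, h⟩ := Submodule.exists_smul_mem_of_finrank_le Y
    (hY ▸ not_lt.mp (hmin X hX0))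
  exact ⟨a, ha, h ⟨Res.of (inclT Fq) M m, hm⟩⟩

/-- Finite generation gives the torsion quotient a common denominator. -/
theorem IsDualTMotive.exists_smul_mem (hM : IsDualTMotive Fq M) {P : Submodule (KTSigma Fq) M}
    (hP : torsionClosure P = ⊤) :
    ∃ a : (KBar Fq)[X], a ≠ 0 ∧ ∀ m : M, inclT Fq a • m ∈ P := by
  have := hM.finite_t
  let V := Res (inclT Fq) M ⧸ Res.submodule (inclT Fq) P
  have ht : Module.IsTorsion (KBar Fq)[X] V := fun v => by
    obtain ⟨m, rfl⟩ := Submodule.mkQ_surjective _ v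
    obtain ⟨a, ha, h⟩ := mem_torsionClosure.mp
      ((hP ▸ Submodule.mem_top : (Res.of (inclT Fq) M).symm m ∈ torsionClosure P))
    refine ⟨⟨a, mem_nonZeroDivisors_of_ne_zero ha⟩, ?_⟩
    exact (map_smul (Submodule.mkQ (Res.submodule (inclT Fq) P)) a m).symm.trans
      ((Submodule.Quotient.mk_eq_zero (Res.submodule (inclT Fq) P)).mpr h)
  obtain ⟨a, ha, ha0⟩ := Submodule.annihilator_top_inter_nonZeroDivisors ht
  refine ⟨a, nonZeroDivisors.ne_zero ha0, fun m => ?_⟩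
  refine (Submodule.Quotient.mk_eq_zero (Res.submodule (inclT Fq) P)).mp ?_
  exact (map_smul (Submodule.mkQ _) a (Res.of (inclT Fq) M m)).trans
    (Submodule.mem_annihilator.mp ha _ Submodule.mem_top)

end Closure

variable {Fq : Type*} [Field Fq] [Fintype Fq] {L : Type*} [CommRing L] [Algebra Fq[X] L]
  [Algebra Fq L] {H : Type*} [AddCommGroup H] [Module (LSigma Fq L) H]

theorem HasGCM.nontrivial (hL : IsGCMAlgebra Fq L) (hH : HasGCM Fq L H) : Nontrivial H := by
  have := hL.dedekind_bar
  by_contra h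
  rw [not_nontrivial_iff_subsingleton] at h
  have : Subsingleton (Res (inclLBar Fq L) H) := h
  have h1 := hH.rank_eq_one
  rw [rank_subsingleton'] at h1
  exact zero_ne_one h1

theorem inclL_smul_inclT_smul (z : KBar Fq) (x : L) (m : Bare Fq L H) :
    inclLBar Fq L (LBar.tmul Fq z x) • m = inclT Fq (C z) • toEnd Fq L H x m := by
  have h1 : inclLBar Fq L (LBar.tmul Fq z x) = bareHom Fq L (inclT Fq (C z)) * inclL Fq L x := by
    rw [bareHom_inclT, polyToLBar_C]
    change _ = inclLBar Fq L _ * inclLBar Fq L (LBar.tmul Fq 1 x)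
    rw [← map_mul, LBar.tmul_mul_tmul, mul_one, one_mul]
  rw [h1, mul_smul]
  rfl

variable [IsScalarTower Fq Fq[X] L]

/-- Every submodule of a motive with complex multiplication has a complement up to isogeny. -/
theorem HasGCM.exists_complement (hL : IsGCMAlgebra Fq L) (hH : HasGCM Fq L H)
    (N : Submodule (KTSigma Fq) (Bare Fq L H)) :
    ∃ Q : Submodule (KTSigma Fq) (Bare Fq L H), IsTorsionClosed Fq Q ∧ Disjoint N Q ∧
      ∃ a : (KBar Fq)[X], a ≠ 0 ∧ ∀ m : Bare Fq L H, inclT Fq a • m ∈ N ⊔ Q := by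
  have := hL.free
  have := hL.finite
  have := hL.dedekind_bar
  have := hH.isDualTMotive.finite_t
  have := hH.isTorsionFree
  have hM := hH.isDualTMotive
  have hnt := hH.nontrivial hL
  have : Nontrivial (Bare Fq L H) := hnt
  obtain ⟨Q, hNQ, hmax⟩ := exists_maximal_disjoint N
  have hQ : IsTorsionClosed Fq Q := by
    rw [← hmax _ (hM.disjoint_torsionClosure hNQ) (le_torsionClosure Q)]
    exact isTorsionClosed_torsionClosure Q
  refine ⟨Q, hQ, hNQ, hM.exists_smul_mem ?_⟩
  obtain ⟨N₁, hN₁, hmin⟩ := hM.exists_minimal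
  have key : ∀ (x : L), ∀ m ∈ N₁, toEnd Fq L H x m ∈ torsionClosure (N ⊔ Q) := fun x m hm => by
    -- If no nonzero element of N₁ were sent by x into N + Q, then Q + xN₁ would still be disjoint
    -- from N; maximality would give xN₁ ⊂ Q, contradicting the assumption. Minimality of N₁ then
    -- carries all of xN₁ into the torsion closure.
    have h1 : N₁ ⊓ (N ⊔ Q).comap (toEnd Fq L H x) ≠ ⊥ := fun h0 => by
      have h2 : Disjoint N (Q ⊔ N₁.map (toEnd Fq L H x)) := by
        rw [Submodule.disjoint_def]
        intro n hn hn'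
        obtain ⟨q, hq, y, ⟨n₁, hn₁, rfl⟩, rfl⟩ := Submodule.mem_sup.mp hn'
        have h3 : n₁ ∈ N₁ ⊓ (N ⊔ Q).comap (toEnd Fq L H x) := by
          refine ⟨hn₁, ?_⟩
          have := Submodule.add_mem_sup hn (Q.neg_mem hq)
          simpa using this
        rw [h0, Submodule.mem_bot] at h3
        rw [h3, map_zero, add_zero] at hn ⊢
        exact Submodule.disjoint_def.mp hNQ q hn hq
      have h3 := hmax _ h2 le_sup_left
      refine hN₁ (le_bot_iff.mp ?_)
      rw [← h0]
      exact le_inf le_rfl (Submodule.map_le_iff_le_comap.mp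
        ((le_sup_right.trans h3.le).trans le_sup_right))
    obtain ⟨a, ha, h⟩ := hmin _ inf_le_left h1 hm
    refine ⟨a, ha, ?_⟩
    rw [← map_smul]
    exact h.2
  obtain ⟨y, hy, hy0⟩ := Submodule.exists_mem_ne_zero_of_ne_bot hN₁
  -- H has rank one over L̄, so the L̄-multiples of a single nonzero y ∈ N₁ exhaust H up to torsion.
  have hz : ∀ z : LBar Fq L, inclLBar Fq L z • y ∈ torsionClosure (N ⊔ Q) := fun z => by
    induction z using LBar.induction_on with
    | zero => rw [map_zero, zero_smul]; exact Submodule.zero_mem _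
    | add z w hz hw => rw [map_add, add_smul]; exact Submodule.add_mem _ hz hw
    | tmul z x =>
      rw [inclL_smul_inclT_smul]
      exact Submodule.smul_mem _ _ (key x y hy)
  have hfr : Module.finrank (KBar Fq)[X] (Res (inclT Fq) (Bare Fq L H)) =
      Module.finrank (KBar Fq)[X] (LBar Fq L) := by
    rw [hH.finrank hL, finrank_LBar]
  obtain ⟨a, ha, h⟩ := (Module.rank_eq_one_of_finrank_eq (KBar Fq)[X] hfr).2
    (Res.of (inclT Fq) _ y) hy0
  refine eq_top_iff.mpr fun m _ => isTorsionClosed_torsionClosure _ a m ha ?_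
  obtain ⟨z, hz'⟩ := h (Res.of (inclT Fq) _ m)
  have hz'' : inclT Fq a • m = inclLBar Fq L z • y := hz'
  rw [hz'']
  exact hz z

/-! ### Tightness and simplicity of eH -/

section Sub

variable {K : Subalgebra Fq[X] L} (hK : ∀ x ∈ K, ∀ f : Module.End (KTSigma Fq) (Bare Fq L H),
  toEnd Fq L H x * f = f * toEnd Fq L H x)
  {e : Module.End (KTSigma Fq) (Bare Fq L H)} (he : e * e = e)

include he in
theorem hasTightGCM_fixedSubmodule (hKL : IsGCMAlgebra Fq K)
    (hH₀ : HasGCM Fq K (fixedSubmodule hK e))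
    (hprim : ∀ f, e * f * e = f → ∃ x : K, f = toEnd Fq L H x * e) :
    HasTightGCM Fq K (fixedSubmodule hK e) := by
  refine ⟨hH₀, fun x y hxy => ?_, fun g => ?_⟩
  · by_contra h
    have := hH₀.nontrivial hKL
    obtain ⟨m, hm⟩ := exists_ne (0 : fixedSubmodule hK e)
    refine hm (hH₀.toEnd_injective hKL (sub_ne_zero.mpr h) (a₁ := Res.of (bareHom Fq K) _ m)
      (a₂ := 0) ?_)
    rw [map_sub, hxy, sub_self]
    rfl
  · have hpi := LinearMap.congr_fun (fixedProj_comp_fixedIncl hK he)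
    -- Extending g by zero on the complementary summand gives an element of eRe = Ke.
    let f : Module.End (KTSigma Fq) (Bare Fq L H) := (fixedIncl hK).comp (g.comp (fixedProj hK he))
    have hf : e * f * e = f := LinearMap.ext fun m => by
      have h1 : ∀ m, e m = fixedIncl hK (fixedProj hK he m) := fun _ => rfl
      have h2 : ∀ m, fixedProj hK he (fixedIncl hK m) = m := hpi
      simp only [Module.End.mul_apply, h1, h2, f, LinearMap.comp_apply]
    obtain ⟨x, hx⟩ := hprim f hf
    refine ⟨x, LinearMap.ext fun m => fixedIncl_injective hK ?_⟩
    have h2 : fixedProj hK he (fixedIncl hK m) = m := hpi m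
    have h3 := LinearMap.congr_fun hx (fixedIncl hK m)
    have h4 : e (fixedIncl hK m) = fixedIncl hK m :=
      congrArg (fixedIncl hK) h2
    rw [Module.End.mul_apply, h4] at h3
    rw [fixedIncl_toEnd, ← h3]
    exact congrArg (fun m => fixedIncl hK (g m)) h2

include he in
theorem isSimpleMotive_fixedSubmodule (hL : IsGCMAlgebra Fq L) (hKL : IsGCMAlgebra Fq K)
    (hH : HasGCM Fq L H) (hH₀ : HasTightGCM Fq K (fixedSubmodule hK e)) :
    IsSimpleMotive Fq (Bare Fq K (fixedSubmodule hK e)) := by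
  have hnt := hH₀.nontrivial hKL
  refine ⟨hnt, fun N hN => or_iff_not_imp_left.mpr fun hN0 => ?_⟩
  have := hKL.free
  have := hKL.finite
  have := hKL.dedekind
  have hpi : ∀ m, fixedProj hK he (fixedIncl hK m) = m :=
    LinearMap.congr_fun (fixedProj_comp_fixedIncl hK he)
  have hN' := hN.isTorsionClosed
  -- N stays torsion-closed in H because eH is a direct summand of the torsion-free module H.
  have hN₁ : IsTorsionClosed Fq (N.map (fixedIncl hK)) := by
    rintro a m ha ⟨n, hn, h⟩
    have h1 : inclT Fq a • fixedProj hK he m ∈ N := by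
      rw [← map_smul, ← h, hpi]; exact hn
    refine ⟨_, hN' a _ ha h1, ?_⟩
    by_contra h2
    refine hH.isDualTMotive.smul_ne_zero ha (sub_ne_zero.mpr h2) ?_
    rw [smul_sub, ← map_smul, ← map_smul, ← h, hpi, sub_self]
  obtain ⟨Q, hQ, hNQ, a, ha, haM⟩ := hH.exists_complement hL (N.map (fixedIncl hK))
  obtain ⟨c, π, hc, hπ, hπN⟩ := hH.isDualTMotive.exists_projection hN₁ hQ hNQ ha haM
  -- The compression of π to eH is an endomorphism, so tightness makes it an element x of K. It maps
  -- eH into N, and x ≠ 0 because π is c on N ≠ 0.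
  obtain ⟨x, hx⟩ := hH₀.bijective.2 ((fixedProj hK he).comp (π.comp (fixedIncl hK)))
  have hxN : ∀ m, toEnd Fq K _ x m ∈ N := fun m => by
    rw [hx]
    obtain ⟨n, hn, h⟩ := hπ (fixedIncl hK m)
    rw [LinearMap.comp_apply, LinearMap.comp_apply, ← h, hpi]
    exact hn
  have hx0 : x ≠ 0 := fun h => by
    obtain ⟨m, hm, hm0⟩ := Submodule.exists_mem_ne_zero_of_ne_bot hN0
    have h1 := LinearMap.congr_fun hx m
    rw [LinearMap.comp_apply, LinearMap.comp_apply, hπN _ (Submodule.mem_map_of_mem hm),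
      scalarEnd_apply, map_smul, hpi, h, map_zero] at h1
    exact hH₀.isDualTMotive.smul_ne_zero
      ((Polynomial.map_ne_zero_iff (algebraMap Fq (KBar Fq)).injective).mpr hc) hm0 h1.symm
  -- As x divides a nonzero p ∈ 𝔽_q[t], also p maps eH into N, which is torsion-closed.
  obtain ⟨p, hp, y, hy⟩ := (Algebra.IsIntegral.isIntegral (R := Fq[X])
      x).isAlgebraic.exists_nonzero_dvd
    (mem_nonZeroDivisors_of_ne_zero hx0)
  refine eq_top_iff.mpr fun m _ => hN' _ m
    ((Polynomial.map_ne_zero_iff (algebraMap Fq (KBar Fq)).injective).mpr hp) ?_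
  rw [← scalarEnd_apply, ← toEnd_algebraMap, hy, map_mul, Module.End.mul_apply]
  exact hxN _

end Sub

end DualTMotive

end

open DualTMotive Polynomial in
theorem theorem4p4p5 (Fq : Type*) [Field Fq] [Fintype Fq]
    (L : Type*) [CommRing L] [Algebra Fq[X] L] [Algebra Fq L] [IsScalarTower Fq Fq[X] L]
    (hL : IsGCMAlgebra Fq L)
    (H : Type*) [AddCommGroup H] [Module (LSigma Fq L) H] (hH : HasGCM Fq L H)
    (hrat : IsRigidAnalyticallyTrivial Fq (Bare Fq L H)) :
    IsGCMAlgebra Fq (endCentralizer Fq L H) ∧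
      ∃ H₀ : Submodule (LSigma Fq (endCentralizer Fq L H))
          (Res (subLSigma Fq L (endCentralizer Fq L H)) H),
        HasTightGCM Fq (endCentralizer Fq L H) H₀ ∧
        IsSimpleMotive Fq (Bare Fq (endCentralizer Fq L H) H₀) ∧
        IsRigidAnalyticallyTrivial Fq (Bare Fq (endCentralizer Fq L H) H₀) ∧
        gcmType Fq L H =
          (gcmType Fq (endCentralizer Fq L H) H₀).map
            (subLBar Fq L (endCentralizer Fq L H)) := by
  have hKL := hH.isGCMAlgebra_endCentralizer hL
  have hK : ∀ x ∈ endCentralizer Fq L H, ∀ f, toEnd Fq L H x * f = f * toEnd Fq L H x :=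
    fun x hx => mem_endCentralizer.mp hx
  obtain ⟨e, he, ⟨n, a, b, hab⟩, hprim, hrank⟩ := hH.exists_idempotent hL hrat
  have hH₀ := hasGCM_fixedSubmodule hK he hL hKL hH hrat hrank
  have htight := hasTightGCM_fixedSubmodule hK he hKL hH₀ hprim
  exact ⟨hKL, fixedSubmodule hK e, htight,
    isSimpleMotive_fixedSubmodule hK he hL hKL hH htight,
    hrat.of_retract Fq (fixedIncl hK) (fixedProj hK he) (fixedProj_comp_fixedIncl hK he),
    gcmType_eq_map hK he hL hKL hH hH₀ a b hab⟩
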